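/- Let $k$ be an algebraically closed field with $\operatorname{char}(k)\neq 2,3$, let $\lambda\in k\setminus\{0,1\}$, and let $E$ be the elliptic curve $y^2=x(x-1)(x-\lambda)$ over $k$, with zero point $0_E$ the point at infinity. A normalized genus $2$ cover of degree $3$ of $E$ is a finite morphism $f:C\to E$ of degree $3$ over $k$, where $C$ is a smooth projective connected curve of genus $2$, such that $f_*(W_C)=2\,[0_E]+E[2]$ as divisors on $E$; here $W_C$ is the sum of the Weierstrass points of $C$ and $E[2]$ is the sum of the four points of order dividing $2$. Two such covers $f_1:C_1\to E$, $f_2:C_2\to E$ are isomorphic if there is an isomorphism $\varphi:C_1\to C_2$ over $k$ with $f_1=f_2\circ\varphi$. Let $\mathcal H_{E/k,3}(k)$ be the set of isomorphism classes. Let $\mathcal U$ be the set of covers $u:\mathbb P^1\to\mathbb P^1$ over $k$ of degree $3$ such that $0,1,\infty$ are ramification points of $u$ with $u(0)=0$, $u(1)=1$, $u(\infty)=\lambda$, and such that no ramification point of $u$ lies over $\infty$. For $p\in k$ put $$g_p(x)=x^3-px^2+(-2\lambda p+2p+3\lambda-3)x-(1-\lambda)(p-2).$$ Every $u\in\mathcal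 U$ is of the form $u(x)=\dfrac{\lambda(x-p)x^2}{g_p(x)}$ for some $p\in k$. For such $u$ and $p$, let $C$ be the smooth projective curve with function field $k(x,y)$ given by $$y^2=(x-p)(x-p+2)\bigl((2p-3)x-p+2\bigr)g_p(x).$$ Then, for each choice of the sign, the formula (in the affine coordinates of $E$) $$f_\pm(x,y)=\left(\frac{\lambda(x-p)x^2}{g_p(x)},\ \pm\frac{\lambda(\lambda-1)\,y\,x(x-1)}{g_p(x)^2}\right)$$ defines a normalized genus $2$ cover $f_\pm:C\to E$ of degree $3$; the covers $f_+$ and $f_-$ have the same isomorphism class, which depends only on $u$, and the map $$\chi:\mathcal U\to\mathcal H_{E/k,3}(k),\qquad u\mapsto[f_\pm:C\to E]$$ is a bijection. -/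

import Mathlib

open Polynomial

universe u

noncomputable section

/-! ## Smooth projective curves over an algebraically closed field

A smooth projective (connected) curve `C` over the algebraically closed field `k` is handled through
its function field `K`, a finitely generated extension of `k` of transcendence degree one.  The
closed points of `C` are the valuation rings of `K` over `k` (other than `K`), the local ring of `C`
at such a point is the valuation ring itself, and the covers `C → D` (the finite, equivalently the
non-constant, morphisms) are the embeddings of the function field of `D` into that of `C` over `k`,
with `P ↦ 𝒪_P ∩ k(D)` as the map on closed points. -/

/-- `K` is the function field of a smooth projective curve over `k`. -/
structure IsCurveField (k K : Type*) [Field k] [Field K] [Algebra k K] : Prop where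
  finitelyGenerated : Algebra.EssFiniteType k K
  trdeg_eq_one : Algebra.trdeg k K = 1

/-- The closed points of the smooth projective curve with function field `K`, each given by its
local ring. -/
@[ext]
structure CurvePoint (k K : Type*) [Field k] [Field K] [Algebra k K] where
  /-- the local ring at the point -/
  ring : ValuationSubring K
  algebraMap_mem : ∀ c : k, algebraMap k K c ∈ ring
  ne_top : ring ≠ ⊤

/-- A cover (finite morphism) from the curve with function field `L` to the curve with function
field `K`, given by the pull-back of rational functions. -/
@[ext]
structure CurveCover (k K L : Type*) [Field k] [Field K] [Field L] [Algebra k K] [Algebra k L] where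
  /-- the pull-back of rational functions -/
  pullback : K →ₐ[k] L
  finite : pullback.Finite

section Covers

variable {k K L : Type*} [Field k] [Field K] [Field L] [Algebra k K] [Algebra k L]

/-- The rational function `h` vanishes at `P`: it lies in the maximal ideal of the local ring. -/
def CurvePoint.Vanishes (P : CurvePoint k K) (h : K) : Prop :=
  h ∈ P.ring.nonunits

/-- The degree of a cover is the degree of the extension of function fields. -/
def CurveCover.degree (φ : CurveCover k K L) : ℕ :=
  letI : Algebra K L := φ.pullback.toRingHom.toAlgebra
  Module.finrank K L

theorem CurveCover.comap_ne_top (φ : CurveCover k K L) (P : CurvePoint k L) :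
    P.ring.comap φ.pullback.toRingHom ≠ ⊤ := by
  intro h
  apply P.ne_top
  rw [eq_top_iff]
  intro z _
  have hz : φ.pullback.toRingHom.IsIntegralElem z := φ.finite.to_isIntegral z
  have hK : ∀ a : K, φ.pullback a ∈ P.ring := fun a => by
    have : a ∈ P.ring.comap φ.pullback.toRingHom := h ▸ ValuationSubring.mem_top a
    exact this
  obtain ⟨p, hp, hpz⟩ := hz
  let ψ : K →+* P.ring := φ.pullback.toRingHom.codRestrict P.ring hK
  have hint : IsIntegral P.ring z := by
    refine ⟨p.map ψ, hp.map ψ, ?_⟩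
    rw [Polynomial.eval₂_map]
    exact hpz
  obtain ⟨y, hy⟩ := IsIntegrallyClosed.isIntegral_iff.mp hint
  rw [← hy]
  exact y.2

/-- The map on closed points induced by a cover. -/
def CurveCover.map (φ : CurveCover k K L) (P : CurvePoint k L) : CurvePoint k K where
  ring := P.ring.comap φ.pullback.toRingHom
  algebraMap_mem c := by
    have h := P.algebraMap_mem c
    rw [← φ.pullback.commutes c] at h
    exact h
  ne_top := φ.comap_ne_top P

/-- The homomorphism of local rings induced by a cover at a closed point. -/
def CurveCover.localHom (φ : CurveCover k K L) (P : CurvePoint k L) :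
    (φ.map P).ring →+* P.ring :=
  (φ.pullback.toRingHom.comp (φ.map P).ring.subtype).codRestrict P.ring fun a => a.2

/-- `P` is a ramification point of the cover: a uniformizer at the image of `P` vanishes at `P`
to order at least two. -/
def CurveCover.IsRamifiedAt (φ : CurveCover k K L) (P : CurvePoint k L) : Prop :=
  (IsLocalRing.maximalIdeal (φ.map P).ring).map (φ.localHom P) ≤
    IsLocalRing.maximalIdeal P.ring ^ 2

end Covers

section Genus

variable (k K : Type*) [Field k] [Field K] [Algebra k K]

/-- The global regular differentials of the curve with function field `K`: those rational
differentials which, at every closed point `P`, are sums of differentials `a db` with `a` and `b`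
in the local ring at `P`. -/
def regularDifferentials : Submodule k (Ω[K⁄k]) :=
  ⨅ P : CurvePoint k K,
    Submodule.span k {ω | ∃ a ∈ P.ring, ∃ b ∈ P.ring, ω = a • KaehlerDifferential.D k K b}

/-- The genus, the dimension of the space of global regular differentials. -/
def curveGenus : ℕ :=
  Module.finrank k (regularDifferentials k K)

variable {k K}

/-- The Weierstrass points of a curve of genus two: there is a rational function whose only pole is
`P`, and this pole has order at most two. -/
def CurvePoint.IsWeierstrass (P : CurvePoint k K) : Prop :=
  ∃ h : K, h ∉ P.ring ∧ (∀ Q : CurvePoint k K, Q ≠ P → h ∈ Q.ring) ∧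
    ∀ s t : K, P.Vanishes s → P.Vanishes t → s * t * h ∈ P.ring

end Genus

/-! ## The projective line -/

section Line

variable {k : Type*} [Field k]

/-- The closed point `a` of the affine line in the projective line, whose function field is `k(X)`:
its local ring belongs to the valuation given by the order of vanishing at `a`. -/
def linePoint (a : k) : CurvePoint k (RatFunc k) where
  ring := ((IsDedekindDomain.HeightOneSpectrum.mk (Ideal.span {X - C a})
    ((Ideal.span_singleton_prime (X_sub_C_ne_zero a)).mpr (prime_X_sub_C a))
    (by simpa using X_sub_C_ne_zero a)).valuation (RatFunc k)).valuationSubring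
  algebraMap_mem c := by
    rw [IsScalarTower.algebraMap_apply k k[X] (RatFunc k), Valuation.mem_valuationSubring_iff]
    exact IsDedekindDomain.HeightOneSpectrum.valuation_le_one _ _
  ne_top h := by
    have hmem : (algebraMap k[X] (RatFunc k) (X - C a))⁻¹ ∈
        (⊤ : ValuationSubring (RatFunc k)) := ValuationSubring.mem_top _
    rw [← h, Valuation.mem_valuationSubring_iff, map_inv₀, inv_le_one₀] at hmem
    · refine absurd hmem (not_le.mpr ?_)
      rw [IsDedekindDomain.HeightOneSpectrum.valuation_lt_one_iff_mem]
      exact Ideal.mem_span_singleton_self _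
    · rw [zero_lt_iff, Valuation.ne_zero_iff]
      exact (map_ne_zero_iff _ (RatFunc.algebraMap_injective k)).mpr (X_sub_C_ne_zero a)

open Classical in
/-- The point at infinity of the projective line: its local ring consists of the rational functions
whose numerator has at most the degree of the denominator. -/
def lineInfty : CurvePoint k (RatFunc k) where
  ring := (RatFunc.inftyValuation k).valuationSubring
  algebraMap_mem c := by
    rw [Valuation.mem_valuationSubring_iff]
    by_cases hc : c = 0
    · simp [hc]
    · rw [RatFunc.algebraMap_eq_C, RatFunc.inftyValuation.C k hc]
  ne_top h := by
    have hmem : (RatFunc.X : RatFunc k) ∈ (⊤ : ValuationSubring (RatFunc k)) :=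
      ValuationSubring.mem_top _
    rw [← h, Valuation.mem_valuationSubring_iff, RatFunc.inftyValuation.X] at hmem
    exact absurd hmem (by decide)

/-- The set `𝒰` of covers `u : ℙ¹ → ℙ¹` of degree three for which `0`, `1`, `∞` are ramification
points with `u(0) = 0`, `u(1) = 1`, `u(∞) = lam`, and without ramification points over `∞`. -/
def normalizedLineCovers (lam : k) : Set (CurveCover k (RatFunc k) (RatFunc k)) :=
  {φ | φ.degree = 3 ∧
    (φ.map (linePoint 0) = linePoint 0 ∧ φ.IsRamifiedAt (linePoint 0)) ∧
    (φ.map (linePoint 1) = linePoint 1 ∧ φ.IsRamifiedAt (linePoint 1)) ∧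
    (φ.map lineInfty = linePoint lam ∧ φ.IsRamifiedAt lineInfty) ∧
    ∀ P, φ.map P = lineInfty → ¬ φ.IsRamifiedAt P}

end Line

/-! ## The elliptic curve and its normalized covers of genus two -/

/-- The elliptic curve `E : y² = x (x - 1) (x - lam)`, the double cover of the projective line with
branch points `0`, `1`, `lam`, `∞`; its zero point is the point over `∞`. -/
def legendreCurve {k : Type*} [Field k] (lam : k) : WeierstrassCurve.Affine k where
  a₁ := 0
  a₂ := -(1 + lam)
  a₃ := 0
  a₄ := lam
  a₆ := 0

section Elliptic

variable {k : Type u} [Field k] (lam : k)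

/-- The function field of `E`. -/
abbrev LegendreField : Type u := (legendreCurve lam).FunctionField

/-- The coordinate function `x` on `E`, which gives the projection `i : E → ℙ¹`. -/
def legendreX : LegendreField lam :=
  algebraMap (legendreCurve lam).CoordinateRing (LegendreField lam)
    (WeierstrassCurve.Affine.CoordinateRing.mk (legendreCurve lam) (C X))

/-- The coordinate function `y` on `E`. -/
def legendreY : LegendreField lam :=
  algebraMap (legendreCurve lam).CoordinateRing (LegendreField lam)
    (WeierstrassCurve.Affine.CoordinateRing.mk (legendreCurve lam) X)

/-- The closed point `Q` of `E`, given by its local ring, is the point `T` of the group `E(k)`, given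
by its coordinates. -/
def IsLegendrePoint (Q : CurvePoint k (LegendreField lam)) : (legendreCurve lam).Point → Prop
  | .zero => legendreX lam ∉ Q.ring
  | .some a b _ => Q.Vanishes (legendreX lam - algebraMap k _ a) ∧
      Q.Vanishes (legendreY lam - algebraMap k _ b)

open Classical in
/-- The cover `f : C → E` is normalized: `f_* W = 2 [0] + E[2]`, where `W` is the divisor of
Weierstrass points of `C`.  The coefficients of the two divisors at each point `T` are compared. -/
def CurveCover.IsNormalized {K : Type*} [Field K] [Algebra k K]
    (f : CurveCover k (LegendreField lam) K) : Prop :=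
  ∀ T : (legendreCurve lam).Point,
    {P : CurvePoint k K | P.IsWeierstrass ∧ IsLegendrePoint lam (f.map P) T}.encard =
      (if T = 0 then 2 else 0) + (if 2 • T = 0 then 1 else 0)

/-- The normalized covers `f : C → E` of degree three by smooth projective curves of genus two. -/
structure NormalizedGenusTwoCover where
  /-- the function field of the curve `C` -/
  K : Type u
  [field : Field K]
  [algebra : Algebra k K]
  isCurveField : IsCurveField k K
  genus_eq : curveGenus k K = 2
  /-- the cover `f : C → E` -/
  cover : CurveCover k (LegendreField lam) K
  degree_eq : cover.degree = 3
  isNormalized : cover.IsNormalized lam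

attribute [instance] NormalizedGenusTwoCover.field NormalizedGenusTwoCover.algebra

/-- Two covers `f₁`, `f₂` are isomorphic if there is an isomorphism `φ : C₁ → C₂` of curves over `k`,
given by its pull-back `e`, with `f₁ = f₂ ∘ φ`. -/
instance hurwitzSetoid : Setoid (NormalizedGenusTwoCover lam) where
  r f₁ f₂ := ∃ e : f₂.K ≃ₐ[k] f₁.K,
    ∀ z, f₁.cover.pullback z = e (f₂.cover.pullback z)
  iseqv :=
    { refl := fun _ => ⟨AlgEquiv.refl, fun _ => rfl⟩
      symm := fun ⟨e, he⟩ => ⟨e.symm, fun z => by rw [he z, AlgEquiv.symm_apply_apply]⟩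
      trans := fun ⟨e, he⟩ ⟨e', he'⟩ => ⟨e'.trans e, fun z => by
        rw [he z, he' z, AlgEquiv.trans_apply]⟩ }

/-- The Hurwitz set `ℋ_{E/k,3}(k)` of isomorphism classes of normalized genus two covers of `E` of
degree three. -/
def HurwitzSet : Type (u + 1) := Quotient (hurwitzSetoid lam)

/-! ## The explicit covers -/

/-- The polynomial `g(1, x)` with the parameter `p`. -/
def gPoly (p : k) : k[X] :=
  X ^ 3 - C p * X ^ 2 + C (-2 * lam * p + 2 * p + 3 * lam - 3) * X - C ((1 - lam) * (p - 2))

/-- The rational function `lam (x - p) x² / g(1, x)`. -/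
def uFun (p : k) : RatFunc k :=
  algebraMap k[X] (RatFunc k) (C lam * (X - C p) * X ^ 2) /
    algebraMap k[X] (RatFunc k) (gPoly lam p)

/-- The polynomial `(x - p) (x - p + 2) ((2 p - 3) x - p + 2) g(1, x)`. -/
def sexticPoly (p : k) : k[X] :=
  (X - C p) * (X - C p + 2) * (C (2 * p - 3) * X - C p + 2) * gPoly lam p

/-- `f : C → E` is the cover given by the parameter `p` and the sign `ε`: the curve `C` is given by
`y² = (x - p) (x - p + 2) ((2 p - 3) x - p + 2) g(1, x)`, and, in the affine coordinates of `E`,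
`f (x, y) = (lam (x - p) x² / g(1, x), ε lam (lam - 1) y x (x - 1) / g(1, x)²)`. -/
def IsExplicitCover (p : k) (ε : ℤˣ) (f : NormalizedGenusTwoCover lam) : Prop :=
  ∃ x y : f.K, IntermediateField.adjoin k {x, y} = ⊤ ∧
    y ^ 2 = aeval x (sexticPoly lam p) ∧
    f.cover.pullback (legendreX lam) =
      aeval x (C lam * (X - C p) * X ^ 2) / aeval x (gPoly lam p) ∧
    f.cover.pullback (legendreY lam) =
      (ε : ℤ) * (algebraMap k f.K (lam * (lam - 1)) * y * x * (x - 1) / aeval x (gPoly lam p) ^ 2)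

end Elliptic

end

/-! The hyperelliptic involution `ι` of `C` lifts the inversion of `E`, that is `f ∘ ι = -f`. Hence
`f` descends to a map `u` of degree three between the quotients of `C` and `E`, both of which are
projective lines, and `C` is recovered from `u` by adjoining a square root of `u (u - 1) (u - lam)`.
The branch points of `C → ℙ¹`, whose preimages are the Weierstrass points, are therefore the points
of odd multiplicity in the fibres of `u` over `0`, `1`, `lam`, `∞`. Normalization asks for three
such points over `∞` and one over each of `0`, `1`, `lam`. In degree three this means that the fibre
over `∞` is reduced and that the other three have the form `β + 2 α`, where `α = β` is allowed.
Moving the three points `α` to `0`, `1`, `∞` turns `u` into an element of `𝒰`.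

The ramification conditions of `𝒰` are linear in the coefficients of numerator and denominator and
leave one parameter `p` (`exists_parameter`). What remains open is that numerator and denominator
are coprime and that `g` is squarefree, i.e. that the degree is three and nothing ramifies over `∞`
(`GoodParameter`). The residual points of the fibres over `0`, `1`, `lam` are the roots of the
linear factors of the sextic, and `g` gives the fibre over `∞`. So the sextic is `u (u - 1) (u -
lam)` up to squares.

Well-definedness (`exists_isExplicitCover`, `IsExplicitCover.equivalent`): genus and Weierstrass
points of the sextic model are computed after moving a branch point to infinity, and the two signs
differ by `ι`.

Surjectivity (`NormalizedGenusTwoCover.exists_isExplicitCover`): a Weierstrass point carries a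
function with a single pole of order at most two, and counting functions with poles there shows that
this function has degree two, which gives a quintic model (`exists_quintic_model`). If `ξ ∘ ι ≠ ξ`
for the coordinate `ξ` of `f`, the third point on the line through `f` and `f ∘ ι` is a point of `E`
over a rational function field, hence constant, and this contradicts the behaviour at a fixed pole
(`involution_legendre`). The normal form of the fibres follows (`exists_normal_form`,
`exists_goodParameter_of_pencil`).

Injectivity (`IsExplicitCover.parameter_eq`): the Weierstrass point over `0` is unique, so an
isomorphism of covers relates the two coordinates by a linear fractional transformation, and
compatibility with the two maps `u` makes the parameters equal (`eq_of_moebius`). -/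

noncomputable section

/-! ### Values of functions at a point. -/

namespace CurvePoint

variable {k K : Type*} [Field k] [Field K] [Algebra k K]

/-- The valuation of the local ring at a point. -/
abbrev val (P : CurvePoint k K) : Valuation K P.ring.ValueGroup := P.ring.valuation

variable (P : CurvePoint k K)

theorem mem_iff {z : K} : z ∈ P.ring ↔ P.val z ≤ 1 := (P.ring.valuation_le_one_iff z).symm

theorem not_mem_iff {z : K} : z ∉ P.ring ↔ 1 < P.val z := by rw [mem_iff, not_le]

theorem vanishes_iff {z : K} : P.Vanishes z ↔ P.val z < 1 := P.ring.mem_nonunits_iff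

theorem val_algebraMap_le (c : k) : P.val (algebraMap k K c) ≤ 1 := P.mem_iff.1 (P.algebraMap_mem c)

theorem val_algebraMap {c : k} (hc : c ≠ 0) : P.val (algebraMap k K c) = 1 := by
  refine le_antisymm (P.val_algebraMap_le c) ?_
  have h := P.val_algebraMap_le c⁻¹
  rw [map_inv₀, map_inv₀] at h
  have h0 : P.val (algebraMap k K c) ≠ 0 := by simpa using hc
  rwa [inv_le_one₀ (zero_lt_iff.2 h0)] at h

theorem val_ofNat_two (h2 : (2 : k) ≠ 0) : P.val (2 : K) = 1 := by
  have := P.val_algebraMap h2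
  rwa [map_ofNat] at this

theorem val_aeval_le {z : K} (hz : P.val z ≤ 1) (A : k[X]) : P.val (aeval z A) ≤ 1 := by
  rw [← mem_iff] at hz ⊢
  induction A using Polynomial.induction_on' with
  | add p q hp hq => rw [map_add]; exact add_mem hp hq
  | monomial n c =>
    rw [aeval_monomial]
    exact mul_mem (P.algebraMap_mem c) (pow_mem hz n)

/-- Congruence modulo the maximal ideal: `A - A(a)` is divisible by `X - a`, and the cofactor is
integral at `P`. -/
theorem val_aeval_sub_lt {z : K} {a : k} (hz : P.val (z - algebraMap k K a) < 1) (A : k[X]) :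
    P.val (aeval z A - algebraMap k K (A.eval a)) < 1 := by
  have hz' : P.val z ≤ 1 := by
    have := P.val.map_add (z - algebraMap k K a) (algebraMap k K a)
    rw [sub_add_cancel] at this
    exact this.trans (max_le hz.le (P.val_algebraMap_le a))
  obtain ⟨B, hB⟩ := Polynomial.X_sub_C_dvd_sub_C_eval (a := a) (p := A)
  have h := congrArg (aeval z) hB
  simp only [map_sub, aeval_C, map_mul, aeval_X] at h
  rw [h, map_mul]
  exact mul_lt_one_of_nonneg_of_lt_one_left zero_le hz (P.val_aeval_le hz' B)

theorem val_le_of_sub_lt {z : K} {a : k} (hz : P.val (z - algebraMap k K a) < 1) : P.val z ≤ 1 := by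
  have := P.val.map_add (z - algebraMap k K a) (algebraMap k K a)
  rw [sub_add_cancel] at this
  exact this.trans (max_le hz.le (P.val_algebraMap_le a))

/-- The value of a function at a point, compared with the valuation. -/
theorem val_eq_one_iff_of_sub_lt {z : K} {a : k} (hz : P.val (z - algebraMap k K a) < 1) :
    P.val z = 1 ↔ a ≠ 0 := by
  constructor
  · rintro h rfl
    simp [h] at hz
  · intro ha
    have := P.val.map_add_eq_of_lt_right (x := z - algebraMap k K a) (y := algebraMap k K a)
      (by rwa [P.val_algebraMap ha])
    rwa [sub_add_cancel, P.val_algebraMap ha] at this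

theorem val_lt_one_iff_of_sub_lt {z : K} {a : k} (hz : P.val (z - algebraMap k K a) < 1) :
    P.val z < 1 ↔ a = 0 := by
  rw [lt_iff_le_and_ne, and_iff_right (P.val_le_of_sub_lt hz), Ne,
    P.val_eq_one_iff_of_sub_lt hz, not_not]

theorem eq_of_sub_lt {z : K} {a b : k} (ha : P.val (z - algebraMap k K a) < 1)
    (hb : P.val (z - algebraMap k K b) < 1) : a = b := by
  by_contra hab
  have h1 := P.val.map_sub (z - algebraMap k K b) (z - algebraMap k K a)
  rw [sub_sub_sub_cancel_left, ← map_sub, P.val_algebraMap (sub_ne_zero.2 hab)] at h1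
  exact absurd h1 (not_le.2 (max_lt hb ha))

/-- Valuation rings are maximal for domination: if `z` were in the second ring only, `z⁻¹` would be
a nonunit of the first ring, hence of the second. -/
theorem ext_of_le {P Q : CurvePoint k K} (h : P.ring ≤ Q.ring)
    (h' : ∀ z, P.val z < 1 → Q.val z < 1) : P = Q := by
  apply CurvePoint.ext
  refine le_antisymm h fun z hz => ?_
  by_contra hzP
  rw [not_mem_iff] at hzP
  have h1 : P.val z⁻¹ < 1 := by rw [map_inv₀]; exact inv_lt_one_of_one_lt₀ hzP
  have h2 := h' _ h1
  rw [map_inv₀, inv_lt_one₀ (zero_lt_iff.2 fun h0 => ?_)] at h2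
  · exact absurd ((Q.mem_iff).1 hz) (not_le.2 h2)
  · rw [map_eq_zero] at h0
    rw [h0, map_zero] at hzP
    exact absurd hzP (not_lt.2 zero_le)

/-- The value of a polynomial at a pole. -/
theorem val_aeval_of_one_lt {z : K} (hz : 1 < P.val z) {A : k[X]} (hA : A ≠ 0) :
    P.val (aeval z A) = P.val z ^ A.natDegree := by
  have hz0 : z ≠ 0 := by
    rintro rfl
    rw [map_zero] at hz
    exact absurd hz (not_lt.2 zero_le)
  have key : aeval z⁻¹ A.reverse * z ^ A.natDegree = aeval z A := by
    let := invertibleOfNonzero hz0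
    have := eval₂_reverse_mul_pow (algebraMap k K) z A
    rwa [invOf_eq_inv] at this
  have hinv : P.val (z⁻¹ - algebraMap k K 0) < 1 := by
    rw [map_zero, sub_zero, map_inv₀]
    exact inv_lt_one_of_one_lt₀ hz
  have h1 := P.val_aeval_sub_lt hinv A.reverse
  rw [← coeff_zero_eq_eval_zero, coeff_zero_reverse] at h1
  have h2 := (P.val_eq_one_iff_of_sub_lt h1).2 (leadingCoeff_ne_zero.2 hA)
  rw [← key, map_mul, h2, one_mul, map_pow]

end CurvePoint

/-! ### Residue fields, poles and values of functions. -/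

namespace IsCurveField

variable {k K : Type*} [Field k] [Field K] [Algebra k K] 

theorem isAlgebraic_adjoin (hK : IsCurveField k K) {x : K} (hx : Transcendental k x) :
    Algebra.IsAlgebraic (IntermediateField.adjoin k {x}) K := by
  have hi : AlgebraicIndependent k (fun _ : Unit => x) := by
    rw [algebraicIndependent_unique_type_iff]; exact hx
  have hb := hi.isTranscendenceBasis_of_lift_trdeg_le_of_finite (by
    rw [hK.trdeg_eq_one]; simp)
  have := hb.isAlgebraic_field
  rwa [Set.range_const] at this

variable [IsAlgClosed k]

theorem exists_eq_algebraMap_of_isAlgebraic {x : K} (hx : IsAlgebraic k x) :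
    ∃ c : k, x = algebraMap k K c := by
  have := IntermediateField.isAlgebraic_adjoin_simple hx.isIntegral
  obtain ⟨c, hc⟩ := (IsAlgClosed.algebraMap_bijective_of_isIntegral (k := k)
    (K := IntermediateField.adjoin k {x})).2 ⟨x, IntermediateField.mem_adjoin_simple_self k x⟩
  exact ⟨c, (congrArg Subtype.val hc).symm⟩

/-- The residue field at a point is `k`. -/
theorem exists_sub_lt (hK : IsCurveField k K) (P : CurvePoint k K) {z : K} (hz : P.val z ≤ 1) :
    ∃ c : k, P.val (z - algebraMap k K c) < 1 := by
  by_contra! hc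
  -- If `z` has no residue in `k`, every linear polynomial in `z`, and so every nonzero polynomial,
  -- is a unit at `P`. Then `k(z)` lies in the local ring, which is integrally closed and `K` is
  -- algebraic over `k(z)`, so the local ring is all of `K`.
  have hA : ∀ A : k[X], A ≠ 0 → P.val (aeval z A) = 1 := by
    intro A hA
    have h := congrArg (fun B => P.val (aeval z B)) (IsAlgClosed.splits A).eq_prod_roots
    simp only [map_mul, aeval_C, map_multiset_prod, Multiset.map_map] at h
    rw [h, P.val_algebraMap (leadingCoeff_ne_zero.2 hA), one_mul]
    apply Multiset.prod_eq_one
    intro w hw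
    obtain ⟨a, -, rfl⟩ := Multiset.mem_map.1 hw
    have h1 : P.val (z - algebraMap k K a) ≤ 1 :=
      (P.val.map_sub _ _).trans (max_le hz (P.val_algebraMap_le a))
    simpa using le_antisymm h1 (hc a)
  have hzt : Transcendental k z := by
    intro halg
    obtain ⟨c, rfl⟩ := exists_eq_algebraMap_of_isAlgebraic halg
    simpa using hc c
  have := hK.isAlgebraic_adjoin hzt
  apply P.ne_top
  rw [eq_top_iff]
  intro w _
  have hmem : ∀ a : IntermediateField.adjoin k {z}, (a : K) ∈ P.ring := by
    rintro ⟨a, ha⟩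
    obtain ⟨A, B, rfl⟩ := (IntermediateField.mem_adjoin_simple_iff k a).1 ha
    by_cases hB : B = 0
    · simp [hB]
    · rw [P.mem_iff, map_div₀, hA B hB, div_one]
      exact P.val_aeval_le hz A
  obtain ⟨p, hp, hpw⟩ := (this.isAlgebraic w).isIntegral
  let ψ : IntermediateField.adjoin k {z} →+* P.ring :=
    (algebraMap (IntermediateField.adjoin k {z}) K).codRestrict P.ring hmem
  have h_integral : IsIntegral P.ring w := by
    refine ⟨p.map ψ, hp.map ψ, ?_⟩
    rw [Polynomial.eval₂_map]
    exact hpw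
  obtain ⟨y, hy⟩ := IsIntegrallyClosed.isIntegral_iff.mp h_integral
  rw [← hy]
  exact y.2

end IsCurveField

/-- A function that is not integral over `k[s]` has a pole at some point where `s` is regular. -/
theorem exists_curvePoint_not_mem {k K : Type*} [Field k] [Field K] [Algebra k K] {s : Set K}
    {z : K} (hz : ¬ IsIntegral (Algebra.adjoin k s) z) :
    ∃ P : CurvePoint k K, s ⊆ P.ring ∧ z ∉ P.ring := by
  by_contra! h
  apply hz
  have h1 : z ∈ (integralClosure (Subring.closure (Set.range (algebraMap k K) ∪ s)) K).toSubring := by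
    -- The integral closure of a subring is the intersection of the valuation rings containing it.
    -- All of these except the trivial one are points of the curve.
    rw [← iInf_valuationSubring_superset, Subring.mem_iInf]
    rintro ⟨V, hV⟩
    by_cases hT : V = ⊤
    · subst hT; exact ValuationSubring.mem_top z
    · exact h ⟨V, fun c => hV (Or.inl ⟨c, rfl⟩), hT⟩ fun a ha => hV (Or.inr ha)
  have h2 : IsIntegral (Subring.closure (Set.range (algebraMap k K) ∪ s)) z := h1
  rw [← Algebra.adjoin_eq_ring_closure] at h2
  exact h2


section Poles

variable {k K : Type*} [Field k] [Field K] [Algebra k K]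

/-- A non-constant function has a pole. -/
theorem exists_pole {z : K} (hz : Transcendental k z) : ∃ P : CurvePoint k K, z ∉ P.ring := by
  obtain ⟨P, -, hP⟩ := exists_curvePoint_not_mem (k := k) (s := ∅) (z := z) (by
    rw [Algebra.adjoin_empty]
    intro h
    have : IsIntegral k z := by
      obtain ⟨p, hp, hpz⟩ := h
      let e := Algebra.botEquiv k K
      refine ⟨p.map (e : (⊥ : Subalgebra k K) →+* k), hp.map _, ?_⟩
      have hcomp : (algebraMap k K).comp (e : (⊥ : Subalgebra k K) →+* k) =
          algebraMap (⊥ : Subalgebra k K) K := by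
        refine RingHom.ext fun a => ?_
        obtain ⟨c, rfl⟩ := e.symm.surjective a
        simp [e]
      rw [Polynomial.eval₂_map, hcomp]
      exact hpz
    exact hz this.isAlgebraic)
  exact ⟨P, hP⟩

theorem exists_eq_algebraMap_of_forall_mem [IsAlgClosed k] {z : K} (hz : ∀ P : CurvePoint k K, z ∈ P.ring) :
    ∃ c : k, z = algebraMap k K c := by
  refine IsCurveField.exists_eq_algebraMap_of_isAlgebraic ?_
  by_contra h
  obtain ⟨P, hP⟩ := exists_pole h
  exact hP (hz P)

/-- A non-constant function takes every value. -/
theorem exists_val_sub_lt {z : K} (hz : Transcendental k z) (a : k) :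
    ∃ P : CurvePoint k K, P.val (z - algebraMap k K a) < 1 := by
  -- A zero of `z - a` is a pole of its inverse.
  obtain ⟨P, hP⟩ := exists_pole (z := (z - algebraMap k K a)⁻¹) (by
    intro h
    apply hz
    have := h.inv.add (isAlgebraic_algebraMap a)
    rwa [inv_inv, sub_add_cancel] at this)
  refine ⟨P, ?_⟩
  rw [P.not_mem_iff, map_inv₀] at hP
  by_cases h0 : P.val (z - algebraMap k K a) = 0
  · rw [h0]; exact zero_lt_one
  · exact (one_lt_inv₀ (zero_lt_iff.2 h0)).1 hP

end Poles

end

noncomputable section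

/-! ### Charts and uniformizers. -/

namespace CurvePoint

variable {k K : Type*} [Field k] [Field K] [Algebra k K]

/-- The local ring at `P` is a localization of `R`, with uniformizer `t`. -/
structure IsChart (P : CurvePoint k K) (R : Subalgebra k K) (t : K) : Prop where
  val_le : ∀ r ∈ R, P.val r ≤ 1
  exists_div : ∀ z, ∃ r ∈ R, ∃ s ∈ R, s ≠ 0 ∧ z = r / s
  mem : t ∈ R
  val_lt : P.val t < 1
  ne_zero : t ≠ 0
  factor : ∀ r ∈ R, r ≠ 0 → ∃ n : ℕ, ∃ σ ∈ R, ∃ τ ∈ R,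
    P.val σ = 1 ∧ P.val τ = 1 ∧ τ * r = t ^ n * σ

/-- `t` generates the maximal ideal of the local ring at `P`, which is discretely valued. -/
def IsUniformizer (P : CurvePoint k K) (t : K) : Prop :=
  P.val t < 1 ∧ t ≠ 0 ∧ ∀ z : K, z ≠ 0 → ∃ n : ℤ, P.val z = P.val t ^ n

variable {P Q : CurvePoint k K} {R : Subalgebra k K} {t : K}

theorem IsUniformizer.val_le (h : P.IsUniformizer t) {z : K} (hz : P.val z < 1) :
    P.val z ≤ P.val t := by
  by_cases h0 : z = 0
  · simp [h0]
  obtain ⟨n, hn⟩ := h.2.2 z h0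
  have ht : 0 < P.val t := zero_lt_iff.2 (by simpa using h.2.1)
  rw [hn] at hz ⊢
  have : 0 < n := by
    by_contra hle
    exact absurd hz (not_lt.2 (one_le_zpow_of_nonpos₀ ht h.1.le (not_lt.1 hle)))
  calc P.val t ^ n ≤ P.val t ^ (1 : ℤ) := zpow_le_zpow_right_of_le_one₀ ht h.1.le this
    _ = P.val t := zpow_one _

/-- A function is a quotient of two elements of `R`, and `factor` gives each of them the value of a
power of `t`. -/
theorem IsChart.isUniformizer (h : P.IsChart R t) : P.IsUniformizer t := by
  refine ⟨h.val_lt, h.ne_zero, fun z hz => ?_⟩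
  obtain ⟨r, hr, s, hs, hs0, rfl⟩ := h.exists_div z
  have hr0 : r ≠ 0 := fun h => hz (by simp [h])
  obtain ⟨n, σ, -, τ, -, h1, h2, h3⟩ := h.factor r hr hr0
  obtain ⟨m, σ', -, τ', -, h1', h2', h3'⟩ := h.factor s hs hs0
  have e1 := congrArg P.val h3
  have e2 := congrArg P.val h3'
  rw [map_mul, map_mul, h1, h2, one_mul, mul_one, map_pow] at e1
  rw [map_mul, map_mul, h1', h2', one_mul, mul_one, map_pow] at e2
  have ht : P.val t ≠ 0 := by simpa using h.ne_zero
  exact ⟨n - m, by rw [map_div₀, e1, e2, zpow_sub₀ ht, zpow_natCast, zpow_natCast]⟩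

/-- Numerator and denominator are powers of `t` up to units. Integrality makes the exponent of the
numerator the larger one, so the power of `t` in the denominator cancels. -/
theorem IsChart.exists_div_of_mem (h : P.IsChart R t) {z : K} (hz : P.val z ≤ 1) :
    ∃ r ∈ R, ∃ s ∈ R, P.val s = 1 ∧ z = r / s := by
  by_cases hz0 : z = 0
  · exact ⟨0, zero_mem R, 1, one_mem R, map_one _, by simp [hz0]⟩
  obtain ⟨r, hr, s, hs, hs0, rfl⟩ := h.exists_div z
  have hr0 : r ≠ 0 := fun h => hz0 (by simp [h])
  obtain ⟨n, σ, hσ, τ, hτ, h1, h2, h3⟩ := h.factor r hr hr0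
  obtain ⟨m, σ', hσ', τ', hτ', h1', h2', h3'⟩ := h.factor s hs hs0
  have e1 := congrArg P.val h3
  have e2 := congrArg P.val h3'
  rw [map_mul, map_mul, h1, h2, one_mul, mul_one, map_pow] at e1
  rw [map_mul, map_mul, h1', h2', one_mul, mul_one, map_pow] at e2
  have ht : 0 < P.val t := zero_lt_iff.2 (by simpa using h.ne_zero)
  have hmn : m ≤ n := by
    by_contra hlt
    rw [map_div₀, e1, e2, div_le_one₀ (pow_pos ht m)] at hz
    exact absurd hz (not_le.2 (pow_lt_pow_right_of_lt_one₀ ht h.val_lt (not_le.1 hlt)))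
  obtain ⟨j, rfl⟩ := Nat.exists_eq_add_of_le hmn
  have n1 : τ ≠ 0 := fun h => by simp [h] at h2
  have n2 : τ' ≠ 0 := fun h => by simp [h] at h2'
  have n3 : σ' ≠ 0 := fun h => by simp [h] at h1'
  refine ⟨t ^ j * σ * τ', mul_mem (mul_mem (pow_mem h.mem j) hσ) hτ', τ * σ', mul_mem hτ hσ', ?_, ?_⟩
  · rw [map_mul, h2, h1', one_mul]
  · rw [div_eq_div_iff hs0 (mul_ne_zero n1 n3)]
    have ht0 := h.ne_zero
    apply mul_left_cancel₀ (pow_ne_zero m ht0)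
    linear_combination (t ^ m * σ') * h3 - (t ^ (m + j) * σ) * h3' 

/-- A point with a chart is determined by its centre on `R`: its local ring is the localization of
`R` there, and the local ring of `Q` dominates it. -/
theorem IsChart.eq (h : P.IsChart R t) (hle : ∀ r ∈ R, Q.val r ≤ 1)
    (hlt : ∀ r ∈ R, P.val r < 1 ↔ Q.val r < 1) : P = Q := by
  have key : ∀ s ∈ R, P.val s = 1 → Q.val s = 1 := fun s hs h1 =>
    le_antisymm (hle s hs) (not_lt.1 fun h2 => by simp [(hlt s hs).2 h2 |>.ne] at h1)
  apply ext_of_le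
  · intro z hz
    obtain ⟨r, hr, s, hs, h1, rfl⟩ := h.exists_div_of_mem (P.mem_iff.1 hz)
    rw [Q.mem_iff, map_div₀, key s hs h1, div_one]
    exact hle r hr
  · intro z hz
    obtain ⟨r, hr, s, hs, h1, rfl⟩ := h.exists_div_of_mem hz.le
    rw [map_div₀, h1, div_one] at hz
    rw [map_div₀, key s hs h1, div_one]
    exact (hlt r hr).1 hz

end CurvePoint

/-! ### Hyperelliptic equations and their affine points. -/

/-- A hyperelliptic equation `y² = d(x)` for the field `K`. -/
structure HyperellipticModel {k K : Type*} [Field k] [Field K] [Algebra k K]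
    (d : k[X]) (x y : K) : Prop where
  eq : y ^ 2 = aeval x d
  adjoin_eq_top : IntermediateField.adjoin k {x, y} = ⊤

namespace HyperellipticModel

variable {k K : Type*} [Field k] [Field K] [Algebra k K] {d : k[X]} {x y : K}

theorem transcendental (H : HyperellipticModel d x y) (hK : IsCurveField k K) :
    Transcendental k x := by
  intro hx
  have hy : IsAlgebraic k y := by
    have h := H.eq
    refine IsAlgebraic.of_pow (n := 2) two_pos ?_
    rw [h]
    have hm : aeval x d ∈ IntermediateField.adjoin k {x} :=
      (IntermediateField.mem_adjoin_simple_iff k _).2 ⟨d, 1, by simp⟩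
    have := IntermediateField.isAlgebraic_adjoin_simple hx.isIntegral
    exact (IntermediateField.isAlgebraic_iff).1 (this.isAlgebraic ⟨_, hm⟩)
  have : Algebra.IsAlgebraic k (IntermediateField.adjoin k {x, y}) := by
    apply IntermediateField.isAlgebraic_adjoin
    rintro z (rfl | rfl)
    exacts [hx.isIntegral, hy.isIntegral]
  rw [H.adjoin_eq_top] at this
  have h2 : Algebra.IsAlgebraic k K :=
    (IntermediateField.topEquiv (F := k) (E := K)).isAlgebraic_iff.1 this
  have := hK.trdeg_eq_one
  rw [trdeg_eq_zero_iff.2 h2] at this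
  exact zero_ne_one this

/-- The elements `a + b y` with `a`, `b` in `k(x)` form a field, inverses being obtained from the
conjugate `a - b y` and the norm. Irreducibility of the equation is not assumed. -/
theorem exists_eq_add_mul (H : HyperellipticModel d x y) (z : K) :
    ∃ a ∈ IntermediateField.adjoin k {x}, ∃ b ∈ IntermediateField.adjoin k {x}, z = a + b * y := by
  have hz : z ∈ IntermediateField.adjoin k {x, y} := H.adjoin_eq_top ▸ IntermediateField.mem_top
  have hd : aeval x d ∈ IntermediateField.adjoin k {x} :=
    (IntermediateField.mem_adjoin_simple_iff k _).2 ⟨d, 1, by simp⟩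
  induction hz using IntermediateField.adjoin_induction with
  | mem z hz =>
    rcases hz with rfl | rfl
    · exact ⟨_, IntermediateField.mem_adjoin_simple_self k _, 0, zero_mem _, by simp⟩
    · exact ⟨0, zero_mem _, 1, one_mem _, by simp⟩
  | algebraMap c => exact ⟨_, algebraMap_mem _ c, 0, zero_mem _, by simp⟩
  | add z w _ _ hz hw =>
    obtain ⟨a, ha, b, hb, rfl⟩ := hz
    obtain ⟨a', ha', b', hb', rfl⟩ := hw
    exact ⟨_, add_mem ha ha', _, add_mem hb hb', by ring⟩
  | mul z w _ _ hz hw =>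
    obtain ⟨a, ha, b, hb, rfl⟩ := hz
    obtain ⟨a', ha', b', hb', rfl⟩ := hw
    refine ⟨_, add_mem (mul_mem ha ha') (mul_mem (mul_mem hb hb') hd), _,
      add_mem (mul_mem ha hb') (mul_mem ha' hb), ?_⟩
    rw [← H.eq]
    ring
  | inv z _ hz =>
    obtain ⟨a, ha, b, hb, rfl⟩ := hz
    by_cases h1 : a + b * y = 0
    · exact ⟨0, zero_mem _, 0, zero_mem _, by simp [h1]⟩
    -- If the conjugate vanishes, the norm is useless, but then the element equals `2 a` and lies in
    -- `k(x)`.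
    by_cases h2 : a - b * y = 0
    · refine ⟨(a + a)⁻¹, inv_mem (add_mem ha ha), 0, zero_mem _, ?_⟩
      rw [← sub_eq_zero.1 h2, zero_mul, add_zero]
    · have hN : a ^ 2 - b ^ 2 * aeval x d ∈ IntermediateField.adjoin k {x} :=
        sub_mem (pow_mem ha 2) (mul_mem (pow_mem hb 2) hd)
      have hN' : a ^ 2 - b ^ 2 * aeval x d = (a + b * y) * (a - b * y) := by rw [← H.eq]; ring
      refine ⟨a / (a ^ 2 - b ^ 2 * aeval x d), div_mem ha hN, -b / (a ^ 2 - b ^ 2 * aeval x d),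
        div_mem (neg_mem hb) hN, ?_⟩
      rw [hN']
      field_simp
      ring

theorem exists_eq_div (H : HyperellipticModel d x y) (hx : Transcendental k x) (z : K) :
    ∃ A B D : k[X], D ≠ 0 ∧ z = (aeval x A + aeval x B * y) / aeval x D := by
  obtain ⟨a, ha, b, hb, rfl⟩ := H.exists_eq_add_mul z
  have key : ∀ a ∈ IntermediateField.adjoin k {x},
      ∃ A B : k[X], B ≠ 0 ∧ a = aeval x A / aeval x B := by
    intro a ha
    obtain ⟨A, B, rfl⟩ := (IntermediateField.mem_adjoin_simple_iff k a).1 ha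
    by_cases hB : B = 0
    · exact ⟨0, 1, one_ne_zero, by simp [hB]⟩
    · exact ⟨A, B, hB, rfl⟩
  obtain ⟨A, D, hD, rfl⟩ := key a ha
  obtain ⟨B, E, hE, rfl⟩ := key b hb
  have h1 : aeval x D ≠ 0 := fun h => hD ((transcendental_iff.1 hx) D h)
  have h2 : aeval x E ≠ 0 := fun h => hE ((transcendental_iff.1 hx) E h)
  refine ⟨A * E, B * D, D * E, mul_ne_zero hD hE, ?_⟩
  simp only [map_mul]
  field_simp

theorem mem_adjoin_iff (H : HyperellipticModel d x y) {z : K} :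
    z ∈ Algebra.adjoin k {x, y} ↔ ∃ A B : k[X], z = aeval x A + aeval x B * y := by
  have hp : ∀ A : k[X], aeval x A ∈ Algebra.adjoin k {x, y} := fun A =>
    Algebra.adjoin_mono (by simp) (aeval_mem_adjoin_singleton k x)
  constructor
  · intro hz
    induction hz using Algebra.adjoin_induction with
    | mem z hz =>
      rcases hz with rfl | rfl
      · exact ⟨X, 0, by simp⟩
      · exact ⟨0, 1, by simp⟩
    | algebraMap c => exact ⟨C c, 0, by simp⟩
    | add z w _ _ hz hw =>
      obtain ⟨A, B, rfl⟩ := hz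
      obtain ⟨A', B', rfl⟩ := hw
      exact ⟨A + A', B + B', by simp only [map_add]; ring⟩
    | mul z w _ _ hz hw =>
      obtain ⟨A, B, rfl⟩ := hz
      obtain ⟨A', B', rfl⟩ := hw
      refine ⟨A * A' + B * B' * d, A * B' + A' * B, ?_⟩
      simp only [map_add, map_mul, ← H.eq]
      ring
  · rintro ⟨A, B, rfl⟩
    exact add_mem (hp A) (mul_mem (hp B) (Algebra.subset_adjoin (by simp)))

theorem val_y_le (H : HyperellipticModel d x y) (P : CurvePoint k K) (hx : P.val x ≤ 1) :
    P.val y ≤ 1 := by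
  have h := P.val_aeval_le hx d
  rw [← H.eq, map_pow] at h
  exact (pow_le_one_iff_of_nonneg zero_le two_ne_zero).1 h

variable [IsAlgClosed k]

theorem exists_coordinates (H : HyperellipticModel d x y) (hK : IsCurveField k K)
    (P : CurvePoint k K) (hx : P.val x ≤ 1) :
    ∃ a b : k, P.val (x - algebraMap k K a) < 1 ∧ P.val (y - algebraMap k K b) < 1 := by
  obtain ⟨a, ha⟩ := hK.exists_sub_lt P hx
  obtain ⟨b, hb⟩ := hK.exists_sub_lt P (H.val_y_le P hx)
  exact ⟨a, b, ha, hb⟩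

end HyperellipticModel

namespace HyperellipticModel

variable {k K : Type*} [Field k] [Field K] [Algebra k K] {d : k[X]} {x y : K}

theorem val_sub_lt (P : CurvePoint k K) {a b : k} (ha : P.val (x - algebraMap k K a) < 1)
    (hb : P.val (y - algebraMap k K b) < 1) (A B : k[X]) :
    P.val (aeval x A + aeval x B * y - algebraMap k K (A.eval a + B.eval a * b)) < 1 := by
  have h1 := P.val_aeval_sub_lt ha A
  have h2 := P.val_aeval_sub_lt ha B
  have : aeval x A + aeval x B * y - algebraMap k K (A.eval a + B.eval a * b) =
      (aeval x A - algebraMap k K (A.eval a)) + ((aeval x B - algebraMap k K (B.eval a)) * y +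
        algebraMap k K (B.eval a) * (y - algebraMap k K b)) := by
    simp only [map_add, map_mul]; ring
  rw [this]
  refine P.val.map_add_lt h1 (P.val.map_add_lt ?_ ?_)
  · rw [map_mul]
    exact mul_lt_one_of_nonneg_of_lt_one_left zero_le h2 (P.val_le_of_sub_lt hb)
  · rw [map_mul]
    exact mul_lt_one_of_nonneg_of_lt_one_right (P.val_algebraMap_le _) zero_le hb

theorem eval_eq_sq (H : HyperellipticModel d x y) (P : CurvePoint k K) {a b : k}
    (ha : P.val (x - algebraMap k K a) < 1) (hb : P.val (y - algebraMap k K b) < 1) :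
    d.eval a = b ^ 2 := by
  have h1 := P.val_aeval_sub_lt ha d
  have h2 := P.val_aeval_sub_lt hb (X ^ 2)
  simp only [map_pow, aeval_X, eval_pow, eval_X] at h2
  rw [← H.eq] at h1
  rw [← map_pow] at h2
  exact P.eq_of_sub_lt h1 h2

/-- A product decomposition of the elements of `k[x, y]`. -/
theorem exists_eq_mul_add {z : K} {A B : k[X]} (hz : z = aeval x A + aeval x B * y) (hz0 : z ≠ 0)
    (a : k) : ∃ (n : ℕ) (q A' B' : k[X]), q.eval a ≠ 0 ∧ (A'.eval a ≠ 0 ∨ B'.eval a ≠ 0) ∧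
      z = (x - algebraMap k K a) ^ n * aeval x q * (aeval x A' + aeval x B' * y) := by
  classical
  -- The gcd of `A` and `B` is split as a power of `X - a` times `q`. The Bézout identity for the
  -- cofactors prevents both of them from vanishing at `a`.
  have hg : EuclideanDomain.gcd A B ≠ 0 := by
    intro h
    obtain ⟨rfl, rfl⟩ := EuclideanDomain.gcd_eq_zero_iff.1 h
    simp at hz
    exact hz0 hz
  obtain ⟨A', hA'⟩ := EuclideanDomain.gcd_dvd_left A B
  obtain ⟨B', hB'⟩ := EuclideanDomain.gcd_dvd_right A B
  have hbez := EuclideanDomain.gcd_eq_gcd_ab A B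
  generalize EuclideanDomain.gcdA A B = α at hbez
  generalize EuclideanDomain.gcdB A B = β at hbez
  generalize EuclideanDomain.gcd A B = g at *
  obtain ⟨q, hq, hqa⟩ := exists_eq_pow_rootMultiplicity_mul_and_not_dvd g hg a
  generalize rootMultiplicity a g = n at hq
  rw [dvd_iff_isRoot, IsRoot.def] at hqa
  refine ⟨n, q, A', B', hqa, ?_, ?_⟩
  · by_contra! h
    have h1 : g * (A' * α + B' * β) = g * 1 := by
      rw [hA', hB'] at hbez
      linear_combination -hbez
    have h2 := congrArg (eval a) (mul_left_cancel₀ hg h1)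
    simp [h.1, h.2] at h2
  · rw [hz, hA', hB', hq]
    simp only [map_mul, map_pow, map_sub, aeval_X, aeval_C]
    ring

theorem val_eq_one (P : CurvePoint k K) {a b : k} (ha : P.val (x - algebraMap k K a) < 1)
    (hb : P.val (y - algebraMap k K b) < 1) {A B : k[X]} (h : A.eval a + B.eval a * b ≠ 0) :
    P.val (aeval x A + aeval x B * y) = 1 :=
  (P.val_eq_one_iff_of_sub_lt (val_sub_lt P ha hb A B)).2 h

theorem val_aeval_eq_one (P : CurvePoint k K) {a : k} (ha : P.val (x - algebraMap k K a) < 1)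
    {A : k[X]} (h : A.eval a ≠ 0) : P.val (aeval x A) = 1 :=
  (P.val_eq_one_iff_of_sub_lt (P.val_aeval_sub_lt ha A)).2 h

theorem isChart_aux (H : HyperellipticModel d x y) (hx : Transcendental k x) (P : CurvePoint k K)
    (hxP : P.val x ≤ 1) :
    (∀ r ∈ Algebra.adjoin k {x, y}, P.val r ≤ 1) ∧
    ∀ z, ∃ r ∈ Algebra.adjoin k {x, y}, ∃ s ∈ Algebra.adjoin k {x, y}, s ≠ 0 ∧ z = r / s := by
  constructor
  · intro r hr
    obtain ⟨A, B, rfl⟩ := H.mem_adjoin_iff.1 hr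
    refine P.val.map_add_le (P.val_aeval_le hxP A) ?_
    rw [map_mul]
    exact mul_le_one₀ (P.val_aeval_le hxP B) zero_le (H.val_y_le P hxP)
  · intro z
    obtain ⟨A, B, D, hD, rfl⟩ := H.exists_eq_div hx z
    exact ⟨_, H.mem_adjoin_iff.2 ⟨A, B, rfl⟩, _, H.mem_adjoin_iff.2 ⟨D, 0, by simp⟩,
      fun h => hD ((transcendental_iff.1 hx) D h), rfl⟩

theorem sub_algebraMap_ne_zero (hx : Transcendental k x) (a : k) : x - algebraMap k K a ≠ 0 := by
  intro h
  apply X_sub_C_ne_zero a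
  apply (transcendental_iff.1 hx)
  simpa using h

/-- Away from the zeros of `y`, the function `x - a` is a uniformizer. -/
theorem isChart_of_ne_zero (H : HyperellipticModel d x y) (hx : Transcendental k x)
    (h2 : (2 : k) ≠ 0) (P : CurvePoint k K) {a b : k} (ha : P.val (x - algebraMap k K a) < 1)
    (hb : P.val (y - algebraMap k K b) < 1) (hb0 : b ≠ 0) :
    P.IsChart (Algebra.adjoin k {x, y}) (x - algebraMap k K a) := by
  have hxP := P.val_le_of_sub_lt ha
  obtain ⟨h_le, h_div⟩ := H.isChart_aux hx P hxP
  have hpoly : ∀ A : k[X], aeval x A ∈ Algebra.adjoin k {x, y} := fun A =>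
    H.mem_adjoin_iff.2 ⟨A, 0, by simp⟩
  refine ⟨h_le, h_div, by
    have := hpoly (X - C a)
    rwa [map_sub, aeval_X, aeval_C] at this, ha, sub_algebraMap_ne_zero hx a, ?_⟩
  intro r hr hr0
  obtain ⟨A, B, hAB⟩ := H.mem_adjoin_iff.1 hr
  obtain ⟨n, q, A', B', hq, hA'B', rfl⟩ := exists_eq_mul_add hAB hr0 a
  -- When `A' + B' y` vanishes at `(a, b)`, the conjugate does not, because `2` and `b` are nonzero
  -- and `A'`, `B'` have no common zero at `a`. Multiplication by this unit yields the norm `N` in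
  -- `k[x]`, whose order is its multiplicity at `a`.
  by_cases h1 : A'.eval a + B'.eval a * b = 0
  · have h3 : A'.eval a + (-B').eval a * b ≠ 0 := by
      intro h3
      rw [eval_neg] at h3
      have e1 : 2 * A'.eval a = 0 := by linear_combination h1 + h3
      have e2 : 2 * (B'.eval a * b) = 0 := by linear_combination h1 - h3
      simp only [mul_eq_zero, h2, hb0, false_or, or_false] at e1 e2
      exact hA'B'.elim (fun h => h e1) fun h => h e2
    have hτ := val_eq_one P ha hb h3
    set N : k[X] := A' ^ 2 - B' ^ 2 * d with hN
    have hNx : aeval x N = (aeval x A' + aeval x (-B') * y) * (aeval x A' + aeval x B' * y) := by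
      simp only [hN, map_sub, map_mul, map_pow, ← H.eq, map_neg]
      ring
    have hN0 : N ≠ 0 := by
      intro h0
      rw [h0, map_zero] at hNx
      rcases mul_eq_zero.1 hNx.symm with h | h
      · rw [h, map_zero] at hτ
        exact zero_ne_one hτ
      · exact hr0 (by rw [h, mul_zero])
    obtain ⟨q', hq', hqa'⟩ := exists_eq_pow_rootMultiplicity_mul_and_not_dvd N hN0 a
    rw [dvd_iff_isRoot, IsRoot.def] at hqa'
    refine ⟨n + rootMultiplicity a N, aeval x (q * q'), hpoly _, _,
      H.mem_adjoin_iff.2 ⟨A', -B', rfl⟩, ?_, hτ, ?_⟩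
    · exact val_aeval_eq_one P ha (by rw [eval_mul]; exact mul_ne_zero hq hqa')
    · have e : aeval x N = (x - algebraMap k K a) ^ (rootMultiplicity a N) * aeval x q' := by
        conv_lhs => rw [hq']
        simp
      rw [map_mul, pow_add]
      linear_combination (x - algebraMap k K a) ^ n * aeval x q * (e - hNx)
  · refine ⟨n, aeval x q * (aeval x A' + aeval x B' * y), mul_mem (hpoly q)
      (H.mem_adjoin_iff.2 ⟨A', B', rfl⟩), 1, one_mem _, ?_, map_one _, by ring⟩
    rw [map_mul, val_aeval_eq_one P ha hq, val_eq_one P ha hb h1, one_mul]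

/-- At a simple root of `d`, the function `y` is a uniformizer. -/
theorem isChart_of_root (H : HyperellipticModel d x y) (hx : Transcendental k x)
    (P : CurvePoint k K) {a : k} (ha : P.val (x - algebraMap k K a) < 1)
    (hda : d.eval a = 0) (hd' : d.derivative.eval a ≠ 0) :
    P.IsChart (Algebra.adjoin k {x, y}) y := by
  have hxP := P.val_le_of_sub_lt ha
  obtain ⟨h_le, h_div⟩ := H.isChart_aux hx P hxP
  have hpoly : ∀ A : k[X], aeval x A ∈ Algebra.adjoin k {x, y} := fun A =>
    H.mem_adjoin_iff.2 ⟨A, 0, by simp⟩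
  have hymem : y ∈ Algebra.adjoin k {x, y} := Algebra.subset_adjoin (by simp)
  have hb : P.val (y - algebraMap k K 0) < 1 := by
    have h := P.val_aeval_sub_lt ha d
    rw [hda, map_zero, sub_zero, ← H.eq, map_pow] at h
    rw [map_zero, sub_zero]
    exact (pow_lt_one_iff_of_nonneg zero_le two_ne_zero).1 h
  -- With `d = (X - a) d₁` the equation reads `d₁(x) (x - a) = y²`, where `d₁(x)` is a unit, so `x -
  -- a` may be traded for `y²`.
  obtain ⟨d₁, hd₁⟩ := dvd_iff_isRoot.2 hda
  have hd₁a : d₁.eval a ≠ 0 := by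
    rw [hd₁] at hd'
    simpa using hd'
  have hv₁ := val_aeval_eq_one P ha hd₁a
  have hy2 : aeval x d₁ * (x - algebraMap k K a) = y ^ 2 := by
    rw [H.eq, hd₁]; simp; ring
  have hd0 : d ≠ 0 := by rintro rfl; simp at hd'
  have hy0 : y ≠ 0 := by
    rintro rfl
    apply hd0
    apply (transcendental_iff.1 hx)
    rw [← H.eq]; simp
  refine ⟨h_le, h_div, hymem, by simpa using hb, hy0, ?_⟩
  intro r hr hr0
  obtain ⟨A, B, hAB⟩ := H.mem_adjoin_iff.1 hr
  obtain ⟨n, q, A', B', hq, hA'B', rfl⟩ := exists_eq_mul_add hAB hr0 a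
  have hpow : aeval x d₁ ^ n * (x - algebraMap k K a) ^ n = y ^ (2 * n) := by
    rw [← mul_pow, hy2, pow_mul]
  -- If `A'` vanishes at `a`, another factor `y` splits off from `A' + B' y` and the order is odd.
  -- Otherwise `A' + B' y` is a unit and the order is even.
  by_cases h1 : A'.eval a = 0
  · have h2 : B'.eval a ≠ 0 := hA'B'.resolve_left (not_not.2 h1)
    obtain ⟨A'', hA''⟩ := dvd_iff_isRoot.2 h1
    have e : aeval x d₁ * (aeval x A' + aeval x B' * y) =
        y * (aeval x (d₁ * B') + aeval x A'' * y) := by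
      rw [hA'']; simp only [map_mul, map_sub, aeval_X, aeval_C]
      linear_combination aeval x A'' * hy2
    refine ⟨2 * n + 1, aeval x q * (aeval x (d₁ * B') + aeval x A'' * y), mul_mem (hpoly q)
      (H.mem_adjoin_iff.2 ⟨_, _, rfl⟩), aeval x d₁ ^ (n + 1), pow_mem (hpoly _) _, ?_, ?_, ?_⟩
    · rw [map_mul, val_aeval_eq_one P ha hq, one_mul]
      exact val_eq_one P ha hb (by rw [mul_zero, add_zero, eval_mul]; exact mul_ne_zero hd₁a h2)
    · rw [map_pow, hv₁, one_pow]
    · rw [pow_succ, pow_succ]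
      linear_combination aeval x q * (aeval x d₁ * (aeval x A' + aeval x B' * y)) * hpow +
        y ^ (2 * n) * aeval x q * e
  · refine ⟨2 * n, aeval x q * (aeval x A' + aeval x B' * y), mul_mem (hpoly q)
      (H.mem_adjoin_iff.2 ⟨A', B', rfl⟩), aeval x d₁ ^ n, pow_mem (hpoly _) _, ?_, ?_, ?_⟩
    · rw [map_mul, val_aeval_eq_one P ha hq, val_eq_one P ha hb (by simpa using h1), one_mul]
    · rw [map_pow, hv₁, one_pow]
    · linear_combination aeval x q * (aeval x A' + aeval x B' * y) * hpow

/-- The hypothesis `hs` is the Jacobian criterion for `y² - d(x)` at `(a, b)`, as `2 b` is nonzero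
exactly when `b` is. -/
theorem exists_isChart (H : HyperellipticModel d x y) (hx : Transcendental k x)
    (h2 : (2 : k) ≠ 0) (P : CurvePoint k K) {a b : k} (ha : P.val (x - algebraMap k K a) < 1)
    (hb : P.val (y - algebraMap k K b) < 1) (hs : b ≠ 0 ∨ d.derivative.eval a ≠ 0) :
    ∃ t, P.IsChart (Algebra.adjoin k {x, y}) t := by
  by_cases h0 : b = 0
  · refine ⟨y, H.isChart_of_root hx P ha ?_ (hs.resolve_left (not_not.2 h0))⟩
    rw [H.eval_eq_sq P ha hb, h0, zero_pow two_ne_zero]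
  · exact ⟨_, H.isChart_of_ne_zero hx h2 P ha hb h0⟩

/-- A smooth point is determined by its coordinates. -/
theorem point_eq (H : HyperellipticModel d x y) (hx : Transcendental k x)
    (h2 : (2 : k) ≠ 0) (P Q : CurvePoint k K) {a b : k} (ha : P.val (x - algebraMap k K a) < 1)
    (hb : P.val (y - algebraMap k K b) < 1) (ha' : Q.val (x - algebraMap k K a) < 1)
    (hb' : Q.val (y - algebraMap k K b) < 1) (hs : b ≠ 0 ∨ d.derivative.eval a ≠ 0) : P = Q := by
  obtain ⟨t, ht⟩ := H.exists_isChart hx h2 P ha hb hs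
  refine ht.eq (H.isChart_aux hx Q (Q.val_le_of_sub_lt ha')).1 fun r hr => ?_
  obtain ⟨A, B, rfl⟩ := H.mem_adjoin_iff.1 hr
  rw [P.val_lt_one_iff_of_sub_lt (val_sub_lt P ha hb A B),
    Q.val_lt_one_iff_of_sub_lt (val_sub_lt Q ha' hb' A B)]

end HyperellipticModel
end

noncomputable section

/-! ### Embeddings of `k(X)` and the abstract field of `y² = d(x)`. -/

section RatFuncHom

variable {k K : Type*} [Field k] [Field K] [Algebra k K] {x : K}

/-- The embedding `k(X) → K` with `X ↦ x`, for `x` transcendental. -/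
def ratFuncHom (hx : Transcendental k x) : RatFunc k →ₐ[k] K :=
  RatFunc.liftAlgHom (aeval x) (by
    intro p hp
    rw [Submonoid.mem_comap, mem_nonZeroDivisors_iff_ne_zero]
    exact fun h => nonZeroDivisors.ne_zero hp (transcendental_iff.1 hx p h))

@[simp]
theorem ratFuncHom_algebraMap (hx : Transcendental k x) (A : k[X]) :
    ratFuncHom hx (algebraMap k[X] (RatFunc k) A) = aeval x A := by
  have := RatFunc.liftAlgHom_apply_div' (φ := aeval x) (hφ := by
    intro p hp
    rw [Submonoid.mem_comap, mem_nonZeroDivisors_iff_ne_zero]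
    exact fun h => nonZeroDivisors.ne_zero hp (transcendental_iff.1 hx p h)) (p := A) (q := 1)
  simpa [ratFuncHom] using this

@[simp]
theorem ratFuncHom_X (hx : Transcendental k x) : ratFuncHom hx RatFunc.X = x := by
  rw [← RatFunc.algebraMap_X, ratFuncHom_algebraMap, aeval_X]

theorem ratFunc_algHom_ext {f g : RatFunc k →ₐ[k] K} (h : f RatFunc.X = g RatFunc.X) : f = g := by
  have hp : ∀ A : k[X], f (algebraMap k[X] (RatFunc k) A) = g (algebraMap k[X] (RatFunc k) A) := by
    intro A
    have : (f.comp (Algebra.algHom k k[X] (RatFunc k))) =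
        (g.comp (Algebra.algHom k k[X] (RatFunc k))) := by
      apply Polynomial.algHom_ext
      change f (algebraMap k[X] (RatFunc k) X) = g (algebraMap k[X] (RatFunc k) X)
      rw [RatFunc.algebraMap_X, h]
    exact DFunLike.congr_fun this A
  ext z
  rw [← RatFunc.num_div_denom z, map_div₀, map_div₀, hp, hp]

end RatFuncHom

section Comap

variable {k K L : Type*} [Field k] [Field K] [Algebra k K] [Field L] [Algebra k L]

/-- The image of a point under an isomorphism of curves. -/
def CurvePoint.comap (P : CurvePoint k L) (e : K ≃ₐ[k] L) : CurvePoint k K where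
  ring := P.ring.comap e.toAlgHom.toRingHom
  algebraMap_mem c := by
    have h := P.algebraMap_mem c
    rw [← e.commutes c] at h
    exact h
  ne_top h := by
    apply P.ne_top
    rw [eq_top_iff]
    intro z _
    have h1 : e.symm z ∈ P.ring.comap e.toAlgHom.toRingHom := h ▸ ValuationSubring.mem_top _
    have h2 : e (e.symm z) ∈ P.ring := h1
    rwa [e.apply_symm_apply] at h2

theorem CurvePoint.val_comap_le_one (P : CurvePoint k L) (e : K ≃ₐ[k] L) (z : K) :
    (P.comap e).val z ≤ 1 ↔ P.val (e z) ≤ 1 := by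
  rw [← mem_iff, ← mem_iff]; rfl

theorem CurvePoint.val_lt_one_iff_inv (P : CurvePoint k K) {z : K} (hz : z ≠ 0) :
    P.val z < 1 ↔ ¬ P.val z⁻¹ ≤ 1 := by
  rw [map_inv₀, not_le, one_lt_inv₀ (zero_lt_iff.2 (by simpa using hz))]

theorem CurvePoint.val_comap_lt_one (P : CurvePoint k L) (e : K ≃ₐ[k] L) (z : K) :
    (P.comap e).val z < 1 ↔ P.val (e z) < 1 := by
  by_cases hz : z = 0
  · simp [hz]
  rw [val_lt_one_iff_inv _ hz, val_lt_one_iff_inv _ (by simpa using hz), val_comap_le_one, map_inv₀]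

end Comap

theorem Polynomial.exists_eq_mul_isCoprime {k : Type*} [Field k] (A : k[X]) {D : k[X]}
    (hD : D ≠ 0) : ∃ g A' D' : k[X], g ≠ 0 ∧ A = g * A' ∧ D = g * D' ∧ IsCoprime A' D' := by
  classical
  obtain ⟨A', hA'⟩ := EuclideanDomain.gcd_dvd_left A D
  obtain ⟨D', hD'⟩ := EuclideanDomain.gcd_dvd_right A D
  have hbez := EuclideanDomain.gcd_eq_gcd_ab A D
  generalize EuclideanDomain.gcdA A D = α at hbez
  generalize EuclideanDomain.gcdB A D = β at hbez
  generalize EuclideanDomain.gcd A D = g at *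
  have hg : g ≠ 0 := by rintro rfl; simp [hD'] at hD
  refine ⟨g, A', D', hg, hA', hD', α, β, ?_⟩
  apply mul_left_cancel₀ hg
  rw [hA', hD'] at hbez
  linear_combination -hbez

/-- As `k[X]` is integrally closed, a square root of `d` is a polynomial, and squarefreeness makes
it a unit. -/
theorem Polynomial.not_isSquare_algebraMap_of_squarefree {k : Type*} [Field k] {d : k[X]}
    (hd : Squarefree d) (hd1 : ¬ IsUnit d) (b : RatFunc k) :
    b ^ 2 ≠ algebraMap k[X] (RatFunc k) d := by
  intro h
  have h_integral : IsIntegral k[X] b := ⟨X ^ 2 - C d, by monicity!, by simp [h]⟩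
  obtain ⟨c, rfl⟩ := IsIntegrallyClosed.isIntegral_iff.1 h_integral
  rw [← map_pow] at h
  have h' := RatFunc.algebraMap_injective k h
  have hc := hd c ⟨1, by rw [← h']; ring⟩
  exact hd1 (h' ▸ hc.pow 2)

theorem irreducible_X_sq_sub_C {k : Type*} [Field k] {d : k[X]} (hd : Squarefree d)
    (hd1 : ¬ IsUnit d) :
    Irreducible (X ^ 2 - C (algebraMap k[X] (RatFunc k) d) : (RatFunc k)[X]) :=
  X_pow_sub_C_irreducible_of_prime Nat.prime_two (not_isSquare_algebraMap_of_squarefree hd hd1)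

/-- The function field of the curve `y² = d(x)`. -/
abbrev HyperellipticField {k : Type*} [Field k] (d : k[X]) :=
  AdjoinRoot (X ^ 2 - C (algebraMap k[X] (RatFunc k) d) : (RatFunc k)[X])

namespace HyperellipticField

variable {k K : Type*} [Field k] [Field K] [Algebra k K] {d : k[X]} {x y : K}

/-- The homomorphism given by a solution of `y² = d(x)`. -/
def lift (hx : Transcendental k x) (h : y ^ 2 = aeval x d) : HyperellipticField d →ₐ[k] K :=
  AdjoinRoot.liftAlgHom _ (ratFuncHom hx) y (by
    simp [eval₂_sub, eval₂_pow, h, ratFuncHom_algebraMap])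

variable (d) in
/-- The function `x`. -/
def xGen : HyperellipticField d := algebraMap (RatFunc k) _ RatFunc.X

variable (d) in
/-- The function `y`. -/
def yGen : HyperellipticField d := AdjoinRoot.root _

theorem lift_xGen (hx : Transcendental k x) (h : y ^ 2 = aeval x d) : lift hx h (xGen d) = x := by
  simp [lift, xGen, AdjoinRoot.algebraMap_eq, AdjoinRoot.liftAlgHom]

theorem lift_yGen (hx : Transcendental k x) (h : y ^ 2 = aeval x d) : lift hx h (yGen d) = y := by
  simp [lift, yGen]

theorem lift_surjective [Fact (Irreducible (X ^ 2 - C (algebraMap k[X] (RatFunc k) d)))]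
    (hx : Transcendental k x) (H : HyperellipticModel d x y) :
    Function.Surjective (lift hx H.eq) := by
  intro z
  have hz : z ∈ IntermediateField.adjoin k {x, y} := H.adjoin_eq_top ▸ IntermediateField.mem_top
  have hle : IntermediateField.adjoin k {x, y} ≤ (lift hx H.eq).fieldRange := by
    rw [IntermediateField.adjoin_le_iff]
    rintro w (rfl | rfl)
    · exact ⟨_, lift_xGen hx H.eq⟩
    · exact ⟨_, lift_yGen hx H.eq⟩
  exact hle hz

end HyperellipticField

/-! ### Isomorphisms, the hyperelliptic involution, the point at infinity, and regular functions. -/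

namespace HyperellipticModel

variable {k K L : Type*} [Field k] [Field K] [Algebra k K] [Field L] [Algebra k L]
  {d : k[X]} {x y : K} {x' y' : L}

/-- For `d` squarefree and not constant the abstract ring `k(X)[Y]/(Y² - d)` is a field, and it maps
isomorphically onto any field with this model. -/
theorem exists_algEquiv (H : HyperellipticModel d x y) (hx : Transcendental k x)
    (H' : HyperellipticModel d x' y') (hx' : Transcendental k x') (hd : Squarefree d)
    (hd1 : ¬ IsUnit d) : ∃ e : K ≃ₐ[k] L, e x = x' ∧ e y = y' := by
  have : Fact (Irreducible (X ^ 2 - C (algebraMap k[X] (RatFunc k) d))) :=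
    ⟨irreducible_X_sq_sub_C hd hd1⟩
  let e₁ := AlgEquiv.ofBijective (HyperellipticField.lift hx H.eq)
    ⟨RingHom.injective _, HyperellipticField.lift_surjective hx H⟩
  let e₂ := AlgEquiv.ofBijective (HyperellipticField.lift hx' H'.eq)
    ⟨RingHom.injective _, HyperellipticField.lift_surjective hx' H'⟩
  have h1 : e₁.symm x = HyperellipticField.xGen d := by
    rw [AlgEquiv.symm_apply_eq]; exact (HyperellipticField.lift_xGen hx H.eq).symm
  have h2 : e₁.symm y = HyperellipticField.yGen d := by
    rw [AlgEquiv.symm_apply_eq]; exact (HyperellipticField.lift_yGen hx H.eq).symm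
  refine ⟨e₁.symm.trans e₂, ?_, ?_⟩
  · rw [AlgEquiv.trans_apply, h1]; exact HyperellipticField.lift_xGen hx' H'.eq
  · rw [AlgEquiv.trans_apply, h2]; exact HyperellipticField.lift_yGen hx' H'.eq

theorem neg (H : HyperellipticModel d x y) : HyperellipticModel d x (-y) where
  eq := by rw [neg_sq, H.eq]
  adjoin_eq_top := by
    rw [eq_top_iff, ← H.adjoin_eq_top, IntermediateField.adjoin_le_iff]
    rintro w (rfl | rfl)
    · exact IntermediateField.subset_adjoin _ _ (by simp)
    · rw [SetLike.mem_coe, ← neg_mem_iff]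
      exact IntermediateField.subset_adjoin _ _ (by simp)

/-- The hyperelliptic involution. -/
theorem exists_involution (H : HyperellipticModel d x y) (hx : Transcendental k x)
    (hd : Squarefree d) (hd1 : ¬ IsUnit d) : ∃ e : K ≃ₐ[k] K, e x = x ∧ e y = -y :=
  H.exists_algEquiv hx H.neg hx hd hd1

/-- The coordinates at infinity. -/
theorem atInfinity (H : HyperellipticModel d x y) (hx0 : x ≠ 0) {n : ℕ}
    (hn : d.natDegree ≤ 2 * n) :
    HyperellipticModel (reflect (2 * n) d) x⁻¹ (y * x⁻¹ ^ n) where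
  eq := by
    let := invertibleOfNonzero hx0
    have := eval₂_reflect_mul_pow (algebraMap k K) x (2 * n) d hn
    rw [invOf_eq_inv] at this
    rw [mul_pow, H.eq, aeval_def, aeval_def, ← this, ← pow_mul, mul_assoc, mul_comm n 2, inv_pow,
      mul_inv_cancel₀ (pow_ne_zero _ hx0), mul_one]
  adjoin_eq_top := by
    rw [eq_top_iff, ← H.adjoin_eq_top, IntermediateField.adjoin_le_iff]
    have h1 : x ∈ IntermediateField.adjoin k {x⁻¹, y * x⁻¹ ^ n} := by
      rw [← inv_mem_iff]
      exact IntermediateField.subset_adjoin _ _ (by simp)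
    rintro w (rfl | rfl)
    · exact h1
    · have h2 : w * x⁻¹ ^ n ∈ IntermediateField.adjoin k {x⁻¹, w * x⁻¹ ^ n} :=
        IntermediateField.subset_adjoin _ _ (by simp)
      have h3 := mul_mem h2 (pow_mem h1 n)
      rwa [mul_assoc, ← mul_pow, inv_mul_cancel₀ hx0, one_pow, mul_one] at h3

theorem transcendental_inv (hx : Transcendental k x) : Transcendental k x⁻¹ := by
  intro h
  apply hx
  simpa using h.inv

/-- For `d` of odd degree, `y / x ^ (g + 1)` is a uniformizer at infinity. -/
theorem isChart_infinity (H : HyperellipticModel d x y) (hx : Transcendental k x) {g : ℕ}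
    (hg : d.natDegree = 2 * g + 1) (P : CurvePoint k K) (hP : 1 < P.val x) :
    P.IsChart (Algebra.adjoin k {x⁻¹, y * x⁻¹ ^ (g + 1)}) (y * x⁻¹ ^ (g + 1)) := by
  have hx0 : x ≠ 0 := by rintro rfl; simp at hP
  have hd0 : d ≠ 0 := by rintro rfl; simp at hg
  -- Since the degree is `2 g + 1`, reflection in degree `2 g + 2` produces a simple root at `0`:
  -- the constant coefficient is zero and the linear one is the leading coefficient of `d`.
  refine (H.atInfinity hx0 (n := g + 1) (by omega)).isChart_of_root (transcendental_inv hx) P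
    (a := 0) ?_ ?_ ?_
  · rw [map_zero, sub_zero, map_inv₀]
    exact inv_lt_one_of_one_lt₀ hP
  · rw [← coeff_zero_eq_eval_zero, coeff_reflect, revAt_le (by omega)]
    exact coeff_eq_zero_of_natDegree_lt (by omega)
  · rw [← coeff_zero_eq_eval_zero, coeff_derivative, coeff_reflect, revAt_le (by omega)]
    have : 2 * (g + 1) - (0 + 1) = d.natDegree := by omega
    rw [this]
    simpa using hd0

/-- For `d` of odd degree, there is only one point at infinity. -/
theorem point_infinity_eq (H : HyperellipticModel d x y) (hx : Transcendental k x) {g : ℕ}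
    (hg : d.natDegree = 2 * g + 1) (P Q : CurvePoint k K) (hP : 1 < P.val x)
    (hQ : 1 < Q.val x) : P = Q := by
  have hx0 : x ≠ 0 := by rintro rfl; simp at hP
  have hPC := H.isChart_infinity hx hg P hP
  have hQC := H.isChart_infinity hx hg Q hQ
  have H' := H.atInfinity hx0 (n := g + 1) (by omega)
  refine hPC.eq hQC.val_le fun r hr => ?_
  obtain ⟨A, B, rfl⟩ := H'.mem_adjoin_iff.1 hr
  have hinv : ∀ R : CurvePoint k K, 1 < R.val x → R.val (x⁻¹ - algebraMap k K 0) < 1 := by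
    intro R hR
    rw [map_zero, sub_zero, map_inv₀]
    exact inv_lt_one_of_one_lt₀ hR
  have hy : ∀ R : CurvePoint k K, R.IsChart (Algebra.adjoin k {x⁻¹, y * x⁻¹ ^ (g + 1)})
      (y * x⁻¹ ^ (g + 1)) → R.val (y * x⁻¹ ^ (g + 1) - algebraMap k K 0) < 1 := by
    intro R hR
    rw [map_zero, sub_zero]
    exact hR.val_lt
  rw [P.val_lt_one_iff_of_sub_lt (val_sub_lt P (hinv P hP) (hy P hPC) A B),
    Q.val_lt_one_iff_of_sub_lt (val_sub_lt Q (hinv Q hQ) (hy Q hQC) A B)]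

theorem val_y_infinity (H : HyperellipticModel d x y) {g : ℕ}
    (hg : d.natDegree = 2 * g + 1) (P : CurvePoint k K) (hP : 1 < P.val x) :
    P.val y ^ 2 = P.val x ^ (2 * g + 1) := by
  have hd0 : d ≠ 0 := by rintro rfl; simp at hg
  rw [← map_pow, H.eq, P.val_aeval_of_one_lt hP hd0, hg]

/-- A rational function of `x` without poles on the affine curve is a polynomial. -/
theorem dvd_of_forall_val_le [IsAlgClosed k] (hx : Transcendental k x) {A D : k[X]} (hD : D ≠ 0)
    (h : ∀ P : CurvePoint k K, P.val x ≤ 1 → P.val (aeval x A / aeval x D) ≤ 1) : D ∣ A := by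
  obtain ⟨g, A', D', hg, hA', hD', α, β, hcop⟩ := exists_eq_mul_isCoprime A hD
  by_cases hdeg : D'.degree = 0
  · rw [hA', hD']
    exact mul_dvd_mul_left g ((isUnit_iff_degree_eq_zero.2 hdeg).dvd)
  · exfalso
    -- A root of the reduced denominator is not a root of the numerator, so any point over it is a
    -- pole.
    obtain ⟨c, hc⟩ := IsAlgClosed.exists_root D' hdeg
    obtain ⟨P, hP⟩ := exists_val_sub_lt hx c
    have h1 := h P (P.val_le_of_sub_lt hP)
    have hgx : aeval x g ≠ 0 := fun h0 => hg (transcendental_iff.1 hx g h0)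
    have hA1 : A'.eval c ≠ 0 := by
      intro h0
      have := congrArg (eval c) hcop
      simp [h0, IsRoot.def.1 hc] at this
    have h2 := val_aeval_eq_one P hP hA1
    have h3 := (P.val_lt_one_iff_of_sub_lt (P.val_aeval_sub_lt hP D')).2 hc
    rw [hA', hD', map_mul, map_mul, mul_div_mul_left _ _ hgx, map_div₀, h2, one_div] at h1
    have h4 : P.val (aeval x D') ≠ 0 := by
      intro h0
      rw [map_eq_zero] at h0
      have := transcendental_iff.1 hx D' h0
      rw [hD', this, mul_zero] at hD
      exact hD rfl
    rw [inv_le_one₀ (zero_lt_iff.2 h4)] at h1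
    exact absurd h3 (not_lt.2 h1)

theorem _root_.CurvePoint.val_add_self_le (h2 : (2 : k) ≠ 0) (P : CurvePoint k K) {z c : K}
    (h : P.val (z + z) ≤ P.val c) : P.val z ≤ P.val c := by
  rw [← two_mul, map_mul, P.val_ofNat_two h2, one_mul] at h
  exact h

/-- The functions without poles on the affine curve `y² = d(x)`. -/
theorem exists_eq_of_forall_val_le [IsAlgClosed k] (H : HyperellipticModel d x y)
    (hx : Transcendental k x) (h2 : (2 : k) ≠ 0) (hd : Squarefree d) (hd1 : ¬ IsUnit d) {z : K}
    (hz : ∀ P : CurvePoint k K, P.val x ≤ 1 → P.val z ≤ 1) :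
    ∃ A B : k[X], z = aeval x A + aeval x B * y := by
  -- Both `z` and its conjugate are regular, so `A / D` and `B y / D` are regular because `2` is
  -- invertible. The square of the latter is `B² d / D²`, and as `d` is squarefree, `D² ∣ B² d`
  -- forces `D ∣ B`.
  obtain ⟨e, hex, hey⟩ := H.exists_involution hx hd hd1
  obtain ⟨A, B, D, hD, hzD⟩ := H.exists_eq_div hx z
  have hDx : aeval x D ≠ 0 := fun h => hD (transcendental_iff.1 hx D h)
  have heA : ∀ A : k[X], e (aeval x A) = aeval x A := by
    intro A
    rw [← aeval_algHom_apply, hex]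
  have hez : e z = (aeval x A - aeval x B * y) / aeval x D := by
    rw [hzD, map_div₀, map_add, map_mul, hey, heA, heA, heA]
    ring
  have hez_le : ∀ P : CurvePoint k K, P.val x ≤ 1 → P.val (e z) ≤ 1 := by
    intro P hP
    rw [← P.val_comap_le_one]
    apply hz
    rwa [P.val_comap_le_one, hex]
  have hAD : D ∣ A := by
    apply dvd_of_forall_val_le hx hD
    intro P hP
    rw [← map_one P.val]
    apply P.val_add_self_le h2
    have : aeval x A / aeval x D + aeval x A / aeval x D = z + e z := by
      rw [hez, hzD]; field_simp; ring
    rw [this, map_one]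
    exact P.val.map_add_le (hz P hP) (hez_le P hP)
  have hBD : D ^ 2 ∣ B ^ 2 * d := by
    apply dvd_of_forall_val_le hx (pow_ne_zero 2 hD)
    intro P hP
    have e1 : aeval x (B ^ 2 * d) / aeval x (D ^ 2) = (aeval x B * y / aeval x D) ^ 2 := by
      rw [map_mul, ← H.eq, map_pow, map_pow]; ring
    rw [e1, map_pow]
    apply pow_le_one₀ zero_le
    rw [← map_one P.val]
    apply P.val_add_self_le h2
    have : aeval x B * y / aeval x D + aeval x B * y / aeval x D = z - e z := by
      rw [hez, hzD]; field_simp; ring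
    rw [this, map_one]
    exact (P.val.map_sub _ _).trans (max_le (hz P hP) (hez_le P hP))
  have hDB : D ∣ B := by
    obtain ⟨g, B', D', hg, hB', hD', hcop⟩ := exists_eq_mul_isCoprime B hD
    rw [hB', hD', mul_pow, mul_pow, mul_assoc] at hBD
    have h3 := (mul_dvd_mul_iff_left (pow_ne_zero 2 hg)).1 hBD
    have h4 := (hcop.symm.pow (m := 2) (n := 2)).dvd_of_dvd_mul_left h3
    have h5 := hd D' (by rwa [← sq])
    rw [hB', hD']
    exact mul_dvd_mul_left g h5.dvd
  obtain ⟨A', rfl⟩ := hAD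
  obtain ⟨B', rfl⟩ := hDB
  refine ⟨A', B', ?_⟩
  rw [hzD, map_mul, map_mul]
  field_simp

end HyperellipticModel
end

noncomputable section

/-! ### Growth at infinity, regular differentials and the genus. -/

namespace HyperellipticModel

variable {k K : Type*} [Field k] [Field K] [Algebra k K] {d : k[X]} {x y : K}

/-- Growth at infinity of the functions regular on the affine curve. -/
theorem natDegree_le_of_val_le (H : HyperellipticModel d x y) (hx : Transcendental k x)
    (h2 : (2 : k) ≠ 0) (hd : Squarefree d) {g : ℕ} (hg : d.natDegree = 2 * g + 1)
    (P : CurvePoint k K) (hP : 1 < P.val x) {A B : k[X]} {m : ℕ}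
    (h : P.val (aeval x A + aeval x B * y) ≤ P.val x ^ m) :
    (A ≠ 0 → A.natDegree ≤ m) ∧ (B ≠ 0 → 2 * B.natDegree + 2 * g + 1 ≤ 2 * m) := by
  have hd0 : d ≠ 0 := by rintro rfl; simp at hg
  have hx0 : x ≠ 0 := by rintro rfl; simp at hP
  have hd1 : ¬ IsUnit d := fun hu => by rw [natDegree_eq_zero_of_isUnit hu] at hg; omega
  obtain ⟨e, hex, hey⟩ := H.exists_involution hx hd hd1
  have heA : ∀ A : k[X], e (aeval x A) = aeval x A := by
    intro A
    rw [← aeval_algHom_apply, hex]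
  -- The involution fixes the only point at infinity, so a bound for `A + B y` also holds for its
  -- conjugate and passes to `A` and to `B y`. Squaring then replaces `y` by `x ^ (2 g + 1)`.
  have hPe : P.comap e = P := by
    apply H.point_infinity_eq hx hg _ _ _ hP
    rw [← not_le, P.val_comap_le_one, hex, not_le]
    exact hP
  have hxm : P.val x ^ m ≠ 0 := pow_ne_zero _ (by simpa using hx0)
  have hconj : P.val (aeval x A - aeval x B * y) ≤ P.val x ^ m := by
    have h1 : P.val ((aeval x A + aeval x B * y) / x ^ m) ≤ 1 := by
      rw [map_div₀, map_pow, div_le_one₀ (zero_lt_iff.2 hxm)]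
      exact h
    rw [← hPe, P.val_comap_le_one, map_div₀, map_pow, map_add, map_mul, heA, heA, hex, hey, map_div₀,
      map_pow, div_le_one₀ (zero_lt_iff.2 hxm), mul_neg, ← sub_eq_add_neg] at h1
    exact h1
  constructor
  · intro hA
    have h1 : P.val (aeval x A) ≤ P.val (x ^ m) := by
      apply P.val_add_self_le h2
      have : aeval x A + aeval x A =
        (aeval x A + aeval x B * y) + (aeval x A - aeval x B * y) := by ring
      rw [this, map_pow]
      exact P.val.map_add_le h hconj
    rw [P.val_aeval_of_one_lt hP hA, map_pow] at h1
    exact (pow_le_pow_iff_right₀ hP).1 h1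
  · intro hB
    have h1 : P.val (aeval x B * y) ≤ P.val (x ^ m) := by
      apply P.val_add_self_le h2
      have : aeval x B * y + aeval x B * y =
        (aeval x A + aeval x B * y) - (aeval x A - aeval x B * y) := by ring
      rw [this, map_pow]
      exact (P.val.map_sub _ _).trans (max_le h hconj)
    have h3 := pow_le_pow_left₀ zero_le h1 2
    rw [map_mul, mul_pow, H.val_y_infinity hg P hP, P.val_aeval_of_one_lt hP hB, map_pow, ← pow_mul,
      ← pow_mul, ← pow_add, pow_le_pow_iff_right₀ hP] at h3
    omega

/-- `K` is generated over `k(x)` by a root of `T² - d`, which is separable because `2 ≠ 0` and `d ≠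
0`. -/
theorem isSeparable_ratFunc (H : HyperellipticModel d x y) (hx : Transcendental k x) (hd0 : d ≠ 0) (h2 : (2 : k) ≠ 0)
    [Algebra (RatFunc k) K] [IsScalarTower k (RatFunc k) K] [Algebra k[X] K]
    [IsScalarTower k[X] (RatFunc k) K] (hA : ∀ A : k[X], algebraMap k[X] K A = aeval x A) :
    Algebra.IsSeparable (RatFunc k) K := by
  have hy : IsSeparable (RatFunc k) y := by
    have hsep : (X ^ 2 - C (algebraMap k[X] (RatFunc k) d)).Separable := by
      apply separable_X_pow_sub_C
      · intro h
        apply h2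
        apply (algebraMap k (RatFunc k)).injective
        rw [map_ofNat, map_zero]
        exact_mod_cast h
      · simpa using hd0
    refine hsep.of_dvd (minpoly.dvd _ _ ?_)
    simp [← IsScalarTower.algebraMap_apply, hA, H.eq]
  refine ⟨fun z => ?_⟩
  obtain ⟨A, B, D, -, rfl⟩ := H.exists_eq_div hx z
  have e : (aeval x A + aeval x B * y) / aeval x D = algebraMap (RatFunc k) K
      (algebraMap k[X] (RatFunc k) A / algebraMap k[X] (RatFunc k) D) +
      algebraMap (RatFunc k) K (algebraMap k[X] (RatFunc k) B / algebraMap k[X] (RatFunc k) D) *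
        y := by
    simp only [map_div₀, ← IsScalarTower.algebraMap_apply, hA]
    ring
  rw [e]
  exact Field.isSeparable_add (isSeparable_algebraMap _)
    (Field.isSeparable_mul (isSeparable_algebraMap _) hy)

/-- `K` is formally étale over `k[X]`, by localization followed by a separable extension. So its
differentials are those of `k[X]` with scalars extended to `K`, where `dX` is a basis. -/
theorem D_x_ne_zero (H : HyperellipticModel d x y) (hx : Transcendental k x) (hd0 : d ≠ 0)
    (h2 : (2 : k) ≠ 0) : KaehlerDifferential.D k K x ≠ 0 := by
  let : Algebra (RatFunc k) K := (ratFuncHom hx).toRingHom.toAlgebra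
  let : Algebra k[X] K := (aeval x).toRingHom.toAlgebra
  have hA : ∀ A : k[X], algebraMap k[X] K A = aeval x A := fun _ => rfl
  have t1 : IsScalarTower k (RatFunc k) K := IsScalarTower.of_algebraMap_eq fun c =>
    ((ratFuncHom hx).commutes c).symm
  have t2 : IsScalarTower k[X] (RatFunc k) K := IsScalarTower.of_algebraMap_eq fun A =>
    (ratFuncHom_algebraMap hx A).symm
  have t3 : IsScalarTower k k[X] K := IsScalarTower.of_algebraMap_eq fun c =>
    ((aeval (R := k) x).commutes c).symm
  have := H.isSeparable_ratFunc hx hd0 h2 hA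
  have e1 : Algebra.FormallyEtale (RatFunc k) K := Algebra.FormallyEtale.of_isSeparable _ _
  have e2 : Algebra.FormallyEtale k[X] (RatFunc k) :=
    Algebra.FormallyEtale.of_isLocalization (nonZeroDivisors k[X])
  have e3 : Algebra.FormallyEtale k[X] K := Algebra.FormallyEtale.comp k[X] (RatFunc k) K
  intro h0
  have h1 := KaehlerDifferential.tensorKaehlerEquivOfFormallyEtale_symm_D_algebraMap k k[X] K X
  rw [hA, aeval_X, h0, map_zero] at h1
  have h3 := congrArg ((KaehlerDifferential.polynomialEquiv k).lTensor K) h1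
  have h4 := congrArg (TensorProduct.rid k[X] K) h3
  simp [KaehlerDifferential.polynomialEquiv_D] at h4


/-- The differentials that are regular at a point. -/
def _root_.CurvePoint.differentials (P : CurvePoint k K) : Submodule k (Ω[K⁄k]) :=
  Submodule.span k {ω | ∃ a ∈ P.ring, ∃ b ∈ P.ring, ω = a • KaehlerDifferential.D k K b}

/-- The differential `dx / y`. -/
def differential (k : Type*) {K : Type*} [Field k] [Field K] [Algebra k K] (x y : K) : Ω[K⁄k] :=
  y⁻¹ • KaehlerDifferential.D k K x

theorem y_ne_zero (H : HyperellipticModel d x y) (hx : Transcendental k x) (hd0 : d ≠ 0) :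
    y ≠ 0 := by
  rintro rfl
  apply hd0
  apply transcendental_iff.1 hx
  rw [← H.eq]
  simp

theorem D_x_eq (H : HyperellipticModel d x y) (hx : Transcendental k x) (hd0 : d ≠ 0) :
    KaehlerDifferential.D k K x = y • differential k x y := by
  rw [differential, smul_smul, mul_inv_cancel₀ (H.y_ne_zero hx hd0), one_smul]

/-- This is `2 y dy = d'(x) dx`, divided by `y`. It makes `dx / y` a multiple of `dy` where `y`
vanishes. -/
theorem two_smul_D_y_eq (H : HyperellipticModel d x y) (hx : Transcendental k x) (hd0 : d ≠ 0) :
    (2 : K) • KaehlerDifferential.D k K y = aeval x d.derivative • differential k x y := by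
  have hy := H.y_ne_zero hx hd0
  have h := congrArg (KaehlerDifferential.D k K) H.eq
  rw [Derivation.map_aeval, H.D_x_eq hx hd0, sq, Derivation.leibniz, ← add_smul, ← two_mul] at h
  have h' := congrArg (fun ω => y⁻¹ • ω) h
  simp only [smul_smul] at h'
  have e1 : y⁻¹ * (2 * y) = 2 := by field_simp
  have e2 : y⁻¹ * (aeval x d.derivative * y) = aeval x d.derivative := by field_simp
  rw [e1, e2] at h'
  exact h'

/-- Every element of `k[x, y]` has differential in `k[x, y] dx / y`. -/
theorem D_mem (H : HyperellipticModel d x y) (hx : Transcendental k x) (hd0 : d ≠ 0)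
    (h2 : (2 : k) ≠ 0) {r : K} (hr : r ∈ Algebra.adjoin k {x, y}) :
    ∃ c ∈ Algebra.adjoin k {x, y}, KaehlerDifferential.D k K r = c • differential k x y := by
  have h2K : (2 : K) ≠ 0 := by
    intro h
    apply h2
    apply (algebraMap k K).injective
    rw [map_ofNat, map_zero, h]
  have hpoly : ∀ A : k[X], aeval x A ∈ Algebra.adjoin k {x, y} := fun A =>
    H.mem_adjoin_iff.2 ⟨A, 0, by simp⟩
  have hy : y ∈ Algebra.adjoin k {x, y} := Algebra.subset_adjoin (by simp)
  obtain ⟨A, B, rfl⟩ := H.mem_adjoin_iff.1 hr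
  have hDy : KaehlerDifferential.D k K y =
      (algebraMap k K 2⁻¹ * aeval x d.derivative) • differential k x y := by
    rw [mul_smul, ← H.two_smul_D_y_eq hx hd0, smul_smul, map_inv₀, map_ofNat, inv_mul_cancel₀ h2K,
      one_smul]
  refine ⟨aeval x A.derivative * y + (aeval x B * (algebraMap k K 2⁻¹ * aeval x d.derivative) +
    y * (aeval x B.derivative * y)), ?_, ?_⟩
  · exact add_mem (mul_mem (hpoly _) hy) (add_mem (mul_mem (hpoly _)
      (mul_mem (Subalgebra.algebraMap_mem _ _) (hpoly _))) (mul_mem hy (mul_mem (hpoly _) hy)))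
  · rw [map_add, Derivation.leibniz, Derivation.map_aeval, Derivation.map_aeval, H.D_x_eq hx hd0, hDy]
    simp only [smul_smul, ← add_smul]

/-- The regular differentials at a point of the affine curve. -/
theorem mem_differentials_iff (H : HyperellipticModel d x y) (hx : Transcendental k x)
    (hd0 : d ≠ 0) (h2 : (2 : k) ≠ 0) (P : CurvePoint k K) {a b : k}
    (ha : P.val (x - algebraMap k K a) < 1) (hb : P.val (y - algebraMap k K b) < 1)
    (hs : b ≠ 0 ∨ d.derivative.eval a ≠ 0) {ω : Ω[K⁄k]} :
    ω ∈ P.differentials ↔ ∃ c, P.val c ≤ 1 ∧ ω = c • differential k x y := by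
  obtain ⟨t, ht⟩ := H.exists_isChart hx h2 P ha hb hs
  constructor
  · intro hω
    induction hω using Submodule.span_induction with
    | mem ω h =>
      obtain ⟨f, hf, z, hz, rfl⟩ := h
      obtain ⟨r, hr, s, hs, hs1, rfl⟩ := ht.exists_div_of_mem (P.mem_iff.1 hz)
      obtain ⟨c, hc, hcr⟩ := H.D_mem hx hd0 h2 hr
      obtain ⟨c', hc', hcs⟩ := H.D_mem hx hd0 h2 hs
      -- The quotient rule for `r / s`, in which the denominator `s` is a unit at `P`.
      refine ⟨f * ((s⁻¹) ^ 2 * (s * c - r * c')), ?_, ?_⟩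
      · rw [map_mul, map_mul, map_pow, map_inv₀, hs1, inv_one, one_pow, one_mul]
        exact mul_le_one₀ (P.mem_iff.1 hf) zero_le
          (ht.val_le _ (sub_mem (mul_mem hs hc) (mul_mem hr hc')))
      · rw [mul_smul, Derivation.leibniz_div, hcr, hcs]
        simp only [smul_smul, ← sub_smul]
    | zero => exact ⟨0, by simp, by simp⟩
    | add ω ω' _ _ h h' =>
      obtain ⟨c, hc, rfl⟩ := h
      obtain ⟨c', hc', rfl⟩ := h'
      exact ⟨c + c', P.val.map_add_le hc hc', by rw [add_smul]⟩
    | smul e ω _ h =>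
      obtain ⟨c, hc, rfl⟩ := h
      refine ⟨algebraMap k K e * c, ?_, by rw [mul_smul, algebraMap_smul]⟩
      rw [map_mul]
      exact mul_le_one₀ (P.val_algebraMap_le e) zero_le hc
  · rintro ⟨c, hc, rfl⟩
    apply Submodule.subset_span
    -- At a branch point `dx / y` is `2 dy / d'(x)` with `d'(x)` a unit. Elsewhere `y` itself is a
    -- unit.
    by_cases h0 : b = 0
    · have hu := val_aeval_eq_one P ha (hs.resolve_left (not_not.2 h0))
      refine ⟨c * 2 * (aeval x d.derivative)⁻¹, ?_, y, P.mem_iff.2 (P.val_le_of_sub_lt hb), ?_⟩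
      · rw [P.mem_iff, map_mul, map_mul, map_inv₀, hu, P.val_ofNat_two h2, inv_one, mul_one, mul_one]
        exact hc
      · have hne : aeval x d.derivative ≠ 0 := fun h => by rw [h, map_zero] at hu; exact zero_ne_one hu
        have : c * 2 * (aeval x d.derivative)⁻¹ = (c * (aeval x d.derivative)⁻¹) * 2 := by ring
        rw [this, mul_smul, H.two_smul_D_y_eq hx hd0, smul_smul, mul_assoc, inv_mul_cancel₀ hne,
          mul_one]
    · have hu := (P.val_eq_one_iff_of_sub_lt hb).2 h0
      refine ⟨c * y⁻¹, ?_, x, P.mem_iff.2 (P.val_le_of_sub_lt ha), ?_⟩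
      · rw [P.mem_iff, map_mul, map_inv₀, hu, inv_one, mul_one]
        exact hc
      · rw [mul_smul]; rfl

theorem smooth_of_squarefree [IsAlgClosed k] (hd : Squarefree d) {a b : k} (h : d.eval a = b ^ 2) :
    b ≠ 0 ∨ d.derivative.eval a ≠ 0 := by
  by_contra! hc
  obtain ⟨rfl, h'⟩ := hc
  rw [zero_pow two_ne_zero] at h
  obtain ⟨q, rfl⟩ := dvd_iff_isRoot.2 h
  have hq : q.eval a = 0 := by simpa using h'
  obtain ⟨r, rfl⟩ := dvd_iff_isRoot.2 hq
  exact not_isUnit_X_sub_C a (hd (X - C a) ⟨r, by ring⟩)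

theorem exists_smooth_coordinates [IsAlgClosed k] (H : HyperellipticModel d x y)
    (hK : IsCurveField k K) (hd : Squarefree d) (P : CurvePoint k K) (hxP : P.val x ≤ 1) :
    ∃ a b : k, P.val (x - algebraMap k K a) < 1 ∧ P.val (y - algebraMap k K b) < 1 ∧
      d.eval a = b ^ 2 ∧ (b ≠ 0 ∨ d.derivative.eval a ≠ 0) := by
  obtain ⟨a, b, ha, hb⟩ := H.exists_coordinates hK P hxP
  have h := H.eval_eq_sq P ha hb
  exact ⟨a, b, ha, hb, h, smooth_of_squarefree hd h⟩

/-- In the coordinates `1 / x`, `y / x ^ (g + 1)` the basic differential is `-x ^ (g - 1) dx / y`.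
The bound is multiplied by `x` so that the exponent stays natural when `g = 0`. -/
theorem mem_differentials_infinity_iff (H : HyperellipticModel d x y) (hx : Transcendental k x)
    (h2 : (2 : k) ≠ 0) {g : ℕ} (hg : d.natDegree = 2 * g + 1)
    (P : CurvePoint k K) (hP : 1 < P.val x) {z : K} :
    z • differential k x y ∈ P.differentials ↔ P.val (z * x) ≤ P.val x ^ g := by
  have hx0 : x ≠ 0 := by rintro rfl; simp at hP
  have hd0 : d ≠ 0 := by rintro rfl; simp at hg
  have hy := H.y_ne_zero hx hd0
  have hD := H.D_x_ne_zero hx hd0 h2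
  have hch := H.isChart_infinity hx hg P hP
  have H' := H.atInfinity hx0 (n := g + 1) (by omega)
  have hd0' : reflect (2 * (g + 1)) d ≠ 0 := by simpa using hd0
  have hs : (reflect (2 * (g + 1)) d).derivative.eval 0 ≠ 0 := by
    rw [← coeff_zero_eq_eval_zero, coeff_derivative, coeff_reflect, revAt_le (by omega)]
    have : 2 * (g + 1) - (0 + 1) = d.natDegree := by omega
    rw [this]
    simpa using hd0
  have e : differential k x⁻¹ (y * x⁻¹ ^ (g + 1)) = (-(x ^ g * x⁻¹)) • differential k x y := by
    rw [differential, differential, Derivation.leibniz_inv, smul_smul, smul_smul]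
    congr 1
    rw [inv_pow]
    field_simp
    ring
  have hvx : P.val x ^ g ≠ 0 := pow_ne_zero _ (by simpa using hx0)
  rw [H'.mem_differentials_iff (transcendental_inv hx) hd0' h2 P (a := 0) (b := 0)
    (by rw [map_zero, sub_zero, map_inv₀]; exact inv_lt_one_of_one_lt₀ hP)
    (by rw [map_zero, sub_zero]; exact hch.val_lt) (Or.inr hs), e]
  constructor
  · rintro ⟨c, hc, h⟩
    rw [smul_smul, differential, smul_smul, smul_smul] at h
    have h' := smul_left_injective K hD h
    have : z * x = -(c * x ^ g) := by
      field_simp at h'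
      exact h'
    rw [this, Valuation.map_neg, map_mul, map_pow]
    exact mul_le_of_le_one_left zero_le hc
  · intro h
    refine ⟨-(z * x * (x⁻¹) ^ g), ?_, ?_⟩
    · rw [Valuation.map_neg, map_mul, map_pow, map_inv₀, inv_pow]
      exact mul_inv_le_one_of_le₀ h zero_le
    · rw [smul_smul]
      congr 1
      rw [inv_pow]
      field_simp

/-- The regular differentials of a hyperelliptic curve. -/
theorem mem_regularDifferentials_iff [IsAlgClosed k] (H : HyperellipticModel d x y)
    (hK : IsCurveField k K) (h2 : (2 : k) ≠ 0) (hd : Squarefree d) {g : ℕ}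
    (hg : d.natDegree = 2 * g + 1) {ω : Ω[K⁄k]} :
    ω ∈ regularDifferentials k K ↔ ∃ A ∈ degreeLT k g, aeval x A • differential k x y = ω := by
  have hx := H.transcendental hK
  have hd0 : d ≠ 0 := by rintro rfl; simp at hg
  have hd1 : ¬ IsUnit d := fun hu => by rw [natDegree_eq_zero_of_isUnit hu] at hg; omega
  have hmem : ω ∈ regularDifferentials k K ↔ ∀ P : CurvePoint k K, ω ∈ P.differentials := by
    rw [regularDifferentials, Submodule.mem_iInf]; rfl
  have hD := H.D_x_ne_zero hx hd0 h2
  have hω0 : differential k x y ≠ 0 :=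
    smul_ne_zero (inv_ne_zero (H.y_ne_zero hx hd0)) hD
  rw [hmem]
  constructor
  · intro h
    -- Any affine point serves to write the differential as `z dx / y`. The coefficient `z` is
    -- unique, hence regular at all affine points.
    obtain ⟨P₀, hP₀⟩ := exists_val_sub_lt hx 0
    obtain ⟨a, b, ha, hb, -, hs⟩ := H.exists_smooth_coordinates hK hd P₀ (P₀.val_le_of_sub_lt hP₀)
    obtain ⟨z, -, rfl⟩ := (H.mem_differentials_iff hx hd0 h2 P₀ ha hb hs).1 (h P₀)
    obtain ⟨A, B, rfl⟩ := H.exists_eq_of_forall_val_le hx h2 hd hd1 (z := z) (by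
      intro P hP
      obtain ⟨a, b, ha, hb, -, hs⟩ := H.exists_smooth_coordinates hK hd P hP
      obtain ⟨c, hc, h'⟩ := (H.mem_differentials_iff hx hd0 h2 P ha hb hs).1 (h P)
      rwa [smul_left_injective K hω0 h'])
    obtain ⟨P, hP⟩ := exists_pole hx
    rw [P.not_mem_iff] at hP
    have h1 := (H.mem_differentials_infinity_iff hx h2 hg P hP).1 (h P)
    have h3 : (aeval x A + aeval x B * y) * x = aeval x (A * X) + aeval x (B * X) * y := by
      simp only [map_mul, aeval_X]; ring
    rw [h3] at h1
    obtain ⟨hA, hB⟩ := H.natDegree_le_of_val_le hx h2 hd hg P hP h1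
    -- A nonzero `B` would require `2 (deg B + 1) + 2 g + 1 ≤ 2 g`.
    have hB0 : B = 0 := by
      by_contra hB0
      have := hB (mul_ne_zero hB0 X_ne_zero)
      rw [natDegree_mul_X hB0] at this
      omega
    refine ⟨A, ?_, by simp [hB0]⟩
    rw [mem_degreeLT]
    by_cases hA0 : A = 0
    · simp [hA0]
    · have := hA (mul_ne_zero hA0 X_ne_zero)
      rw [natDegree_mul_X hA0] at this
      rw [← natDegree_lt_iff_degree_lt hA0]
      omega
  · rintro ⟨A, hA, rfl⟩ P
    by_cases hP : P.val x ≤ 1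
    · obtain ⟨a, b, ha, hb, -, hs⟩ := H.exists_smooth_coordinates hK hd P hP
      exact (H.mem_differentials_iff hx hd0 h2 P ha hb hs).2 ⟨_, P.val_aeval_le hP A, rfl⟩
    · rw [not_le] at hP
      rw [H.mem_differentials_infinity_iff hx h2 hg P hP]
      by_cases hA0 : A = 0
      · simp [hA0]
      · rw [map_mul, P.val_aeval_of_one_lt hP hA0, ← pow_succ]
        rw [mem_degreeLT, ← natDegree_lt_iff_degree_lt hA0] at hA
        exact pow_le_pow_right₀ hP.le hA

/-- The differentials `x ^ i dx / y` with `i < g` form a basis. -/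
theorem curveGenus_eq [IsAlgClosed k] (H : HyperellipticModel d x y)
    (hK : IsCurveField k K) (h2 : (2 : k) ≠ 0) (hd : Squarefree d) {g : ℕ}
    (hg : d.natDegree = 2 * g + 1) : curveGenus k K = g := by
  have hx := H.transcendental hK
  have hd0 : d ≠ 0 := by rintro rfl; simp at hg
  have hω0 : differential k x y ≠ 0 :=
    smul_ne_zero (inv_ne_zero (H.y_ne_zero hx hd0)) (H.D_x_ne_zero hx hd0 h2)
  let Φ : k[X] →ₗ[k] Ω[K⁄k] :=
    ((LinearMap.toSpanSingleton K (Ω[K⁄k]) (differential k x y)).restrictScalars k).comp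
      (aeval x).toLinearMap
  have hΦ : ∀ A, Φ A = aeval x A • differential k x y := fun A => rfl
  have hinj : Function.Injective Φ := by
    rw [← LinearMap.ker_eq_bot, LinearMap.ker_eq_bot']
    intro A hA
    rw [hΦ, smul_eq_zero] at hA
    exact transcendental_iff.1 hx A (hA.resolve_right hω0)
  have heq : regularDifferentials k K = (degreeLT k g).map Φ := by
    ext ω
    rw [H.mem_regularDifferentials_iff hK h2 hd hg, Submodule.mem_map]
    rfl
  rw [curveGenus, heq, ← ((degreeLT k g).equivMapOfInjective Φ hinj).finrank_eq,
    (degreeLTEquiv k g).finrank_eq, Module.finrank_fin_fun]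

end HyperellipticModel
end

noncomputable section

/-! ### Weierstrass points of hyperelliptic curves. -/

namespace HyperellipticModel

variable {k K : Type*} [Field k] [Field K] [Algebra k K] {d : k[X]} {x y : K}

theorem val_y_lt_of_root (H : HyperellipticModel d x y) (P : CurvePoint k K) {a : k}
    (hda : d.eval a = 0) (ha : P.val (x - algebraMap k K a) < 1) :
    P.val (y - algebraMap k K 0) < 1 := by
  have h := P.val_aeval_sub_lt ha d
  rw [hda, map_zero, sub_zero, ← H.eq, map_pow] at h
  rw [map_zero, sub_zero]
  exact (pow_lt_one_iff_of_nonneg zero_le two_ne_zero).1 h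

/-- There is only one point over a root of `d`. -/
theorem branch_point_eq [IsAlgClosed k] (H : HyperellipticModel d x y) (hx : Transcendental k x)
    (h2 : (2 : k) ≠ 0) (hd : Squarefree d) {P Q : CurvePoint k K} {a : k} (hda : d.eval a = 0)
    (hP : P.val (x - algebraMap k K a) < 1) (hQ : Q.val (x - algebraMap k K a) < 1) : P = Q :=
  H.point_eq hx h2 P Q hP (H.val_y_lt_of_root P hda hP) hQ (H.val_y_lt_of_root Q hda hQ)
    (smooth_of_squarefree hd (by rw [hda, zero_pow two_ne_zero]))

/-- The function `x` has a pole of order exactly two at infinity: for `t = y / x ^ (g + 1)`, the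
value of `t² x` is that of `y² / x ^ (2 g + 1)`, which is one. -/
theorem isUniformizer_infinity (H : HyperellipticModel d x y) (hx : Transcendental k x) {g : ℕ}
    (hg : d.natDegree = 2 * g + 1) (P : CurvePoint k K) (hP : 1 < P.val x) :
    ∃ t, P.IsUniformizer t ∧ P.val t * P.val t * P.val x = 1 := by
  refine ⟨_, (H.isChart_infinity hx hg P hP).isUniformizer, ?_⟩
  have hx0 : P.val x ≠ 0 := fun h => by simp [h] at hP
  have h := H.val_y_infinity hg P hP
  have hx0' : x ≠ 0 := fun h => by simp [h] at hP
  have e : y * x⁻¹ ^ (g + 1) * (y * x⁻¹ ^ (g + 1)) * x = y ^ 2 * (x ^ (2 * g + 1))⁻¹ := by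
    rw [inv_pow]
    field_simp
    ring
  rw [← map_mul, ← map_mul, e, map_mul, map_pow, h, map_inv₀, map_pow,
    mul_inv_cancel₀ (pow_ne_zero _ hx0)]

theorem isWeierstrass_infinity (H : HyperellipticModel d x y) (hx : Transcendental k x) {g : ℕ}
    (hg : d.natDegree = 2 * g + 1) (P : CurvePoint k K) (hP : 1 < P.val x) : P.IsWeierstrass := by
  refine ⟨x, P.not_mem_iff.2 hP, fun Q hQ => ?_, fun s t hs ht => ?_⟩
  · by_contra h
    exact hQ (H.point_infinity_eq hx hg Q P (Q.not_mem_iff.1 h) hP)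
  · obtain ⟨τ, hτ, h1⟩ := H.isUniformizer_infinity hx hg P hP
    rw [P.mem_iff, map_mul, map_mul, ← h1]
    exact mul_le_mul_left (mul_le_mul' (hτ.val_le (P.vanishes_iff.1 hs))
      (hτ.val_le (P.vanishes_iff.1 ht))) _

theorem isWeierstrass_of_root [IsAlgClosed k] (H : HyperellipticModel d x y) (hx : Transcendental k x)
    (h2 : (2 : k) ≠ 0) (hd : Squarefree d) (P : CurvePoint k K) {a : k} (hda : d.eval a = 0)
    (ha : P.val (x - algebraMap k K a) < 1) : P.IsWeierstrass := by
  have hne := sub_algebraMap_ne_zero hx a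
  have hd' : d.derivative.eval a ≠ 0 :=
    (smooth_of_squarefree hd (b := 0) (by rw [hda, zero_pow two_ne_zero])).resolve_left (by simp)
  have hpos : 0 < P.val (x - algebraMap k K a) := zero_lt_iff.2 (by simpa using hne)
  refine ⟨(x - algebraMap k K a)⁻¹, ?_, fun Q hQ => ?_, fun s t hs ht => ?_⟩
  · rw [P.not_mem_iff, map_inv₀]
    exact (one_lt_inv₀ hpos).2 ha
  · rw [Q.mem_iff, map_inv₀, inv_le_one₀ (zero_lt_iff.2 (by simpa using hne))]
    by_contra! h
    exact hQ (H.branch_point_eq hx h2 hd hda h ha)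
  · have hτ := (H.isChart_of_root hx P ha hda hd').isUniformizer
    obtain ⟨q, hq⟩ := dvd_iff_isRoot.2 hda
    have hqa : q.eval a ≠ 0 := by
      rw [hq] at hd'
      simpa using hd'
    have h1 : P.val y * P.val y = P.val (x - algebraMap k K a) := by
      rw [← sq, ← map_pow, H.eq, hq, map_mul, map_mul, val_aeval_eq_one P ha hqa]
      simp
    rw [P.mem_iff, map_mul, map_mul, map_inv₀]
    apply mul_inv_le_one_of_le₀ _ zero_le
    rw [← h1]
    exact mul_le_mul' (hτ.val_le (P.vanishes_iff.1 hs)) (hτ.val_le (P.vanishes_iff.1 ht))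

/-- The Weierstrass points of a curve of genus two are the branch points. -/
theorem isWeierstrass_iff [IsAlgClosed k] (H : HyperellipticModel d x y) (hK : IsCurveField k K)
    (h2 : (2 : k) ≠ 0) (hd : Squarefree d) (hg : d.natDegree = 5) (P : CurvePoint k K) :
    P.IsWeierstrass ↔ 1 < P.val x ∨ ∃ a, d.eval a = 0 ∧ P.val (x - algebraMap k K a) < 1 := by
  have hx := H.transcendental hK
  have hd1 : ¬ IsUnit d := fun hu => by rw [natDegree_eq_zero_of_isUnit hu] at hg; omega
  constructor
  swap
  · rintro (hP | ⟨a, hda, ha⟩)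
    · exact H.isWeierstrass_infinity hx (g := 2) hg P hP
    · exact H.isWeierstrass_of_root hx h2 hd P hda ha
  · rintro ⟨h, hhP, hhQ, hst⟩
    by_contra! hc
    obtain ⟨hxP, hc⟩ := hc
    obtain ⟨a, b, ha, hb, hab, hs⟩ := H.exists_smooth_coordinates hK hd P hxP
    have hb0 : b ≠ 0 := by
      rintro rfl
      exact absurd (hc a (by rw [hab, zero_pow two_ne_zero])) (not_le.2 ha)
    have hne := sub_algebraMap_ne_zero hx a
    -- For a function `h` with pole at most double at `P = (a, b)`, the product `(x - a)² h` is
    -- regular on the affine curve and grows at most like `x²`. A term in `y` would need `5 ≤ 4`, so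
    -- `h` is a function of `x`, hence invariant under the involution. Its pole would also occur at
    -- `(a, -b)`, which differs from `P` as `b ≠ 0`.
    obtain ⟨A, B, hAB⟩ := H.exists_eq_of_forall_val_le hx h2 hd hd1
      (z := (x - algebraMap k K a) * (x - algebraMap k K a) * h) (by
        intro Q hQ
        by_cases hQP : Q = P
        · subst hQP
          exact Q.mem_iff.1 (hst _ _ (Q.vanishes_iff.2 ha) (Q.vanishes_iff.2 ha))
        · rw [map_mul, map_mul]
          have h1 : Q.val (x - algebraMap k K a) ≤ 1 :=
            (Q.val.map_sub _ _).trans (max_le hQ (Q.val_algebraMap_le a))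
          exact mul_le_one₀ (mul_le_one₀ h1 zero_le h1) zero_le (Q.mem_iff.1 (hhQ Q hQP)))
    obtain ⟨R, hR⟩ := exists_pole hx
    rw [R.not_mem_iff] at hR
    have hRP : R ≠ P := by
      rintro rfl
      exact absurd hxP (not_le.2 hR)
    have hRa : R.val (x - algebraMap k K a) = R.val x := by
      have := R.val_aeval_of_one_lt hR (X_sub_C_ne_zero a)
      simpa using this
    have h1 : R.val (aeval x A + aeval x B * y) ≤ R.val x ^ 2 := by
      rw [← hAB, map_mul, map_mul, hRa, ← sq]
      exact mul_le_of_le_one_right zero_le (R.mem_iff.1 (hhQ R hRP))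
    obtain ⟨hA, hB⟩ := H.natDegree_le_of_val_le hx h2 hd (g := 2) hg R hR h1
    have hB0 : B = 0 := by
      by_contra hB0
      have := hB hB0
      omega
    obtain ⟨e, hex, hey⟩ := H.exists_involution hx hd hd1
    have hh : h = aeval x A / aeval x ((X - C a) * (X - C a)) := by
      rw [hB0, map_zero, zero_mul, add_zero] at hAB
      rw [← hAB]
      simp only [map_mul, map_sub, aeval_X, aeval_C]
      field_simp
    have heh : e h = h := by
      rw [hh, map_div₀, ← aeval_algHom_apply, ← aeval_algHom_apply, hex]
    have hPe : P.comap e ≠ P := by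
      intro hPe
      have h3 : (P.comap e).val (y - algebraMap k K b) < 1 := by rwa [hPe]
      rw [P.val_comap_lt_one, map_sub, hey, e.commutes] at h3
      have h4 := P.val.map_add_lt hb h3
      have : y - algebraMap k K b + (-y - algebraMap k K b) = algebraMap k K (-(2 * b)) := by
        simp only [map_neg, map_mul, map_ofNat]; ring
      rw [this, P.val_algebraMap (neg_ne_zero.2 (mul_ne_zero h2 hb0))] at h4
      exact lt_irrefl _ h4
    have h5 := (P.comap e).mem_iff.1 (hhQ _ hPe)
    rw [P.val_comap_le_one, heh, ← P.mem_iff] at h5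
    exact hhP h5

/-- A function whose only pole is the point at infinity, of order at most two, is linear in `x`. -/
theorem exists_eq_linear [IsAlgClosed k] (H : HyperellipticModel d x y) (hK : IsCurveField k K)
    (h2 : (2 : k) ≠ 0) (hd : Squarefree d) (hg : d.natDegree = 5) (P : CurvePoint k K)
    (hP : 1 < P.val x) {z : K} (hz : ∀ Q, Q ≠ P → z ∈ Q.ring)
    (hst : ∀ s t : K, P.Vanishes s → P.Vanishes t → s * t * z ∈ P.ring) :
    ∃ α β : k, z = algebraMap k K α * x + algebraMap k K β := by
  have hx := H.transcendental hK
  have hd1 : ¬ IsUnit d := fun hu => by rw [natDegree_eq_zero_of_isUnit hu] at hg; omega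
  obtain ⟨A, B, rfl⟩ := H.exists_eq_of_forall_val_le hx h2 hd hd1 (z := z) (by
    intro Q hQ
    refine Q.mem_iff.1 (hz Q ?_)
    rintro rfl
    exact absurd hQ (not_le.2 hP))
  obtain ⟨τ, hτ, h1⟩ := H.isUniformizer_infinity hx (g := 2) hg P hP
  have h3 := P.mem_iff.1 (hst τ τ (P.vanishes_iff.2 hτ.1) (P.vanishes_iff.2 hτ.1))
  -- A pole of order at most two is a growth no faster than that of `x`.
  have h4 : P.val (aeval x A + aeval x B * y) ≤ P.val x ^ 1 := by
    have hτ0 : 0 < P.val τ * P.val τ := by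
      have : 0 < P.val τ := zero_lt_iff.2 (by simpa using hτ.2.1)
      exact mul_pos this this
    rw [pow_one, ← mul_le_mul_iff_right₀ hτ0, h1]
    rwa [map_mul, map_mul] at h3
  obtain ⟨hA, hB⟩ := H.natDegree_le_of_val_le hx h2 hd (g := 2) hg P hP h4
  have hB0 : B = 0 := by
    by_contra hB0
    have := hB hB0
    omega
  have hA1 : A.natDegree ≤ 1 := by
    by_cases hA0 : A = 0
    · simp [hA0]
    · exact hA hA0
  refine ⟨A.coeff 1, A.coeff 0, ?_⟩
  conv_lhs => rw [hB0, eq_X_add_C_of_natDegree_le_one hA1]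
  simp

end HyperellipticModel
end

noncomputable section

theorem RatFunc.aeval_X_eq {k : Type*} [Field k] (A : k[X]) :
    aeval (RatFunc.X : RatFunc k) A = algebraMap k[X] (RatFunc k) A := by
  rw [← RatFunc.algebraMap_X, aeval_algebraMap_apply, aeval_X_left_apply]

/-! ### Degrees of homomorphisms of function fields. -/

section Degree

variable {k K L M : Type*} [Field k] [Field K] [Field L] [Field M] [Algebra k K] [Algebra k L]
  [Algebra k M]

/-- The degree of a homomorphism of function fields. -/
def homDegree (f : K →ₐ[k] L) : ℕ :=
  letI : Algebra K L := f.toRingHom.toAlgebra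
  Module.finrank K L

theorem homDegree_comp (f : K →ₐ[k] L) (g : L →ₐ[k] M) :
    homDegree (g.comp f) = homDegree f * homDegree g := by
  let : Algebra K L := f.toRingHom.toAlgebra
  let : Algebra L M := g.toRingHom.toAlgebra
  let : Algebra K M := (g.comp f).toRingHom.toAlgebra
  have : IsScalarTower K L M := IsScalarTower.of_algebraMap_eq fun _ => rfl
  exact (Module.finrank_mul_finrank K L M).symm

theorem homDegree_algEquiv (e : K ≃ₐ[k] L) : homDegree e.toAlgHom = 1 := by
  let : Algebra K L := e.toAlgHom.toRingHom.toAlgebra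
  change Module.finrank K L = 1
  let e' : K ≃ₗ[K] L :=
    { e with
      map_smul' := fun c z => by
        change e (c * z) = e c * e z
        exact map_mul e c z }
  rw [← e'.finrank_eq, Module.finrank_self]

theorem AlgHom.finite_of_homDegree_ne_zero {f : K →ₐ[k] L} (h : homDegree f ≠ 0) : f.Finite := by
  let : Algebra K L := f.toRingHom.toAlgebra
  exact Module.finite_of_finrank_pos (R := K) (M := L) (Nat.pos_of_ne_zero h)

theorem homDegree_eq_finrank_adjoin (f : RatFunc k →ₐ[k] L) :
    homDegree f = Module.finrank (IntermediateField.adjoin k {f RatFunc.X}) L := by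
  let : Algebra (RatFunc k) L := f.toRingHom.toAlgebra
  have hr : f.fieldRange = IntermediateField.adjoin k {f RatFunc.X} := by
    apply le_antisymm
    · rintro _ ⟨z, rfl⟩
      have hp : ∀ A : k[X], f (algebraMap k[X] (RatFunc k) A) = aeval (f RatFunc.X) A := by
        intro A
        rw [aeval_algHom_apply, RatFunc.aeval_X_eq]
      rw [IntermediateField.mem_adjoin_simple_iff]
      refine ⟨z.num, z.denom, ?_⟩
      rw [← hp, ← hp, ← map_div₀, RatFunc.num_div_denom]
      rfl
    · rw [IntermediateField.adjoin_simple_le_iff]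
      exact ⟨_, rfl⟩
  rw [← hr]
  let e : RatFunc k ≃+* f.fieldRange :=
    (RingEquiv.ofBijective (f.rangeRestrict : RatFunc k →+* f.range)
      ⟨RingHom.injective _, f.rangeRestrict_surjective⟩)
  exact Algebra.finrank_eq_of_equiv_equiv e (RingEquiv.refl L) rfl

theorem homDegree_ratFunc (f : RatFunc k →ₐ[k] RatFunc k) :
    homDegree f = max (f RatFunc.X).num.natDegree (f RatFunc.X).denom.natDegree := by
  rw [homDegree_eq_finrank_adjoin, RatFunc.finrank_eq_max_natDegree]

end Degree

/-! ### Maps on points and ramification. -/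

section Maps

variable {k K L : Type*} [Field k] [Field K] [Field L] [Algebra k K] [Algebra k L]

theorem CurveCover.val_map_le_one (φ : CurveCover k K L) (P : CurvePoint k L) (z : K) :
    (φ.map P).val z ≤ 1 ↔ P.val (φ.pullback z) ≤ 1 := by
  rw [← CurvePoint.mem_iff, ← CurvePoint.mem_iff]; rfl

theorem CurveCover.val_map_lt_one (φ : CurveCover k K L) (P : CurvePoint k L) (z : K) :
    (φ.map P).val z < 1 ↔ P.val (φ.pullback z) < 1 := by
  by_cases hz : z = 0
  · simp [hz]
  rw [CurvePoint.val_lt_one_iff_inv _ hz, CurvePoint.val_lt_one_iff_inv _ (by simpa using hz),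
    val_map_le_one, map_inv₀]

theorem CurveCover.one_lt_val_map (φ : CurveCover k K L) (P : CurvePoint k L) (z : K) :
    1 < (φ.map P).val z ↔ 1 < P.val (φ.pullback z) := by
  rw [← not_le, ← not_le, val_map_le_one]

theorem CurvePoint.IsUniformizer.maximalIdeal_eq {P : CurvePoint k K} {t : K}
    (h : P.IsUniformizer t) :
    IsLocalRing.maximalIdeal P.ring = Ideal.span {⟨t, P.mem_iff.2 h.1.le⟩} := by
  have ht0 : P.val t ≠ 0 := by simpa using h.2.1
  apply le_antisymm
  · rintro ⟨z, hz⟩ hzm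
    have hlt : P.val z < 1 := (P.ring.valuation_lt_one_iff ⟨z, hz⟩).1 hzm
    rw [Ideal.mem_span_singleton]
    refine ⟨⟨z / t, P.mem_iff.2 ?_⟩, Subtype.ext ?_⟩
    · rw [map_div₀, div_le_one₀ (zero_lt_iff.2 ht0)]
      exact h.val_le hlt
    · exact (mul_div_cancel₀ z h.2.1).symm
  · rw [Ideal.span_singleton_le_iff_mem]
    exact (P.ring.valuation_lt_one_iff ⟨t, _⟩).2 h.1

/-- With both maximal ideals principal, the inclusion of ideals becomes a divisibility in a
valuation ring. -/
theorem CurveCover.isRamifiedAt_iff (φ : CurveCover k K L) (P : CurvePoint k L) {s : K} {t : L}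
    (hs : (φ.map P).IsUniformizer s) (ht : P.IsUniformizer t) :
    φ.IsRamifiedAt P ↔ P.val (φ.pullback s) ≤ P.val t ^ 2 := by
  have ht0 : P.val t ≠ 0 := by simpa using ht.2.1
  rw [IsRamifiedAt, hs.maximalIdeal_eq, ht.maximalIdeal_eq, Ideal.map_span, Set.image_singleton,
    Ideal.span_singleton_pow, Ideal.span_singleton_le_span_singleton]
  have e : ((φ.localHom P ⟨s, (φ.map P).mem_iff.2 hs.1.le⟩ : P.ring) : L) = φ.pullback s := rfl
  constructor
  · rintro ⟨c, hc⟩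
    have h := congrArg (fun z : P.ring => P.val (z : L)) hc
    simp only [e] at h
    rw [h]
    change P.val (t ^ 2 * c) ≤ _
    rw [map_mul, map_pow]
    exact mul_le_of_le_one_right zero_le (P.mem_iff.1 c.2)
  · intro h
    refine ⟨⟨φ.pullback s / t ^ 2, P.mem_iff.2 ?_⟩, Subtype.ext ?_⟩
    · rw [map_div₀, map_pow, div_le_one₀ (zero_lt_iff.2 (pow_ne_zero 2 ht0))]
      exact h
    · exact (mul_div_cancel₀ _ (pow_ne_zero 2 ht.2.1)).symm

end Maps

/-! ### Points of the projective line. -/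

section RationalCurve

variable {k K : Type*} [Field k] [Field K] [Algebra k K] {x : K}

theorem exists_eq_pow_mul_of_ne_zero {A : k[X]} (hA : A ≠ 0) (x : K) (a : k) :
    ∃ (n : ℕ) (q : k[X]), q.eval a ≠ 0 ∧ A = (X - C a) ^ n * q ∧
      aeval x A = (x - algebraMap k K a) ^ n * aeval x q := by
  obtain ⟨q, hq, hqa⟩ := exists_eq_pow_rootMultiplicity_mul_and_not_dvd A hA a
  rw [dvd_iff_isRoot, IsRoot.def] at hqa
  refine ⟨_, q, hqa, hq, ?_⟩
  conv_lhs => rw [hq]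
  simp

/-- Vanishing orders of polynomials. -/
theorem val_aeval_le_pow_iff (P : CurvePoint k K) {a : k} (ha : P.val (x - algebraMap k K a) < 1)
    (hx : Transcendental k x) (A : k[X]) (n : ℕ) :
    P.val (aeval x A) ≤ P.val (x - algebraMap k K a) ^ n ↔ (X - C a) ^ n ∣ A := by
  have h0 : 0 < P.val (x - algebraMap k K a) :=
    zero_lt_iff.2 (by simpa using HyperellipticModel.sub_algebraMap_ne_zero hx a)
  constructor
  · intro h
    by_cases hA : A = 0
    · simp [hA]
    obtain ⟨m, q, hq, hAq, hAx⟩ := exists_eq_pow_mul_of_ne_zero hA x a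
    rw [hAx, map_mul, HyperellipticModel.val_aeval_eq_one P ha hq, mul_one, map_pow,
      pow_le_pow_iff_right_of_lt_one₀ h0 ha] at h
    rw [hAq]
    exact dvd_mul_of_dvd_left (pow_dvd_pow _ h) q
  · rintro ⟨q, rfl⟩
    rw [map_mul, map_mul, map_pow, map_pow, map_sub, aeval_X, aeval_C]
    exact mul_le_of_le_one_right zero_le (P.val_aeval_le (P.val_le_of_sub_lt ha) q)

/-- Charts of the projective line. -/
theorem isChart_line (hx : Transcendental k x) (htop : IntermediateField.adjoin k {x} = ⊤)
    (P : CurvePoint k K) {a : k} (ha : P.val (x - algebraMap k K a) < 1) :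
    P.IsChart (Algebra.adjoin k {x}) (x - algebraMap k K a) := by
  have hmem : ∀ A : k[X], aeval x A ∈ Algebra.adjoin k {x} := fun A =>
    aeval_mem_adjoin_singleton k x
  have hmem' : ∀ r ∈ Algebra.adjoin k {x}, ∃ A : k[X], r = aeval x A := by
    intro r hr
    rw [Algebra.adjoin_singleton_eq_range_aeval] at hr
    obtain ⟨A, hA⟩ := hr
    exact ⟨A, hA.symm⟩
  refine ⟨?_, ?_, ?_, ha, HyperellipticModel.sub_algebraMap_ne_zero hx a, ?_⟩
  · intro r hr
    obtain ⟨A, rfl⟩ := hmem' r hr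
    exact P.val_aeval_le (P.val_le_of_sub_lt ha) A
  · intro z
    have hz : z ∈ IntermediateField.adjoin k {x} := htop ▸ IntermediateField.mem_top
    obtain ⟨A, B, rfl⟩ := (IntermediateField.mem_adjoin_simple_iff k z).1 hz
    by_cases hB : aeval x B = 0
    · exact ⟨0, zero_mem _, 1, one_mem _, one_ne_zero, by simp [hB]⟩
    · exact ⟨_, hmem A, _, hmem B, hB, rfl⟩
  · have := hmem (X - C a)
    rwa [map_sub, aeval_X, aeval_C] at this
  · intro r hr hr0
    obtain ⟨A, rfl⟩ := hmem' r hr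
    have hA : A ≠ 0 := by rintro rfl; simp at hr0
    obtain ⟨m, q, hq, -, hAx⟩ := exists_eq_pow_mul_of_ne_zero hA x a
    exact ⟨m, aeval x q, hmem q, 1, one_mem _, HyperellipticModel.val_aeval_eq_one P ha hq,
      map_one _, by rw [one_mul, hAx]⟩

theorem line_point_eq (hx : Transcendental k x) (htop : IntermediateField.adjoin k {x} = ⊤)
    {P Q : CurvePoint k K} {a : k} (ha : P.val (x - algebraMap k K a) < 1)
    (ha' : Q.val (x - algebraMap k K a) < 1) : P = Q := by
  refine (isChart_line hx htop P ha).eq (isChart_line hx htop Q ha').val_le fun r hr => ?_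
  rw [Algebra.adjoin_singleton_eq_range_aeval] at hr
  obtain ⟨A, rfl⟩ := hr
  change P.val (aeval x A) < 1 ↔ Q.val (aeval x A) < 1
  rw [P.val_lt_one_iff_of_sub_lt (P.val_aeval_sub_lt ha A),
    Q.val_lt_one_iff_of_sub_lt (Q.val_aeval_sub_lt ha' A)]

end RationalCurve

section Line

variable {k : Type*} [Field k]

theorem RatFunc.adjoin_X_eq_top : IntermediateField.adjoin k {(RatFunc.X : RatFunc k)} = ⊤ := by
  rw [eq_top_iff]
  intro z _
  rw [IntermediateField.mem_adjoin_simple_iff]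
  exact ⟨z.num, z.denom, by rw [aeval_X_eq, aeval_X_eq, num_div_denom]⟩

theorem val_linePoint (a : k) :
    (linePoint a).val (RatFunc.X - algebraMap k (RatFunc k) a) < 1 := by
  have hne := HyperellipticModel.sub_algebraMap_ne_zero (RatFunc.transcendental_X (K := k)) a
  rw [CurvePoint.val_lt_one_iff_inv _ hne, ← CurvePoint.mem_iff]
  change ¬ (_ ∈ Valuation.valuationSubring _)
  rw [Valuation.mem_valuationSubring_iff, map_inv₀, inv_le_one₀, not_le]
  · have : RatFunc.X - algebraMap k (RatFunc k) a = algebraMap k[X] (RatFunc k) (X - C a) := by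
      simp [RatFunc.algebraMap_C]
    rw [this, IsDedekindDomain.HeightOneSpectrum.valuation_lt_one_iff_mem]
    exact Ideal.mem_span_singleton_self _
  · rw [zero_lt_iff, Valuation.ne_zero_iff]
    exact hne

theorem val_lineInfty : 1 < (lineInfty (k := k)).val RatFunc.X := by
  rw [← CurvePoint.not_mem_iff]
  change ¬ (_ ∈ Valuation.valuationSubring _)
  rw [Valuation.mem_valuationSubring_iff, RatFunc.inftyValuation.X]
  decide

theorem eq_linePoint {P : CurvePoint k (RatFunc k)} {a : k}
    (h : P.val (RatFunc.X - algebraMap k (RatFunc k) a) < 1) : P = linePoint a :=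
  line_point_eq RatFunc.transcendental_X RatFunc.adjoin_X_eq_top h (val_linePoint a)

theorem isUniformizer_linePoint (a : k) :
    (linePoint a).IsUniformizer (RatFunc.X - algebraMap k (RatFunc k) a) :=
  (isChart_line RatFunc.transcendental_X RatFunc.adjoin_X_eq_top _ (val_linePoint a)).isUniformizer

theorem val_inv_sub_zero_lt {K : Type*} [Field K] [Algebra k K] {P : CurvePoint k K} {x : K}
    (h : 1 < P.val x) : P.val (x⁻¹ - algebraMap k K 0) < 1 := by
  rw [map_zero, sub_zero, map_inv₀]
  exact inv_lt_one_of_one_lt₀ h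

theorem RatFunc.adjoin_inv_X_eq_top :
    IntermediateField.adjoin k {(RatFunc.X : RatFunc k)⁻¹} = ⊤ := by
  rw [eq_top_iff, ← adjoin_X_eq_top, IntermediateField.adjoin_simple_le_iff, ← inv_mem_iff]
  exact IntermediateField.mem_adjoin_simple_self _ _

theorem eq_lineInfty {P : CurvePoint k (RatFunc k)} (h : 1 < P.val RatFunc.X) : P = lineInfty :=
  line_point_eq (HyperellipticModel.transcendental_inv RatFunc.transcendental_X)
    RatFunc.adjoin_inv_X_eq_top (val_inv_sub_zero_lt h) (val_inv_sub_zero_lt val_lineInfty)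

theorem isUniformizer_lineInfty : (lineInfty (k := k)).IsUniformizer RatFunc.X⁻¹ := by
  have := (isChart_line (HyperellipticModel.transcendental_inv RatFunc.transcendental_X)
    RatFunc.adjoin_inv_X_eq_top _ (val_inv_sub_zero_lt (val_lineInfty (k := k)))).isUniformizer
  rwa [map_zero, sub_zero] at this

end Line
end

noncomputable section

/-! ### The family of rational functions with parameter `p`. -/

section Parameter

variable {k : Type*} [Field k] {lam : k}

/-- The numerator of `uFun`. -/
def uNum (lam p : k) : k[X] := C lam * (X - C p) * X ^ 2

theorem gPoly_eq (lam p : k) : gPoly lam p =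
    X ^ 3 + C (-p) * X ^ 2 + C ((lam - 1) * (3 - 2 * p)) * X + C ((lam - 1) * (p - 2)) := by
  rw [gPoly]
  simp only [map_mul, map_sub, map_add, map_neg, C_1, map_ofNat]
  ring

theorem uNum_eq (lam p : k) : uNum lam p = C lam * X ^ 3 + C (-(lam * p)) * X ^ 2 := by
  rw [uNum]
  simp only [map_mul, map_neg]
  ring

theorem natDegree_gPoly (lam p : k) : (gPoly lam p).natDegree = 3 := by
  rw [gPoly_eq]; compute_degree!

theorem gPoly_monic (lam p : k) : (gPoly lam p).Monic := by
  rw [gPoly_eq]; monicity!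

theorem gPoly_ne_zero (lam p : k) : gPoly lam p ≠ 0 := (gPoly_monic lam p).ne_zero

theorem natDegree_uNum (h_zero : lam ≠ 0) (p : k) : (uNum lam p).natDegree = 3 := by
  rw [uNum_eq]; compute_degree!

/-- The fibre over `1`: double at `1`, with residual point `p - 2`. -/
theorem uNum_sub_gPoly (lam p : k) :
    uNum lam p - gPoly lam p = C (lam - 1) * (X - 1) ^ 2 * (X - C p + 2) := by
  rw [uNum_eq, gPoly_eq]
  simp only [map_mul, map_sub, map_neg, C_1, map_ofNat]
  ring

/-- The fibre over `lam`: the degree drops from three to at most one, which is the ramification at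
infinity, and the linear factor gives the residual point. For `2 p = 3` this point is infinity as
well. -/
theorem uNum_sub_lam_gPoly (lam p : k) :
    uNum lam p - C lam * gPoly lam p = C (lam * (lam - 1)) * (C (2 * p - 3) * X - C p + 2) := by
  rw [uNum_eq, gPoly_eq]
  simp only [map_mul, map_sub, map_neg, C_1, map_ofNat]
  ring

/-- The parameters of the covers in `𝒰`. -/
structure GoodParameter (lam p : k) : Prop where
  isCoprime : IsCoprime (uNum lam p) (gPoly lam p)
  squarefree : Squarefree (gPoly lam p)

/-- A rational function of degree three with the ramification prescribed in `𝒰`. -/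
theorem exists_parameter (h_zero : lam ≠ 0) {R S : k[X]} (hR3 : R.natDegree ≤ 3)
    (hc3 : R.coeff 3 ≠ 0) (h0 : X ^ 2 ∣ R) (h1 : (X - C 1) ^ 2 ∣ R - S)
    (hinf : (R - C lam * S).natDegree ≤ 1) :
    ∃ p c : k, c ≠ 0 ∧ R = C c * uNum lam p ∧ S = C c * gPoly lam p := by
  have hR : R = C (R.coeff 3) * X ^ 3 + C (R.coeff 2) * X ^ 2 := by
    rw [X_pow_dvd_iff] at h0
    ext n
    by_cases hn : n ≤ 3
    · interval_cases n <;> simp [h0 0, h0 1, coeff_X_pow]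
    · rw [coeff_eq_zero_of_natDegree_lt (by omega)]
      simp [coeff_X_pow, show n ≠ 3 by omega, show n ≠ 2 by omega]
  have hT := eq_X_add_C_of_natDegree_le_one hinf
  generalize (R - C lam * S).coeff 1 = m at hT
  generalize (R - C lam * S).coeff 0 = n at hT
  generalize R.coeff 3 = e at *
  generalize R.coeff 2 = f at *
  obtain ⟨Q, hQ⟩ := h1
  have e1 := congrArg (eval 1) hQ
  have e2 := congrArg (fun p => eval 1 (derivative p)) hQ
  have e3 := congrArg (eval 1) hT
  have e4 := congrArg (fun p => eval 1 (derivative p)) hT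
  rw [hR] at e1 e2 e3 e4
  simp [derivative_pow] at e1 e2 e3 e4
  -- The conditions at `0` and the degree give `R = e X³ + f X²`, and `R - lam S = m X + n`. As `R`
  -- and `S` agree to second order at `1`, the coefficients `m` and `n` can be read off from the
  -- value and the derivative of `R` there.
  have hm : m = (1 - lam) * (3 * e + 2 * f) := by linear_combination lam * e2 - e4
  have hn : n = (1 - lam) * (-2 * e - f) := by linear_combination lam * e1 - e3 - hm
  -- The parameter is the nonzero root of `e X³ + f X²`, or `0` if `f = 0`; the constant matches the
  -- leading coefficients.
  refine ⟨-f / e, e / lam, div_ne_zero hc3 h_zero, ?_, ?_⟩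
  · rw [uNum_eq, mul_add, ← mul_assoc, ← mul_assoc, ← C_mul, ← C_mul]
    conv_lhs => rw [hR]
    congr 3 <;> field_simp
  · have hS : S = C lam⁻¹ * (R - (C m * X + C n)) := by
      rw [← hT, sub_sub_cancel, ← mul_assoc, ← C_mul, inv_mul_cancel₀ h_zero, C_1, one_mul]
    rw [hS, hR, gPoly_eq, hm, hn]
    ext i
    simp only [coeff_C_mul, coeff_add, coeff_sub, coeff_X_pow, coeff_X, coeff_C]
    rcases i with _ | _ | _ | _ | i
    · simp; field_simp; ring
    · simp; field_simp; ring
    · simp; field_simp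
    · simp; field_simp
    · simp

theorem uFun_eq (lam p : k) : uFun lam p =
    algebraMap k[X] (RatFunc k) (uNum lam p) / algebraMap k[X] (RatFunc k) (gPoly lam p) := rfl

/-- After cross multiplication the coefficients of `X⁴` differ by `2 lam (lam - 1) (p - q)`. -/
theorem uFun_injective (h2 : (2 : k) ≠ 0) (h_zero : lam ≠ 0) (h_one : lam ≠ 1) {p q : k}
    (h : uFun lam p = uFun lam q) : p = q := by
  rw [uFun_eq, uFun_eq, div_eq_div_iff (by simpa using gPoly_ne_zero lam p)
    (by simpa using gPoly_ne_zero lam q), ← map_mul, ← map_mul] at h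
  have h' := RatFunc.algebraMap_injective k h
  rw [uNum_eq, uNum_eq, gPoly_eq, gPoly_eq] at h'
  have h4 := congrArg (fun P => coeff P 4) h'
  have e : ∀ a b c q : k, (C lam * X ^ 3 + C a * X ^ 2) *
      (X ^ 3 + C b * X ^ 2 + C c * X + C q) = C lam * X ^ 6 + C (lam * b + a) * X ^ 5 +
        C (lam * c + a * b) * X ^ 4 + C (lam * q + a * c) * X ^ 3 + C (a * q) * X ^ 2 := by
    intro a b c q
    simp only [map_mul, map_add]; ring
  rw [e, e] at h4
  simp only [coeff_add, coeff_C_mul, coeff_X_pow] at h4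
  norm_num at h4
  have h5 : lam * (lam - 1) * 2 * (p - q) = 0 := by linear_combination h4
  have hl : lam * (lam - 1) * 2 ≠ 0 :=
    mul_ne_zero (mul_ne_zero h_zero (sub_ne_zero.2 h_one)) h2
  exact sub_eq_zero.1 ((mul_eq_zero.1 h5).resolve_left hl)

theorem natDegree_num_of_coprime {A B : k[X]} (hB : B ≠ 0) (hAB : IsCoprime A B) {w : RatFunc k}
    (hw : w = algebraMap k[X] (RatFunc k) A / algebraMap k[X] (RatFunc k) B) :
    w.num.natDegree = A.natDegree ∧ w.denom.natDegree = B.natDegree := by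
  have h : w.num * B = A * w.denom := by
    apply RatFunc.algebraMap_injective k
    rw [map_mul, map_mul, ← div_eq_div_iff (by simpa using w.denom_ne_zero) (by simpa using hB),
      RatFunc.num_div_denom, hw]
  have hc := w.isCoprime_num_denom
  constructor
  · apply natDegree_eq_of_degree_eq
    apply degree_eq_degree_of_associated
    exact associated_of_dvd_dvd (hc.dvd_of_dvd_mul_right ⟨B, h.symm⟩)
      (hAB.dvd_of_dvd_mul_right ⟨w.denom, h⟩)
  · apply natDegree_eq_of_degree_eq
    apply degree_eq_degree_of_associated
    refine associated_of_dvd_dvd (hc.symm.dvd_of_dvd_mul_left ⟨A, ?_⟩)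
      (hAB.symm.dvd_of_dvd_mul_left ⟨w.num, ?_⟩)
    · rw [h, mul_comm]
    · rw [← h, mul_comm]

end Parameter
end

noncomputable section

/-! ### Criteria for function fields of curves. -/

section CurveFields

variable {k K : Type*} [Field k] [Field K] [Algebra k K] {x : K}

open scoped IntermediateField.algebraAdjoinAdjoin in
theorem IsCurveField.of_transcendental {s : Set K} (hs : s.Finite)
    (htop : IntermediateField.adjoin k s = ⊤) (hx : Transcendental k x)
    (halg : Algebra.IsAlgebraic (IntermediateField.adjoin k {x}) K) : IsCurveField k K where
  finitelyGenerated := by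
    rw [← IntermediateField.fg_top_iff]
    exact ⟨hs.toFinset, by rw [hs.coe_toFinset, htop]⟩
  trdeg_eq_one := by
    have h1 : Algebra.IsAlgebraic (Algebra.adjoin k {x}) (IntermediateField.adjoin k {x}) :=
      IsLocalization.isAlgebraic _ (nonZeroDivisors (Algebra.adjoin k {x}))
    have h2 : Algebra.IsAlgebraic (Algebra.adjoin k {x}) K :=
      Algebra.IsAlgebraic.trans _ (IntermediateField.adjoin k {x}) _
    refine le_antisymm ?_ ?_
    · have := Algebra.IsAlgebraic.trdeg_le_cardinalMk k ({x} : Set K)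
      simpa using this
    · have hi : AlgebraicIndependent k (fun _ : Unit => x) := by
        rw [algebraicIndependent_unique_type_iff]; exact hx
      simpa using hi.lift_cardinalMk_le_trdeg

theorem HyperellipticModel.isCurveField {d : k[X]} {y : K} (H : HyperellipticModel d x y)
    (hx : Transcendental k x) : IsCurveField k K := by
  refine .of_transcendental (s := {x, y}) (by simp) H.adjoin_eq_top hx ⟨fun z => ?_⟩
  obtain ⟨a, ha, b, hb, rfl⟩ := H.exists_eq_add_mul z
  have hmem : ∀ c ∈ IntermediateField.adjoin k {x}, IsAlgebraic (IntermediateField.adjoin k {x}) c :=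
    fun c hc => isAlgebraic_algebraMap (⟨c, hc⟩ : IntermediateField.adjoin k {x})
  refine (hmem a ha).add ((hmem b hb).mul ?_)
  refine IsAlgebraic.of_pow (n := 2) two_pos ?_
  rw [H.eq]
  exact hmem _ ((IntermediateField.mem_adjoin_simple_iff k _).2 ⟨d, 1, by simp⟩)

theorem RatFunc.isCurveField : IsCurveField k (RatFunc k) := by
  refine .of_transcendental (s := {RatFunc.X}) (by simp) adjoin_X_eq_top transcendental_X
    ⟨fun z => ?_⟩
  have hz : z ∈ IntermediateField.adjoin k {(RatFunc.X : RatFunc k)} :=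
    RatFunc.adjoin_X_eq_top (k := k) ▸ IntermediateField.mem_top
  exact isAlgebraic_algebraMap (⟨z, hz⟩ : IntermediateField.adjoin k {(RatFunc.X : RatFunc k)})

end CurveFields

/-! ### The covers in `𝒰` correspond to the good parameters. -/

section NormalizedLineCovers

variable {k : Type*} [Field k] {lam : k}

theorem val_div_linePoint (P : CurvePoint k (RatFunc k)) {a : k}
    (ha : P.val (RatFunc.X - algebraMap k (RatFunc k) a) < 1) {A B : k[X]}
    (hB : B.eval a ≠ 0) :
    P.val (algebraMap k[X] (RatFunc k) A / algebraMap k[X] (RatFunc k) B) =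
      P.val (aeval RatFunc.X A) := by
  rw [← RatFunc.aeval_X_eq, ← RatFunc.aeval_X_eq, map_div₀,
    HyperellipticModel.val_aeval_eq_one P ha hB, div_one]

theorem eval_ne_zero_of_val_le (P : CurvePoint k (RatFunc k)) {a : k}
    (ha : P.val (RatFunc.X - algebraMap k (RatFunc k) a) < 1) {A B : k[X]}
    (hAB : IsCoprime A B) (hB : B ≠ 0)
    (h : P.val (algebraMap k[X] (RatFunc k) A / algebraMap k[X] (RatFunc k) B) ≤ 1) :
    B.eval a ≠ 0 := by
  intro h0
  have hA : A.eval a ≠ 0 := by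
    obtain ⟨α, β, h1⟩ := hAB
    intro hA
    have := congrArg (eval a) h1
    simp [hA, h0] at this
  have hB1 := (P.val_lt_one_iff_of_sub_lt (P.val_aeval_sub_lt ha B)).2 h0
  rw [← RatFunc.aeval_X_eq, ← RatFunc.aeval_X_eq, map_div₀,
    HyperellipticModel.val_aeval_eq_one P ha hA, one_div, inv_le_one₀] at h
  · exact absurd hB1 (not_lt.2 h)
  · rw [zero_lt_iff, RatFunc.aeval_X_eq]
    simpa using hB

/-- Every cover in `𝒰` is given by a parameter. -/
theorem exists_goodParameter [IsAlgClosed k] (h_zero : lam ≠ 0)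
    {φ : CurveCover k (RatFunc k) (RatFunc k)} (hφ : φ ∈ normalizedLineCovers lam) :
    ∃ p, φ.pullback RatFunc.X = uFun lam p ∧ GoodParameter lam p := by
  obtain ⟨hdeg, ⟨h0, r0⟩, ⟨h1, r1⟩, ⟨hi, ri⟩, hunr⟩ := hφ
  have hdeg' : max (φ.pullback RatFunc.X).num.natDegree (φ.pullback RatFunc.X).denom.natDegree = 3 := by
    rw [← homDegree_ratFunc]
    exact hdeg
  set w := φ.pullback RatFunc.X with hw
  have hwRS : w = algebraMap k[X] (RatFunc k) w.num / algebraMap k[X] (RatFunc k) w.denom :=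
    (RatFunc.num_div_denom w).symm
  have hcop := w.isCoprime_num_denom
  have hS0 := w.denom_ne_zero
  generalize w.num = R at *
  generalize w.denom = S at *
  have hsub : ∀ c : k, w - algebraMap k (RatFunc k) c =
      algebraMap k[X] (RatFunc k) (R - C c * S) / algebraMap k[X] (RatFunc k) S := by
    intro c
    have hS0' : algebraMap k[X] (RatFunc k) S ≠ 0 := by simpa using hS0
    rw [hwRS, map_sub, map_mul, sub_div, mul_div_cancel_right₀ _ hS0', RatFunc.algebraMap_C]
    rfl
  have hpull : ∀ c : k, φ.pullback (RatFunc.X - algebraMap k (RatFunc k) c) =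
      w - algebraMap k (RatFunc k) c := by
    intro c
    rw [map_sub, AlgHom.commutes]
  -- Vanishing of `w - a` to order two at `a` is a double zero of the numerator `R - a S`, since the
  -- denominator does not vanish there.
  have finite_case : ∀ a : k, φ.map (linePoint a) = linePoint a → φ.IsRamifiedAt (linePoint a) →
      (X - C a) ^ 2 ∣ R - C a * S := by
    intro a h r
    have ha := val_linePoint a
    have hu : (φ.map (linePoint a)).IsUniformizer (RatFunc.X - algebraMap k (RatFunc k) a) := by
      rw [h]; exact isUniformizer_linePoint a
    rw [φ.isRamifiedAt_iff _ hu (isUniformizer_linePoint a), hpull] at r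
    have hlt := (φ.val_map_lt_one _ _).1 hu.1
    rw [hpull, hsub] at hlt
    have hcop' : IsCoprime (R - C a * S) S := by
      rw [sub_eq_add_neg, ← neg_mul, mul_comm]
      exact IsCoprime.add_mul_left_left hcop _
    have hSa := eval_ne_zero_of_val_le _ ha hcop' hS0 hlt.le
    rw [hsub, val_div_linePoint _ ha hSa, val_aeval_le_pow_iff _ ha RatFunc.transcendental_X] at r
    exact r
  have d0 : X ^ 2 ∣ R := by simpa using finite_case 0 h0 r0
  have d1 : (X - C 1) ^ 2 ∣ R - S := by simpa using finite_case 1 h1 r1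
  -- At infinity the uniformizer is `1 / X`, so a zero of order two of `w - lam` is a drop of the
  -- degree by two.
  have dinf : (R - C lam * S).natDegree + 2 ≤ S.natDegree := by
    have hu : (φ.map lineInfty).IsUniformizer (RatFunc.X - algebraMap k (RatFunc k) lam) := by
      rw [hi]; exact isUniformizer_linePoint lam
    rw [φ.isRamifiedAt_iff _ hu isUniformizer_lineInfty, hpull, hsub, ← RatFunc.aeval_X_eq,
      ← RatFunc.aeval_X_eq] at ri
    have hne : R - C lam * S ≠ 0 := by
      intro h
      have h3 := hsub lam
      rw [h, map_zero, zero_div, ← hpull, map_eq_zero] at h3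
      exact HyperellipticModel.sub_algebraMap_ne_zero RatFunc.transcendental_X lam h3
    have hX := val_lineInfty (k := k)
    rw [map_div₀, CurvePoint.val_aeval_of_one_lt _ hX hne, CurvePoint.val_aeval_of_one_lt _ hX hS0,
      map_inv₀, inv_pow] at ri
    have hpos : 0 < (lineInfty (k := k)).val RatFunc.X := zero_lt_one.trans hX
    rw [div_le_iff₀ (pow_pos hpos _), ← div_eq_inv_mul, le_div_iff₀ (pow_pos hpos 2), ← pow_add,
      pow_le_pow_iff_right₀ hX] at ri
    exact ri
  have hRS : R.natDegree ≤ S.natDegree := by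
    have : R = (R - C lam * S) + C lam * S := by ring
    rw [this]
    refine (natDegree_add_le _ _).trans (max_le (by omega) (natDegree_C_mul_le _ _))
  have hS3 : S.natDegree = 3 := by rwa [max_eq_right hRS] at hdeg'
  have hc3 : R.coeff 3 ≠ 0 := by
    have h3 : (R - C lam * S).coeff 3 = 0 := coeff_eq_zero_of_natDegree_lt (by omega)
    rw [coeff_sub, coeff_C_mul, sub_eq_zero] at h3
    rw [h3, ← hS3]
    exact mul_ne_zero h_zero (leadingCoeff_ne_zero.2 hS0)
  obtain ⟨p, c, hc, hRp, hSp⟩ := exists_parameter h_zero (by omega) hc3 d0 d1 (by omega)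
  have hCc : IsUnit (C c : k[X]) := isUnit_C.2 hc.isUnit
  have hwp : w = uFun lam p := by
    rw [hwRS, hRp, hSp, map_mul, map_mul, mul_div_mul_left _ _ (by simpa using hc), uFun_eq]
  refine ⟨p, hwp, ?_, ?_⟩
  · rw [hRp, hSp] at hcop
    exact (isCoprime_mul_unit_left hCc _ _).1 hcop
  · have hcop' : IsCoprime (uNum lam p) (gPoly lam p) := by
      rw [hRp, hSp] at hcop
      exact (isCoprime_mul_unit_left hCc _ _).1 hcop
    -- A double root of `g` is a point over `∞` at which `1 / w` vanishes twice, i.e. a ramification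
    -- point that is excluded in `𝒰`.
    by_contra hsq
    obtain ⟨b, hb, hbu⟩ : ∃ b : k[X], b * b ∣ gPoly lam p ∧ ¬ IsUnit b := by
      simpa [Squarefree] using hsq
    have hb0 : b ≠ 0 := by
      rintro rfl
      simp [gPoly_ne_zero] at hb
    obtain ⟨a, ha⟩ := IsAlgClosed.exists_root b (fun h => hbu (isUnit_iff_degree_eq_zero.2 h))
    have hsqd : (X - C a) ^ 2 ∣ gPoly lam p := by
      rw [sq]
      exact (mul_dvd_mul (dvd_iff_isRoot.2 ha) (dvd_iff_isRoot.2 ha)).trans hb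
    have hla := val_linePoint a
    have hga : (gPoly lam p).eval a = 0 :=
      dvd_iff_isRoot.1 ((dvd_pow_self _ two_ne_zero).trans hsqd)
    have hua : (uNum lam p).eval a ≠ 0 := by
      obtain ⟨α, β, h1⟩ := hcop'
      intro hA
      have := congrArg (eval a) h1
      simp [hA, hga] at this
    have hwi : w⁻¹ = algebraMap k[X] (RatFunc k) (gPoly lam p) /
        algebraMap k[X] (RatFunc k) (uNum lam p) := by
      rw [hwp, uFun_eq, inv_div]
    have hmap : φ.map (linePoint a) = lineInfty := by
      apply eq_lineInfty
      rw [φ.one_lt_val_map, ← hw]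
      have hw0 : w ≠ 0 := by
        rw [hw]
        simpa using RatFunc.X_ne_zero
      rw [← not_le, ← inv_inv w, ← CurvePoint.val_lt_one_iff_inv _ (inv_ne_zero hw0), hwi,
        val_div_linePoint _ hla hua]
      exact (CurvePoint.val_lt_one_iff_of_sub_lt _ (CurvePoint.val_aeval_sub_lt _ hla _)).2 hga
    refine hunr _ hmap ?_
    have hu : (φ.map (linePoint a)).IsUniformizer RatFunc.X⁻¹ := by
      rw [hmap]; exact isUniformizer_lineInfty
    rw [φ.isRamifiedAt_iff _ hu (isUniformizer_linePoint a), map_inv₀, ← hw, hwi,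
      val_div_linePoint _ hla hua, val_aeval_le_pow_iff _ hla RatFunc.transcendental_X]
    exact hsqd

theorem GoodParameter.uFun_transcendental (h_zero : lam ≠ 0) {p : k} (hp : GoodParameter lam p) :
    Transcendental k (uFun lam p) := by
  apply RatFunc.transcendental_of_ne_C
  rintro ⟨c, hc⟩
  have h := (natDegree_num_of_coprime (gPoly_ne_zero lam p) hp.isCoprime (uFun_eq lam p)).1
  rw [hc, RatFunc.num_C, natDegree_C, natDegree_uNum h_zero] at h
  omega

theorem GoodParameter.homDegree_eq (h_zero : lam ≠ 0) {p : k} (hp : GoodParameter lam p) :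
    homDegree (ratFuncHom (hp.uFun_transcendental h_zero)) = 3 := by
  obtain ⟨h1, h2⟩ := natDegree_num_of_coprime (gPoly_ne_zero lam p) hp.isCoprime (uFun_eq lam p)
  rw [homDegree_ratFunc, ratFuncHom_X, h1, h2, natDegree_uNum h_zero, natDegree_gPoly, max_self]

theorem GoodParameter.eval_ne_zero {p : k} (hp : GoodParameter lam p) {a : k}
    (h : (uNum lam p).eval a = 0) : (gPoly lam p).eval a ≠ 0 := by
  obtain ⟨α, β, h1⟩ := hp.isCoprime
  intro hA
  have := congrArg (eval a) h1
  simp [hA, h] at this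

/-- Numerator and denominator agree at `1`, so a zero of `g` there would be a common zero. -/
theorem GoodParameter.eval_gPoly_one {p : k} (hp : GoodParameter lam p) :
    (gPoly lam p).eval 1 ≠ 0 := by
  intro h
  refine hp.eval_ne_zero ?_ h
  have := congrArg (eval 1) (uNum_sub_gPoly lam p)
  simpa [h] using this

/-- Every good parameter gives a cover in `𝒰`. -/
theorem GoodParameter.exists_cover [IsAlgClosed k] (h_zero : lam ≠ 0) {p : k}
    (hp : GoodParameter lam p) :
    ∃ φ ∈ normalizedLineCovers lam, φ.pullback RatFunc.X = uFun lam p := by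
  have hdeg := hp.homDegree_eq h_zero
  set f := ratFuncHom (hp.uFun_transcendental h_zero) with hf
  have hfX : f RatFunc.X = uFun lam p := ratFuncHom_X _
  have hfin : f.Finite := AlgHom.finite_of_homDegree_ne_zero (by omega)
  have hg0 : algebraMap k[X] (RatFunc k) (gPoly lam p) ≠ 0 := by simpa using gPoly_ne_zero lam p
  have hsub : ∀ c : k, f (RatFunc.X - algebraMap k (RatFunc k) c) =
      algebraMap k[X] (RatFunc k) (uNum lam p - C c * gPoly lam p) /
        algebraMap k[X] (RatFunc k) (gPoly lam p) := by
    intro c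
    rw [map_sub, AlgHom.commutes, hfX, uFun_eq, map_sub, map_mul, sub_div,
      mul_div_cancel_right₀ _ hg0, RatFunc.algebraMap_C]
    rfl
  let φ : CurveCover k (RatFunc k) (RatFunc k) := ⟨f, hfin⟩
  have finite_case : ∀ a : k, (gPoly lam p).eval a ≠ 0 →
      (X - C a) ^ 2 ∣ uNum lam p - C a * gPoly lam p →
      φ.map (linePoint a) = linePoint a ∧ φ.IsRamifiedAt (linePoint a) := by
    intro a hga hdvd
    have hla := val_linePoint a
    -- This single estimate gives both the image of `a` and the ramification.
    have key : (linePoint a).val (f (RatFunc.X - algebraMap k (RatFunc k) a)) ≤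
        (linePoint a).val (RatFunc.X - algebraMap k (RatFunc k) a) ^ 2 := by
      rw [hsub, val_div_linePoint _ hla hga, val_aeval_le_pow_iff _ hla RatFunc.transcendental_X]
      exact hdvd
    have hmap : φ.map (linePoint a) = linePoint a := by
      apply eq_linePoint
      rw [φ.val_map_lt_one]
      exact key.trans_lt (pow_lt_one₀ zero_le hla two_ne_zero)
    refine ⟨hmap, ?_⟩
    rw [φ.isRamifiedAt_iff _ (by rw [hmap]; exact isUniformizer_linePoint a)
      (isUniformizer_linePoint a)]
    exact key
  have hX := val_lineInfty (k := k)
  refine ⟨φ, ⟨hdeg, finite_case 0 ?_ ?_, finite_case 1 hp.eval_gPoly_one ?_, ?_, ?_⟩, hfX⟩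
  · exact hp.eval_ne_zero (by simp [uNum])
  · rw [C_0, zero_mul, sub_zero, sub_zero, uNum]
    exact dvd_mul_left _ _
  · rw [C_1, one_mul, uNum_sub_gPoly]
    exact dvd_mul_of_dvd_left (dvd_mul_left _ _) _
  · have key : (lineInfty (k := k)).val (f (RatFunc.X - algebraMap k (RatFunc k) lam)) ≤
        (lineInfty (k := k)).val RatFunc.X⁻¹ ^ 2 := by
      rw [hsub]
      by_cases h0 : uNum lam p - C lam * gPoly lam p = 0
      · simp [h0]
      · have hpos : 0 < (lineInfty (k := k)).val RatFunc.X := zero_lt_one.trans hX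
        rw [← RatFunc.aeval_X_eq, ← RatFunc.aeval_X_eq, map_div₀,
          CurvePoint.val_aeval_of_one_lt _ hX h0,
          CurvePoint.val_aeval_of_one_lt _ hX (gPoly_ne_zero lam p), natDegree_gPoly, map_inv₀,
          inv_pow, div_le_iff₀ (pow_pos hpos _), ← div_eq_inv_mul, le_div_iff₀ (pow_pos hpos 2),
          ← pow_add]
        apply pow_le_pow_right₀ hX.le
        have : (uNum lam p - C lam * gPoly lam p).natDegree ≤ 1 := by
          rw [uNum_sub_lam_gPoly]
          compute_degree
        omega
    have hmap : φ.map lineInfty = linePoint lam := by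
      apply eq_linePoint
      rw [φ.val_map_lt_one]
      exact key.trans_lt (pow_lt_one₀ zero_le isUniformizer_lineInfty.1 two_ne_zero)
    refine ⟨hmap, ?_⟩
    rw [φ.isRamifiedAt_iff _ (by rw [hmap]; exact isUniformizer_linePoint lam)
      isUniformizer_lineInfty]
    exact key
  · intro P hP hram
    -- A finite point over `∞` is a root of `g`, simple by squarefreeness. The point at infinity is
    -- not over `∞` because numerator and denominator both have degree three.
    by_cases hPX : P.val RatFunc.X ≤ 1
    · obtain ⟨a, ha⟩ := RatFunc.isCurveField.exists_sub_lt P hPX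
      have hP' : 1 < P.val (f RatFunc.X) := by
        rw [← φ.one_lt_val_map, hP]
        exact hX
      have hga : (gPoly lam p).eval a = 0 := by
        by_contra hga
        rw [hfX, uFun_eq, val_div_linePoint P ha hga] at hP'
        exact absurd (P.val_aeval_le hPX _) (not_le.2 hP')
      have hua : (uNum lam p).eval a ≠ 0 := fun h => hp.eval_ne_zero h hga
      have hu : (φ.map P).IsUniformizer RatFunc.X⁻¹ := by
        rw [hP]; exact isUniformizer_lineInfty
      have ht : P.IsUniformizer (RatFunc.X - algebraMap k (RatFunc k) a) := by
        rw [eq_linePoint ha]; exact isUniformizer_linePoint a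
      rw [φ.isRamifiedAt_iff _ hu ht] at hram
      change P.val (f RatFunc.X⁻¹) ≤ _ at hram
      rw [map_inv₀, hfX, uFun_eq, inv_div, val_div_linePoint P ha hua,
        val_aeval_le_pow_iff _ ha RatFunc.transcendental_X, sq] at hram
      exact not_isUnit_X_sub_C a (hp.squarefree _ hram)
    · rw [not_le] at hPX
      have hP' : 1 < P.val (f RatFunc.X) := by
        rw [← φ.one_lt_val_map, hP]
        exact hX
      rw [hfX, uFun_eq, ← RatFunc.aeval_X_eq, ← RatFunc.aeval_X_eq, map_div₀,
        P.val_aeval_of_one_lt hPX (gPoly_ne_zero lam p), natDegree_gPoly,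
        P.val_aeval_of_one_lt hPX (A := uNum lam p), natDegree_uNum h_zero, div_self] at hP'
      · exact lt_irrefl _ hP'
      · exact pow_ne_zero _ (zero_lt_one.trans hPX).ne'
      · intro h0
        have := natDegree_uNum h_zero p
        simp [h0] at this

end NormalizedLineCovers
end

noncomputable section

/-! ### The degree of `y² = d(x)` over the line. -/

section ModelDegree

variable {k K L : Type*} [Field k] [Field K] [Algebra k K] [Field L] [Algebra k L] {d : k[X]} {x y : K}

theorem HyperellipticModel.algHom_ext (H : HyperellipticModel d x y) {f g : K →ₐ[k] L}
    (hx : f x = g x) (hy : f y = g y) : f = g := by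
  have hle : IntermediateField.adjoin k {x, y} ≤
      { AlgHom.equalizer f g with
        inv_mem' := fun z (hz : f z = g z) => by
          change f z⁻¹ = g z⁻¹
          rw [map_inv₀, map_inv₀, hz] } := by
    rw [IntermediateField.adjoin_le_iff]
    rintro z (hz | hz)
    · rw [hz]; exact hx
    · rw [Set.mem_singleton_iff.1 hz]; exact hy
  ext z
  exact hle (H.adjoin_eq_top ▸ IntermediateField.mem_top)

theorem HyperellipticField.model
    [Fact (Irreducible (X ^ 2 - C (algebraMap k[X] (RatFunc k) d)))] :
    Transcendental k (xGen d) ∧ HyperellipticModel d (xGen d) (yGen d) := by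
  have hinj : Function.Injective (algebraMap (RatFunc k) (HyperellipticField d)) :=
    RingHom.injective _
  let i : RatFunc k →ₐ[k] HyperellipticField d := IsScalarTower.toAlgHom k (RatFunc k) _
  have haev : ∀ A : k[X], aeval (xGen d) A =
      algebraMap (RatFunc k) _ (algebraMap k[X] (RatFunc k) A) := by
    intro A
    exact (aeval_algHom_apply i RatFunc.X A).trans (congrArg i (RatFunc.aeval_X_eq A))
  refine ⟨?_, ?_, ?_⟩
  · rw [transcendental_iff]
    intro A hA
    rw [haev] at hA
    exact RatFunc.algebraMap_injective k ((hinj (hA.trans (map_zero _).symm)).trans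
      (map_zero _).symm)
  · have h := AdjoinRoot.eval₂_root (X ^ 2 - C (algebraMap k[X] (RatFunc k) d))
    rw [haev]
    rw [eval₂_sub, eval₂_pow, eval₂_X, eval₂_C, sub_eq_zero] at h
    exact h
  · rw [eq_top_iff]
    intro z _
    have hi : ∀ r : RatFunc k, algebraMap (RatFunc k) (HyperellipticField d) r ∈
        IntermediateField.adjoin k {xGen d, yGen d} := by
      intro r
      have hX : ∀ A : k[X], aeval (xGen d) A ∈ IntermediateField.adjoin k {xGen d, yGen d} :=
        fun A => IntermediateField.algebra_adjoin_le_adjoin _ _ (Algebra.adjoin_mono (by simp)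
          (aeval_mem_adjoin_singleton k _))
      rw [← RatFunc.num_div_denom r, map_div₀, ← haev, ← haev]
      exact div_mem (hX _) (hX _)
    induction z using AdjoinRoot.induction_on with
    | ih q =>
      rw [← AdjoinRoot.aeval_eq, aeval_eq_sum_range]
      refine sum_mem fun n _ => ?_
      rw [Algebra.smul_def]
      exact mul_mem (hi _) (pow_mem (IntermediateField.subset_adjoin _ _ (by right; rfl)) _)

theorem HyperellipticModel.homDegree_eq_two (H : HyperellipticModel d x y)
    (hx : Transcendental k x) (hd : Squarefree d) (hd1 : ¬ IsUnit d) :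
    homDegree (ratFuncHom hx) = 2 := by
  have : Fact (Irreducible (X ^ 2 - C (algebraMap k[X] (RatFunc k) d))) :=
    ⟨irreducible_X_sq_sub_C hd hd1⟩
  let e := AlgEquiv.ofBijective (HyperellipticField.lift hx H.eq)
    ⟨RingHom.injective _, HyperellipticField.lift_surjective hx H⟩
  let i : RatFunc k →ₐ[k] HyperellipticField d := IsScalarTower.toAlgHom k (RatFunc k) _
  have hcomp : ratFuncHom hx = e.toAlgHom.comp i := by
    apply ratFunc_algHom_ext
    rw [ratFuncHom_X]
    exact (HyperellipticField.lift_xGen hx H.eq).symm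
  rw [hcomp, homDegree_comp, homDegree_algEquiv, mul_one]
  have h : Module.finrank (RatFunc k) (HyperellipticField d) = 2 := by
    rw [(AdjoinRoot.powerBasis (irreducible_X_sq_sub_C hd hd1).ne_zero).finrank,
      AdjoinRoot.powerBasis_dim, natDegree_X_pow_sub_C]
  convert h using 1
  unfold homDegree
  congr 1
  exact Module.ext' _ _ fun r z => (Algebra.smul_def r z).symm

end ModelDegree

/-! ### The elliptic curve as a hyperelliptic model. -/

section Legendre

variable {k : Type u} [Field k] (lam : k)

/-- The cubic polynomial of `E`. -/
def legendrePoly : k[X] := X * (X - 1) * (X - C lam)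

theorem aeval_legendreX (A : k[X]) : aeval (legendreX lam) A =
    algebraMap (legendreCurve lam).CoordinateRing (LegendreField lam)
      (WeierstrassCurve.Affine.CoordinateRing.mk (legendreCurve lam) (C A)) := by
  induction A using Polynomial.induction_on' with
  | add p q hp hq => simp only [map_add, hp, hq]
  | monomial n c =>
    rw [aeval_monomial, legendreX, ← C_mul_X_pow_eq_monomial]
    simp only [map_mul, map_pow]
    congr 1

/-- The coordinate ring is free over `k[X]` on `1` and `Y`, so `k[X]` injects into it. -/
theorem legendreX_transcendental : Transcendental k (legendreX lam) := by
  rw [transcendental_iff]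
  intro A hA
  rw [aeval_legendreX] at hA
  have h0 := (IsFractionRing.injective _ (LegendreField lam)) (hA.trans (map_zero _).symm)
  have := WeierstrassCurve.Affine.CoordinateRing.smul_basis_eq_zero (W' := legendreCurve lam)
    (p := A) (q := 0) (by
      rw [zero_smul, add_zero, WeierstrassCurve.Affine.CoordinateRing.smul, mul_one]
      exact h0)
  exact this.1

theorem legendre_model : HyperellipticModel (legendrePoly lam) (legendreX lam) (legendreY lam) where
  eq := by
    have h : (legendreCurve lam).polynomial =
      X ^ 2 - C (legendrePoly lam) := by
      rw [WeierstrassCurve.Affine.polynomial, legendreCurve, legendrePoly]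
      simp
      ring
    have h1 : WeierstrassCurve.Affine.CoordinateRing.mk (legendreCurve lam)
        (X ^ 2 - C (legendrePoly lam)) = 0 := by
      rw [← h]
      exact AdjoinRoot.mk_self
    rw [map_sub, sub_eq_zero, map_pow] at h1
    rw [aeval_legendreX, ← h1, legendreY, map_pow]
  adjoin_eq_top := by
    rw [eq_top_iff]
    intro z _
    obtain ⟨r, s, hs, rfl⟩ := IsFractionRing.div_surjective (A := (legendreCurve lam).CoordinateRing) z
    have hmem : ∀ r : (legendreCurve lam).CoordinateRing,
        algebraMap (legendreCurve lam).CoordinateRing (LegendreField lam) r ∈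
          IntermediateField.adjoin k {legendreX lam, legendreY lam} := by
      intro r
      have hX : ∀ A : k[X], aeval (legendreX lam) A ∈
          IntermediateField.adjoin k {legendreX lam, legendreY lam} := fun A =>
        IntermediateField.algebra_adjoin_le_adjoin _ _ (Algebra.adjoin_mono (by simp)
          (aeval_mem_adjoin_singleton k _))
      obtain ⟨p, q, rfl⟩ := WeierstrassCurve.Affine.CoordinateRing.exists_smul_basis_eq r
      rw [WeierstrassCurve.Affine.CoordinateRing.smul, WeierstrassCurve.Affine.CoordinateRing.smul,
        mul_one, map_add, map_mul, ← aeval_legendreX, ← aeval_legendreX]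
      exact add_mem (hX p) (mul_mem (hX q) (IntermediateField.subset_adjoin _ _ (by
        right; rfl)))
    exact div_mem (hmem r) (hmem s)

variable {lam}

theorem natDegree_legendrePoly : (legendrePoly lam).natDegree = 3 := by
  rw [legendrePoly]
  have : X * (X - 1) * (X - C lam) = X ^ 3 - C (1 + lam) * X ^ 2 + C lam * X := by
    rw [C_add, C_1]; ring
  rw [this]
  compute_degree!

theorem squarefree_legendrePoly (h_zero : lam ≠ 0) (h_one : lam ≠ 1) :
    Squarefree (legendrePoly lam) := by
  have hX : Squarefree (X - C 0 : k[X]) := (irreducible_X_sub_C 0).squarefree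
  have h1 : Squarefree (X - C 1 : k[X]) := (irreducible_X_sub_C 1).squarefree
  have hl := (irreducible_X_sub_C lam).squarefree
  have : legendrePoly lam = (X - C 0) * (X - C 1) * (X - C lam) := by
    rw [legendrePoly, C_0, C_1, sub_zero]
  rw [this, squarefree_mul_iff, squarefree_mul_iff]
  exact ⟨(IsCoprime.mul_left (isCoprime_X_sub_C_of_isUnit_sub (sub_ne_zero.2 h_zero.symm).isUnit)
    (isCoprime_X_sub_C_of_isUnit_sub (sub_ne_zero.2 h_one.symm).isUnit)).isRelPrime,
    ⟨(isCoprime_X_sub_C_of_isUnit_sub (sub_ne_zero.2 zero_ne_one).isUnit).isRelPrime, hX, h1⟩, hl⟩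

theorem not_isUnit_legendrePoly : ¬ IsUnit (legendrePoly lam) := by
  intro h
  have := natDegree_eq_zero_of_isUnit h
  rw [natDegree_legendrePoly] at this
  omega

/-- Solutions of the equation of `E` in a field give homomorphisms of the function field. -/
theorem exists_legendreHom (h_zero : lam ≠ 0) (h_one : lam ≠ 1) {K : Type*} [Field K] [Algebra k K]
    {x y : K} (hx : Transcendental k x) (h : y ^ 2 = aeval x (legendrePoly lam)) :
    ∃ f : LegendreField lam →ₐ[k] K, f (legendreX lam) = x ∧ f (legendreY lam) = y := by
  have : Fact (Irreducible (X ^ 2 - C (algebraMap k[X] (RatFunc k) (legendrePoly lam)))) :=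
    ⟨irreducible_X_sq_sub_C (squarefree_legendrePoly h_zero h_one) not_isUnit_legendrePoly⟩
  obtain ⟨ht, H⟩ := HyperellipticField.model (d := legendrePoly lam)
  obtain ⟨e, hex, hey⟩ := (legendre_model lam).exists_algEquiv (legendreX_transcendental lam) H ht
    (squarefree_legendrePoly h_zero h_one) not_isUnit_legendrePoly
  refine ⟨(HyperellipticField.lift hx h).comp e.toAlgHom, ?_, ?_⟩
  · change HyperellipticField.lift hx h (e _) = x
    rw [hex, HyperellipticField.lift_xGen]
  · change HyperellipticField.lift hx h (e _) = y
    rw [hey, HyperellipticField.lift_yGen]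

theorem homDegree_legendreX (h_zero : lam ≠ 0) (h_one : lam ≠ 1) :
    homDegree (ratFuncHom (legendreX_transcendental lam)) = 2 :=
  (legendre_model lam).homDegree_eq_two _ (squarefree_legendrePoly h_zero h_one)
    not_isUnit_legendrePoly

end Legendre
end

noncomputable section

theorem Squarefree.map_ringEquiv {R S : Type*} [CommRing R] [CommRing S] (e : R ≃+* S) {a : R}
    (h : Squarefree a) : Squarefree (e a) := by
  intro q hq
  have h1 : e.symm q * e.symm q ∣ a := by
    have := map_dvd e.symm hq
    rwa [map_mul, e.symm_apply_apply] at this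
  have h2 := (h _ h1).map e
  rwa [e.apply_symm_apply] at h2

/-! ### Moving a branch point to infinity: from sextics to quintics. -/

section Quintic

variable {k : Type*} [Field k] {d : k[X]} {p : k}

/-- The right hand side of the equation of `y² = d(x)`, with `d` of degree five or six, in the
coordinates `1 / (x - p)`, `y / (x - p)³`. -/
def quinticAt (d : k[X]) (p : k) : k[X] := reflect 6 (taylor p d)

/-- Reflection puts `d(p) = 0` in degree six and `d'(p)`, nonzero at a simple root, in degree five.
-/
theorem natDegree_quinticAt [IsAlgClosed k] (hd : Squarefree d) (hdeg : d.natDegree ≤ 6)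
    (hp : d.eval p = 0) : (quinticAt d p).natDegree = 5 := by
  have hle : (quinticAt d p).natDegree ≤ 6 := by
    refine natDegree_reflect_le.trans ?_
    rw [natDegree_taylor]
    omega
  have h6 : (quinticAt d p).coeff 6 = 0 := by
    rw [quinticAt, coeff_reflect, revAt_le le_rfl, Nat.sub_self, taylor_coeff_zero, hp]
  have h5 : (quinticAt d p).coeff 5 ≠ 0 := by
    rw [quinticAt, coeff_reflect, revAt_le (by omega), taylor_coeff_one]
    exact (HyperellipticModel.smooth_of_squarefree hd (b := 0) (a := p)
      (by rw [hp, zero_pow two_ne_zero])).resolve_left (by simp)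
  refine le_antisymm ?_ (le_natDegree_of_ne_zero h5)
  by_contra! h
  have h' : (quinticAt d p).natDegree = 6 := by omega
  have h0 : (quinticAt d p).leadingCoeff = 0 := by rw [leadingCoeff, h', h6]
  rw [leadingCoeff_eq_zero] at h0
  simp [h0] at h5

theorem Polynomial.squarefree_of_forall_not_dvd [IsAlgClosed k] (hd : d ≠ 0)
    (h : ∀ a, ¬ (X - C a) * (X - C a) ∣ d) : Squarefree d := by
  intro q hq
  by_contra hu
  have hq0 : q ≠ 0 := by
    rintro rfl
    exact hd (by simpa using hq)
  obtain ⟨a, ha⟩ := IsAlgClosed.exists_root q (fun h0 => hu (isUnit_iff_degree_eq_zero.2 h0))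
  exact h a ((mul_dvd_mul (dvd_iff_isRoot.2 ha) (dvd_iff_isRoot.2 ha)).trans hq)

/-- A factor `(X - a)²` reflects to the factor `(1 - a X)²` of the translate of `d`. By
squarefreeness `a = 0`, and then the translate would have degree at most four. -/
theorem squarefree_quinticAt [IsAlgClosed k] (hd : Squarefree d) (hdeg : d.natDegree ≤ 6)
    (hdeg' : 5 ≤ d.natDegree) (hp : d.eval p = 0) : Squarefree (quinticAt d p) := by
  have h5 := natDegree_quinticAt hd hdeg hp
  have hne : quinticAt d p ≠ 0 := by rintro h; simp [h] at h5
  refine squarefree_of_forall_not_dvd hne ?_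
  rintro a ⟨e, he⟩
  have hX : (X - C a) * (X - C a) ≠ 0 := mul_ne_zero (X_sub_C_ne_zero a) (X_sub_C_ne_zero a)
  have he0 : e ≠ 0 := by rintro rfl; simp [he] at hne
  have hX2 : ((X - C a) * (X - C a)).natDegree = 2 := by
    rw [natDegree_mul (X_sub_C_ne_zero a) (X_sub_C_ne_zero a), natDegree_X_sub_C]
  have hedeg : e.natDegree ≤ 4 := by
    have := natDegree_mul hX he0
    rw [← he, h5, hX2] at this
    omega
  have ht : taylor p d = reflect 6 (quinticAt d p) := by rw [quinticAt, reflect_reflect]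
  have hX1 : reflect 1 (X - C a) = 1 - C a * X := by
    ext n
    rw [coeff_reflect]
    rcases n with _ | _ | n
    · rw [revAt_le (by omega)]; simp
    · rw [revAt_le (by omega)]; simp [coeff_one]
    · rw [revAt_eq_self_of_lt (by omega)]; simp [coeff_X, coeff_one]
  have hXX : reflect 2 ((X - C a) * (X - C a)) = (1 - C a * X) * (1 - C a * X) := by
    have := reflect_mul (X - C a) (X - C a) (F := 1) (G := 1) (by rw [natDegree_X_sub_C])
      (by rw [natDegree_X_sub_C])
    rw [hX1] at this
    exact this
  have hr := reflect_mul ((X - C a) * (X - C a)) e (F := 2) (G := 4) (by omega) hedeg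
  rw [← he, hXX] at hr
  have hsf : Squarefree (taylor p d) := by
    exact hd.map_ringEquiv (taylorEquiv p).toRingEquiv
  have hu := hsf (1 - C a * X) ⟨_, ht.trans hr⟩
  have ha : a = 0 := by
    by_contra ha
    have hdeg1 : (1 - C a * X).natDegree = 1 := by
      compute_degree!
    rw [natDegree_eq_zero_of_isUnit hu] at hdeg1
    omega
  -- Coefficients `0` and `1` of the reflected polynomial are coefficients `6` and `5` of the
  -- translate.
  have hlow : ∀ i < 2, (quinticAt d p).coeff i = 0 := by
    intro i hi
    rw [he, ha, C_0, sub_zero, ← pow_two, coeff_X_pow_mul', if_neg (by omega)]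
  have hbig : ∀ i, 5 ≤ i → (taylor p d).coeff i = 0 := by
    intro i hi
    rw [ht, coeff_reflect]
    rcases Nat.lt_or_ge 6 i with h | h
    · rw [revAt_eq_self_of_lt h, coeff_eq_zero_of_natDegree_lt (by omega)]
    · rw [revAt_le h, hlow _ (by omega)]
  have : (taylor p d).leadingCoeff = 0 := hbig _ (by rw [natDegree_taylor]; exact hdeg')
  rw [leadingCoeff_eq_zero] at this
  rw [← natDegree_taylor d p, this] at hdeg'
  simp at hdeg'

theorem eval_quinticAt (hdeg : d.natDegree ≤ 6) {a : k} (ha : a ≠ 0) :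
    (quinticAt d p).eval a = 0 ↔ d.eval (p + a⁻¹) = 0 := by
  let := invertibleOfNonzero (inv_ne_zero ha)
  have := eval₂_reflect_eq_zero_iff (RingHom.id k) a⁻¹ 6 (taylor p d)
    (by rwa [natDegree_taylor])
  rw [invOf_eq_inv, inv_inv] at this
  rw [quinticAt, add_comm, ← taylor_eval]
  exact this

theorem eval_quinticAt_zero : (quinticAt d p).eval 0 = d.coeff 6 ∨ 6 < d.natDegree := by
  by_contra! h
  apply h.1
  rw [← coeff_zero_eq_eval_zero, quinticAt, coeff_reflect, revAt_le (by omega), Nat.sub_zero]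
  rcases h.2.lt_or_eq with h' | h'
  · rw [coeff_eq_zero_of_natDegree_lt (by rwa [natDegree_taylor]), coeff_eq_zero_of_natDegree_lt h']
  · rw [← h']
    conv_lhs => rw [← natDegree_taylor d p]
    exact leadingCoeff_taylor p d

end Quintic

/-! ### Genus and Weierstrass points for equations of degree five or six. -/

namespace HyperellipticModel

variable {k K : Type*} [Field k] [Field K] [Algebra k K] {d : k[X]} {x y : K}

theorem translate (H : HyperellipticModel d x y) (p : k) :
    HyperellipticModel (taylor p d) (x - algebraMap k K p) y where
  eq := by
    rw [H.eq, taylor_apply, aeval_comp]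
    simp
  adjoin_eq_top := by
    rw [eq_top_iff, ← H.adjoin_eq_top, IntermediateField.adjoin_le_iff]
    have hx : x - algebraMap k K p ∈ IntermediateField.adjoin k {x - algebraMap k K p, y} :=
      IntermediateField.subset_adjoin _ _ (by simp)
    rintro w (rfl | rfl)
    · simpa using add_mem hx (algebraMap_mem _ p)
    · exact IntermediateField.subset_adjoin _ _ (by simp)

theorem quintic (H : HyperellipticModel d x y) (hx : Transcendental k x)
    (hdeg : d.natDegree ≤ 6) (p : k) :
    HyperellipticModel (quinticAt d p) (x - algebraMap k K p)⁻¹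
      (y * (x - algebraMap k K p)⁻¹ ^ 3) :=
  (H.translate p).atInfinity (sub_algebraMap_ne_zero hx p) (n := 3) (by rwa [natDegree_taylor])

theorem curveGenus_eq_two [IsAlgClosed k] (H : HyperellipticModel d x y)
    (hx : Transcendental k x) (h2 : (2 : k) ≠ 0) (hd : Squarefree d) (hdeg : d.natDegree ≤ 6)
    (hdeg' : 5 ≤ d.natDegree) {p : k} (hp : d.eval p = 0) : curveGenus k K = 2 :=
  (H.quintic hx hdeg p).curveGenus_eq (H.isCurveField hx) h2
    (squarefree_quinticAt hd hdeg hdeg' hp) (g := 2) (natDegree_quinticAt hd hdeg hp)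

theorem val_inv_lt_iff {P : CurvePoint k K} {z : K} (hz : z ≠ 0) : P.val z⁻¹ < 1 ↔ 1 < P.val z := by
  rw [map_inv₀, inv_lt_one₀ (zero_lt_iff.2 (by simpa using hz))]

theorem one_lt_val_sub_iff {P : CurvePoint k K} {z : K} (p : k) :
    1 < P.val (z - algebraMap k K p) ↔ 1 < P.val z := by
  rw [← P.not_mem_iff, ← P.not_mem_iff, not_iff_not]
  refine ⟨fun h => ?_, fun h => sub_mem h (P.algebraMap_mem p)⟩
  simpa using add_mem h (P.algebraMap_mem p)

/-- The Weierstrass points of a curve of genus two given by an equation of degree five or six. -/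
theorem isWeierstrass_sextic_iff [IsAlgClosed k] (H : HyperellipticModel d x y)
    (hx : Transcendental k x) (h2 : (2 : k) ≠ 0) (hd : Squarefree d) (hdeg : d.natDegree ≤ 6)
    (hdeg' : 5 ≤ d.natDegree) {p : k} (hp : d.eval p = 0) (P : CurvePoint k K) :
    P.IsWeierstrass ↔ (∃ a, d.eval a = 0 ∧ P.val (x - algebraMap k K a) < 1) ∨
      (d.natDegree = 5 ∧ 1 < P.val x) := by
  have hne := sub_algebraMap_ne_zero hx p
  constructor
  swap
  · rintro (⟨a, hda, ha⟩ | ⟨h5, hP⟩)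
    · exact H.isWeierstrass_of_root hx h2 hd P hda ha
    · exact H.isWeierstrass_infinity hx (g := 2) h5 P hP
  intro hW
  -- For the coordinate `1 / (x - p)` of the quintic model, infinity is `x = p`, a nonzero root `a`
  -- is `x = p + 1 / a`, and a root `0` is `x = ∞`, which occurs only if `d` has no term of degree
  -- six.
  rcases ((H.quintic hx hdeg p).isWeierstrass_iff (H.isCurveField hx) h2
    (squarefree_quinticAt hd hdeg hdeg' hp) (natDegree_quinticAt hd hdeg hp) P).1 hW with
    hP | ⟨a, hda, ha⟩
  · rw [← val_inv_lt_iff (inv_ne_zero hne), inv_inv] at hP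
    exact Or.inl ⟨p, hp, hP⟩
  · by_cases ha0 : a = 0
    · subst ha0
      rw [map_zero, sub_zero, val_inv_lt_iff hne, one_lt_val_sub_iff] at ha
      refine Or.inr ⟨?_, ha⟩
      have h6 : d.coeff 6 = 0 := by
        rcases eval_quinticAt_zero (d := d) (p := p) with h | h
        · rw [← h, hda]
        · omega
      by_contra h5
      have h6' : d.natDegree = 6 := by omega
      rw [← h6', coeff_natDegree, leadingCoeff_eq_zero] at h6
      simp [h6] at h6'
    · refine Or.inl ⟨p + a⁻¹, (eval_quinticAt hdeg ha0).1 hda, ?_⟩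
      have hxa : P.val (x - algebraMap k K p)⁻¹ = 1 := by
        have h := P.val_eq_one_iff_of_sub_lt ha
        exact h.2 ha0
      have haK : algebraMap k K a ≠ 0 := by simpa using ha0
      have e : x - algebraMap k K (p + a⁻¹) = -((x - algebraMap k K p)⁻¹ - algebraMap k K a) *
          ((x - algebraMap k K p)⁻¹)⁻¹ * (algebraMap k K a)⁻¹ := by
        rw [map_add, map_inv₀]
        field_simp
        ring
      rw [e, map_mul, map_mul, map_inv₀, hxa, inv_one, mul_one, map_inv₀, P.val_algebraMap ha0,
        inv_one, mul_one, Valuation.map_neg]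
      exact ha

end HyperellipticModel
end

noncomputable section

/-! ### Pencils of polynomials and the normalization condition. -/

theorem IsCoprime.sub_C_mul_left {k : Type*} [Field k] {r s : k[X]} (h : IsCoprime r s) (a : k) :
    IsCoprime (r - C a * s) s := by
  obtain ⟨u, v, huv⟩ := h
  exact ⟨u, v + u * C a, by linear_combination huv⟩

/-- The members of a pencil without base points have no common roots. -/
theorem IsCoprime.sub_C_mul {k : Type*} [Field k] {r s : k[X]} (h : IsCoprime r s) {a b : k}
    (hab : a ≠ b) : IsCoprime (r - C a * s) (r - C b * s) := by
  obtain ⟨u, v, huv⟩ := h.sub_C_mul_left a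
  have hc : C (a - b) * C (a - b)⁻¹ = (1 : k[X]) := by
    rw [← C_mul, mul_inv_cancel₀ (sub_ne_zero.2 hab), C_1]
  rw [C_sub] at hc
  exact ⟨u - v * C (a - b)⁻¹, v * C (a - b)⁻¹, by linear_combination huv + v * s * hc⟩

section Normalized

variable {k : Type u} [Field k] {lam : k} {K : Type*} [Field K] [Algebra k K]

theorem eval_legendrePoly {e : k} :
    (legendrePoly lam).eval e = 0 ↔ e = 0 ∨ e = 1 ∨ e = lam := by
  rw [legendrePoly]
  simp only [eval_mul, eval_X, eval_sub, eval_one, eval_C, mul_eq_zero, sub_eq_zero]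
  tauto

theorem legendreCurve_equation_iff {a b : k} :
    (legendreCurve lam).Equation a b ↔ b ^ 2 = (legendrePoly lam).eval a := by
  rw [WeierstrassCurve.Affine.equation_iff, legendrePoly, legendreCurve]
  simp only [eval_mul, eval_X, eval_sub, eval_one, eval_C]
  constructor <;> intro h <;> linear_combination h

theorem legendreCurve_two_nsmul_some [DecidableEq k] (h2 : (2 : k) ≠ 0) {a b : k}
    (h : (legendreCurve lam).Nonsingular a b) :
    2 • (WeierstrassCurve.Affine.Point.some a b h) = 0 ↔ b = 0 := by
  rw [two_nsmul, add_eq_zero_iff_eq_neg, WeierstrassCurve.Affine.Point.neg_some,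
    WeierstrassCurve.Affine.Point.some.injEq]
  simp only [true_and, WeierstrassCurve.Affine.negY, legendreCurve, zero_mul, sub_zero]
  constructor
  · intro h
    have : (2 : k) * b = 0 := by linear_combination h
    exact (mul_eq_zero.1 this).resolve_left h2
  · rintro rfl; simp

theorem legendreCurve_nonsingular (h_zero : lam ≠ 0) (h_one : lam ≠ 1) {e : k}
    (he : (legendrePoly lam).eval e = 0) : (legendreCurve lam).Nonsingular e 0 := by
  rw [WeierstrassCurve.Affine.nonsingular_iff, legendreCurve_equation_iff]
  refine ⟨by rw [he, zero_pow two_ne_zero], Or.inl ?_⟩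
  simp only [legendreCurve]
  rcases eval_legendrePoly.1 he with rfl | rfl | rfl
  · simpa using h_zero.symm
  · intro h
    exact h_one (by linear_combination h)
  · intro h
    have : e * (e - 1) = 0 := by linear_combination -h
    exact (mul_ne_zero h_zero (sub_ne_zero.2 h_one)) this

variable (f : CurveCover k (LegendreField lam) K)

theorem CurveCover.val_legendreY_lt {f : CurveCover k (LegendreField lam) K} {P : CurvePoint k K}
    {e : k} (he : (legendrePoly lam).eval e = 0)
    (hP : P.val (f.pullback (legendreX lam) - algebraMap k K e) < 1) :
    (f.map P).val (legendreX lam - algebraMap k _ e) < 1 ∧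
      (f.map P).val (legendreY lam - algebraMap k _ 0) < 1 := by
  have h : (f.map P).val (legendreX lam - algebraMap k _ e) < 1 := by
    rw [CurveCover.val_map_lt_one, map_sub, AlgHom.commutes]
    exact hP
  exact ⟨h, (legendre_model lam).val_y_lt_of_root _ he h⟩

/-- The divisor `2 [0] + E[2]` has coefficient three at `0` and one at each point `(e, 0)`. The
hypothesis `hcases` rules out Weierstrass points over any other point. -/
theorem CurveCover.isNormalized_of (h2 : (2 : k) ≠ 0)
    (hpole : {P : CurvePoint k K | P.IsWeierstrass ∧
      1 < P.val (f.pullback (legendreX lam))}.encard = 3)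
    (hroot : ∀ e, (legendrePoly lam).eval e = 0 → {P : CurvePoint k K | P.IsWeierstrass ∧
      P.val (f.pullback (legendreX lam) - algebraMap k K e) < 1}.encard = 1)
    (hcases : ∀ P : CurvePoint k K, P.IsWeierstrass → 1 < P.val (f.pullback (legendreX lam)) ∨
      ∃ e, (legendrePoly lam).eval e = 0 ∧
        P.val (f.pullback (legendreX lam) - algebraMap k K e) < 1) : f.IsNormalized lam := by
  classical
  intro T
  rcases T with _ | ⟨a, b, hab⟩
  · have h0 : (WeierstrassCurve.Affine.Point.zero : (legendreCurve lam).Point) = 0 := rfl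
    rw [h0, if_pos rfl, smul_zero, if_pos rfl]
    refine Eq.trans ?_ (hpole.trans (by norm_num))
    congr 1
    ext P
    refine and_congr_right fun _ => ?_
    change legendreX lam ∉ (f.map P).ring ↔ _
    rw [CurvePoint.not_mem_iff, CurveCover.one_lt_val_map]
  · rw [if_neg (by rintro ⟨⟩), zero_add]
    split_ifs with hb <;> rw [legendreCurve_two_nsmul_some h2] at hb
    · subst hb
      have he : (legendrePoly lam).eval a = 0 := by
        rw [← legendreCurve_equation_iff.1 hab.1, zero_pow two_ne_zero]
      rw [← hroot a he]
      congr 1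
      ext P
      refine and_congr_right fun _ => ⟨fun h => ?_, fun h => ?_⟩
      · have := (f.map P).vanishes_iff.1 h.1
        rwa [CurveCover.val_map_lt_one, map_sub, AlgHom.commutes] at this
      · obtain ⟨h1, h2⟩ := CurveCover.val_legendreY_lt he h
        exact ⟨(f.map P).vanishes_iff.2 h1, (f.map P).vanishes_iff.2 h2⟩
    · rw [Set.encard_eq_zero, Set.eq_empty_iff_forall_notMem]
      rintro P ⟨hW, h1, h2⟩
      rw [CurvePoint.vanishes_iff] at h1 h2
      rcases hcases P hW with h | ⟨e, he, h⟩
      · rw [← CurveCover.one_lt_val_map] at h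
        exact absurd ((f.map P).val_le_of_sub_lt h1) (not_le.2 h)
      · exact hb ((f.map P).eq_of_sub_lt h2 (CurveCover.val_legendreY_lt he h).2)

variable {f}

theorem CurveCover.IsNormalized.encard_pole (hf : f.IsNormalized lam) :
    {P : CurvePoint k K | P.IsWeierstrass ∧
      1 < P.val (f.pullback (legendreX lam))}.encard = 3 := by
  classical
  have h := hf 0
  rw [if_pos rfl, smul_zero, if_pos rfl] at h
  refine Eq.trans ?_ (h.trans (by norm_num))
  congr 1
  ext P
  refine and_congr_right fun _ => ?_
  change _ ↔ legendreX lam ∉ (f.map P).ring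
  rw [CurvePoint.not_mem_iff, CurveCover.one_lt_val_map]

theorem CurveCover.IsNormalized.encard_root (hf : f.IsNormalized lam) (h2 : (2 : k) ≠ 0)
    (h_zero : lam ≠ 0) (h_one : lam ≠ 1) {e : k} (he : (legendrePoly lam).eval e = 0) :
    {P : CurvePoint k K | P.IsWeierstrass ∧
      P.val (f.pullback (legendreX lam) - algebraMap k K e) < 1}.encard = 1 := by
  classical
  have h := hf (.some e 0 (legendreCurve_nonsingular h_zero h_one he))
  rw [if_neg (by rintro ⟨⟩), zero_add,
    if_pos ((legendreCurve_two_nsmul_some h2 _).2 rfl)] at h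
  rw [← h]
  congr 1
  ext P
  refine and_congr_right fun _ => ⟨fun h => ?_, fun h => ?_⟩
  · obtain ⟨h1, h2⟩ := CurveCover.val_legendreY_lt he h
    exact ⟨(f.map P).vanishes_iff.2 h1, (f.map P).vanishes_iff.2 h2⟩
  · have := (f.map P).vanishes_iff.1 h.1
    rwa [CurveCover.val_map_lt_one, map_sub, AlgHom.commutes] at this

end Normalized

/-! ### The sextic polynomial. -/

section Sextic

variable {k : Type u} [Field k] {lam p : k}

theorem sexticPoly_eval {a : k} : (sexticPoly lam p).eval a = 0 ↔
    a = p ∨ a = p - 2 ∨ (2 * p - 3) * a - p + 2 = 0 ∨ (gPoly lam p).eval a = 0 := by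
  rw [sexticPoly]
  simp only [eval_mul, eval_sub, eval_add, eval_X, eval_C, eval_ofNat, mul_eq_zero, or_assoc]
  rw [sub_eq_zero, show a - p + 2 = a - (p - 2) by ring, sub_eq_zero]

/-- The four factors divide the members over `0`, `1`, `lam`, `∞` of a pencil without base points,
so they are pairwise coprime. The third one is nonzero, since otherwise its coprimality with `X - p`
would make `X - p` a unit. -/
theorem GoodParameter.squarefree_sexticPoly (h_zero : lam ≠ 0) (h_one : lam ≠ 1)
    (hp : GoodParameter lam p) : Squarefree (sexticPoly lam p) ∧
      (C (2 * p - 3) * X - C p + 2 : k[X]) ≠ 0 := by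
  have hu := hp.isCoprime
  have hug : IsCoprime (uNum lam p - gPoly lam p) (gPoly lam p) := by
    simpa using hu.sub_C_mul_left 1
  have hulg := hu.sub_C_mul_left lam
  have huu : IsCoprime (uNum lam p) (uNum lam p - gPoly lam p) := by
    simpa using hu.sub_C_mul zero_ne_one
  have hul : IsCoprime (uNum lam p) (uNum lam p - C lam * gPoly lam p) := by
    simpa using hu.sub_C_mul h_zero.symm
  have hgl : IsCoprime (uNum lam p - gPoly lam p) (uNum lam p - C lam * gPoly lam p) := by
    simpa using hu.sub_C_mul h_one.symm
  have d0 : X - C p ∣ uNum lam p := ⟨C lam * X ^ 2, by rw [uNum]; ring⟩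
  have d1 : X - C p + 2 ∣ uNum lam p - gPoly lam p := by
    rw [uNum_sub_gPoly]; exact Dvd.intro_left _ rfl
  have d2 : C (2 * p - 3) * X - C p + 2 ∣ uNum lam p - C lam * gPoly lam p := by
    rw [uNum_sub_lam_gPoly]; exact Dvd.intro_left _ rfl
  have c01 := (huu.of_isCoprime_of_dvd_left d0).of_isCoprime_of_dvd_right d1
  have c02 := (hul.of_isCoprime_of_dvd_left d0).of_isCoprime_of_dvd_right d2
  have c12 := (hgl.of_isCoprime_of_dvd_left d1).of_isCoprime_of_dvd_right d2
  have c0 := hu.of_isCoprime_of_dvd_left d0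
  have c1 := hug.of_isCoprime_of_dvd_left d1
  have c2 := hulg.of_isCoprime_of_dvd_left d2
  have hne : (C (2 * p - 3) * X - C p + 2 : k[X]) ≠ 0 := by
    intro h
    rw [h, isCoprime_zero_right] at c02
    exact not_isUnit_X_sub_C p c02
  have s0 := (irreducible_X_sub_C p).squarefree
  have s1 : Squarefree (X - C p + 2) := by
    have : (X - C p + 2 : k[X]) = X - C (p - 2) := by
      rw [C_sub, map_ofNat]; ring
    rw [this]
    exact (irreducible_X_sub_C _).squarefree
  have s2 : Squarefree (C (2 * p - 3) * X - C p + 2) := by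
    rintro q ⟨r, hr⟩
    have hq0 : q ≠ 0 := by rintro rfl; exact hne (by rw [hr]; ring)
    have hr0 : r ≠ 0 := by rintro rfl; exact hne (by rw [hr]; ring)
    have hdeg : (C (2 * p - 3) * X - C p + 2 : k[X]).natDegree ≤ 1 := by compute_degree
    rw [hr, natDegree_mul (mul_ne_zero hq0 hq0) hr0, natDegree_mul hq0 hq0] at hdeg
    rw [isUnit_iff_degree_eq_zero, degree_eq_natDegree hq0]
    simp only [Nat.cast_eq_zero]
    omega
  refine ⟨?_, hne⟩
  rw [sexticPoly, squarefree_mul_iff, squarefree_mul_iff, squarefree_mul_iff]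
  exact ⟨((c0.mul_left c1).mul_left c2).isRelPrime,
    ⟨(c02.mul_left c12).isRelPrime, ⟨c01.isRelPrime, s0, s1⟩, s2⟩, hp.squarefree⟩

theorem natDegree_sexticPoly (hne : (C (2 * p - 3) * X - C p + 2 : k[X]) ≠ 0) :
    (sexticPoly lam p).natDegree = 5 + (C (2 * p - 3) * X - C p + 2 : k[X]).natDegree := by
  have h1 : (X - C p + 2 : k[X]) = X - C (p - 2) := by
    rw [C_sub, map_ofNat]; ring
  rw [sexticPoly, h1, natDegree_mul (mul_ne_zero (mul_ne_zero (X_sub_C_ne_zero _)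
    (X_sub_C_ne_zero _)) hne) (gPoly_ne_zero _ _), natDegree_mul (mul_ne_zero (X_sub_C_ne_zero _)
    (X_sub_C_ne_zero _)) hne, natDegree_mul (X_sub_C_ne_zero _) (X_sub_C_ne_zero _),
    natDegree_X_sub_C, natDegree_X_sub_C, natDegree_gPoly]
  omega

theorem natDegree_linear_le :
    (C (2 * p - 3) * X - C p + 2 : k[X]).natDegree ≤ 1 := by compute_degree

theorem natDegree_linear_eq_zero_iff :
    (C (2 * p - 3) * X - C p + 2 : k[X]).natDegree = 0 ↔ 2 * p - 3 = 0 := by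
  constructor
  · intro h
    have := coeff_eq_zero_of_natDegree_lt (p := (C (2 * p - 3) * X - C p + 2 : k[X])) (n := 1)
      (by omega)
    have h2 : (2 : k[X]).coeff 1 = 0 := coeff_ofNat_succ 2 0
    simpa [coeff_C, h2] using this
  · intro h
    rw [h, C_0, zero_mul, zero_sub, ← map_ofNat (C : k →+* k[X]) 2, ← C_neg, ← C_add, natDegree_C]

end Sextic
end

noncomputable section

theorem CurvePoint.val_div_sub_lt {k K : Type*} [Field k] [Field K] [Algebra k K]
    (P : CurvePoint k K) {x : K} {a : k} (ha : P.val (x - algebraMap k K a) < 1) {A B : k[X]}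
    (hB : B.eval a ≠ 0) :
    P.val (aeval x A / aeval x B - algebraMap k K (A.eval a / B.eval a)) < 1 := by
  have hBx : P.val (aeval x B) = 1 := by
    have := P.val_aeval_sub_lt ha B
    exact (P.val_eq_one_iff_of_sub_lt this).2 hB
  have hBx0 : aeval x B ≠ 0 := by rintro h; simp [h] at hBx
  have hBK : algebraMap k K (B.eval a) ≠ 0 := by simpa using hB
  have h := P.val_aeval_sub_lt ha (A * C (B.eval a) - C (A.eval a) * B)
  simp only [eval_sub, eval_mul, eval_C, sub_self, map_zero, sub_zero, map_sub, map_mul,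
    aeval_C] at h
  have e : aeval x A / aeval x B - algebraMap k K (A.eval a / B.eval a) =
      (aeval x A * algebraMap k K (B.eval a) - algebraMap k K (A.eval a) * aeval x B) /
        (aeval x B * algebraMap k K (B.eval a)) := by
    rw [map_div₀]
    field_simp
  rw [e, map_div₀, map_mul P.val (aeval x B), hBx, P.val_algebraMap hB, mul_one, div_one]
  exact h

/-! ### The explicit covers are normalized covers of degree three. -/

section Explicit

variable {k : Type u} [Field k] {lam p : k} {K : Type*} [Field K] [Algebra k K] {x y : K}

theorem GoodParameter.aeval_transcendental (h_zero : lam ≠ 0) (hp : GoodParameter lam p)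
    (hx : Transcendental k x) :
    Transcendental k (aeval x (uNum lam p) / aeval x (gPoly lam p)) := by
  have h : aeval x (uNum lam p) / aeval x (gPoly lam p) = ratFuncHom hx (uFun lam p) := by
    rw [uFun_eq, map_div₀, ratFuncHom_algebraMap, ratFuncHom_algebraMap]
  rw [h]
  exact fun h => hp.uFun_transcendental h_zero
    ((isAlgebraic_algHom_iff (ratFuncHom hx) (ratFuncHom hx).injective).1 h)

theorem aeval_gPoly_ne_zero (hx : Transcendental k x) : aeval x (gPoly lam p) ≠ 0 := fun h =>
  gPoly_ne_zero lam p (transcendental_iff.1 hx _ h)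

/-- The composite to the line factors through `E` and through the `x`-line, so `2 · deg f = 3 · 2`.
-/
theorem homDegree_of_explicit (h_zero : lam ≠ 0) (h_one : lam ≠ 1) (hp : GoodParameter lam p)
    (H : HyperellipticModel (sexticPoly lam p) x y) (hx : Transcendental k x)
    {f : LegendreField lam →ₐ[k] K}
    (hf : f (legendreX lam) = aeval x (uNum lam p) / aeval x (gPoly lam p)) : homDegree f = 3 := by
  obtain ⟨hsq, hne⟩ := hp.squarefree_sexticPoly h_zero h_one
  have hdeg := natDegree_sexticPoly (lam := lam) hne
  have hcomp : f.comp (ratFuncHom (legendreX_transcendental lam)) =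
      (ratFuncHom hx).comp (ratFuncHom (hp.uFun_transcendental h_zero)) := by
    apply ratFunc_algHom_ext
    rw [AlgHom.comp_apply, AlgHom.comp_apply, ratFuncHom_X, ratFuncHom_X, hf, uFun_eq, map_div₀,
      ratFuncHom_algebraMap, ratFuncHom_algebraMap]
  have h := homDegree_comp (ratFuncHom (legendreX_transcendental lam)) f
  rw [hcomp, homDegree_comp, hp.homDegree_eq h_zero, homDegree_legendreX h_zero h_one,
    H.homDegree_eq_two hx hsq (fun hu => by rw [natDegree_eq_zero_of_isUnit hu] at hdeg; omega)] at h
  omega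

/-- The three factors `u`, `u - 1`, `u - lam` have numerators with double parts `x²`, `(x - 1)²` and
`1`. Their residual linear factors, times `g`, make up the sextic, which leaves the denominator
`g⁴`. -/
theorem explicit_equation (hx : Transcendental k x) (h : y ^ 2 = aeval x (sexticPoly lam p)) (ε : ℤˣ) :
    ((ε : ℤ) * (algebraMap k K (lam * (lam - 1)) * y * x * (x - 1) / aeval x (gPoly lam p) ^ 2)) ^ 2 =
      aeval (aeval x (uNum lam p) / aeval x (gPoly lam p)) (legendrePoly lam) := by
  have hg := aeval_gPoly_ne_zero (lam := lam) (p := p) hx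
  have h1 := congrArg (aeval x) (uNum_sub_gPoly lam p)
  have h2 := congrArg (aeval x) (uNum_sub_lam_gPoly lam p)
  have hε : ((ε : ℤ) : K) ^ 2 = 1 := by
    rcases Int.units_eq_one_or ε with rfl | rfl <;> simp
  rw [mul_pow, hε, one_mul, legendrePoly]
  have h0 : aeval x (uNum lam p) = algebraMap k K lam * (x - algebraMap k K p) * x ^ 2 := by
    simp [uNum]
  simp only [map_mul, map_sub, map_add, map_pow, map_one, aeval_X, aeval_C, sexticPoly,
    map_ofNat, h0] at h1 h2 h ⊢
  generalize aeval x (gPoly lam p) = g at *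
  generalize algebraMap k K lam = l at *
  generalize algebraMap k K p = q at *
  have e1 : l * (x - q) * x ^ 2 / g - 1 = (l - 1) * (x - 1) ^ 2 * (x - q + 2) / g := by
    rw [← h1]; field_simp
  have e2 : l * (x - q) * x ^ 2 / g - l = l * (l - 1) * ((2 * q - 3) * x - q + 2) / g := by
    rw [← h2]; field_simp
  rw [e1, e2, div_pow, mul_pow, mul_pow, mul_pow, h]
  field_simp

theorem one_lt_val_of_explicit (h_zero : lam ≠ 0) (hp : GoodParameter lam p)
    (hx : Transcendental k x) {P : CurvePoint k K} {a : k} (hga : (gPoly lam p).eval a = 0)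
    (ha : P.val (x - algebraMap k K a) < 1) :
    1 < P.val (aeval x (uNum lam p) / aeval x (gPoly lam p)) := by
  have hua : (uNum lam p).eval a ≠ 0 := fun h => hp.eval_ne_zero h hga
  have h1 := P.val_div_sub_lt ha (A := gPoly lam p) hua
  rw [hga, zero_div, map_zero, sub_zero, ← inv_div] at h1
  rwa [HyperellipticModel.val_inv_lt_iff] at h1
  intro h0
  have := hp.aeval_transcendental h_zero hx
  rw [h0] at this
  exact this isAlgebraic_zero

theorem val_sub_lt_of_explicit (hp : GoodParameter lam p) {P : CurvePoint k K} {a e : k}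
    (hua : (uNum lam p - C e * gPoly lam p).eval a = 0) (ha : P.val (x - algebraMap k K a) < 1) :
    P.val (aeval x (uNum lam p) / aeval x (gPoly lam p) - algebraMap k K e) < 1 := by
  rw [eval_sub, eval_mul, eval_C, sub_eq_zero] at hua
  have hga : (gPoly lam p).eval a ≠ 0 := fun h => by
    rw [h, mul_zero] at hua
    exact hp.eval_ne_zero hua h
  have h1 := P.val_div_sub_lt ha (A := uNum lam p) hga
  rwa [hua, mul_div_cancel_right₀ _ hga] at h1

/-- For `2 p = 3` the difference `u - lam` is a constant divided by `g`, so the Weierstrass point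
over `lam` is the pole of `x`. -/
theorem val_sub_lt_of_explicit_infinity (hx : Transcendental k x) {P : CurvePoint k K}
    (h3 : 2 * p - 3 = 0) (hP : 1 < P.val x) :
    P.val (aeval x (uNum lam p) / aeval x (gPoly lam p) - algebraMap k K lam) < 1 := by
  have hg := aeval_gPoly_ne_zero (lam := lam) (p := p) hx
  have e : aeval x (uNum lam p) / aeval x (gPoly lam p) - algebraMap k K lam =
      algebraMap k K (lam * (lam - 1) * (2 - p)) * (aeval x (gPoly lam p))⁻¹ := by
    have h := congrArg (aeval x) (uNum_sub_lam_gPoly lam p)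
    rw [h3] at h
    simp only [map_mul, map_sub, map_add, map_zero, zero_mul, map_one, aeval_C,
      map_ofNat] at h ⊢
    field_simp
    linear_combination h
  rw [e, map_mul, map_inv₀, P.val_aeval_of_one_lt hP (gPoly_ne_zero _ _), natDegree_gPoly]
  refine (mul_le_mul_left (P.val_algebraMap_le _) _).trans_lt ?_
  rw [one_mul]
  exact inv_lt_one_of_one_lt₀ (one_lt_pow₀ hP (by omega))

theorem eval_pencil_zero : (uNum lam p - C 0 * gPoly lam p).eval p = 0 := by simp [uNum]

theorem eval_pencil_one : (uNum lam p - C 1 * gPoly lam p).eval (p - 2) = 0 := by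
  rw [C_1, one_mul, uNum_sub_gPoly]; simp

theorem eval_pencil_lam {a : k} (ha : (2 * p - 3) * a - p + 2 = 0) :
    (uNum lam p - C lam * gPoly lam p).eval a = 0 := by
  rw [uNum_sub_lam_gPoly, eval_mul]
  simp only [eval_mul, eval_sub, eval_add, eval_X, eval_C, eval_ofNat, ha, mul_zero]

/-- The Weierstrass points of the explicit curve and their images. -/
theorem weierstrass_cases_of_explicit [IsAlgClosed k] (h2 : (2 : k) ≠ 0)
    (h_zero : lam ≠ 0) (h_one : lam ≠ 1) (hp : GoodParameter lam p)
    (H : HyperellipticModel (sexticPoly lam p) x y) (hx : Transcendental k x)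
    {z : K} (hz : z = aeval x (uNum lam p) / aeval x (gPoly lam p)) {P : CurvePoint k K}
    (hP : P.IsWeierstrass) :
    (1 < P.val z ∧ ∃ a, (gPoly lam p).eval a = 0 ∧ P.val (x - algebraMap k K a) < 1) ∨
      (P.val (z - algebraMap k K 0) < 1 ∧ P.val (x - algebraMap k K p) < 1) ∨
      (P.val (z - algebraMap k K 1) < 1 ∧ P.val (x - algebraMap k K (p - 2)) < 1) ∨
      (P.val (z - algebraMap k K lam) < 1 ∧
        ((∃ a, (2 * p - 3) * a - p + 2 = 0 ∧ P.val (x - algebraMap k K a) < 1) ∨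
          (2 * p - 3 = 0 ∧ 1 < P.val x))) := by
  obtain ⟨hsq, hne⟩ := hp.squarefree_sexticPoly h_zero h_one
  have hdeg := natDegree_sexticPoly (lam := lam) hne
  have hlin := natDegree_linear_le (p := p)
  have hroot : (sexticPoly lam p).eval p = 0 := sexticPoly_eval.2 (Or.inl rfl)
  rw [H.isWeierstrass_sextic_iff hx h2 hsq (by omega) (by omega) hroot] at hP
  subst hz
  rcases hP with ⟨a, hda, ha⟩ | ⟨h5, hP⟩
  · rcases sexticPoly_eval.1 hda with rfl | rfl | h | h
    · exact Or.inr (Or.inl ⟨val_sub_lt_of_explicit hp eval_pencil_zero ha, ha⟩)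
    · exact Or.inr (Or.inr (Or.inl ⟨val_sub_lt_of_explicit hp eval_pencil_one ha, ha⟩))
    · exact Or.inr (Or.inr (Or.inr ⟨val_sub_lt_of_explicit hp (eval_pencil_lam h) ha,
        Or.inl ⟨a, h, ha⟩⟩))
    · exact Or.inl ⟨one_lt_val_of_explicit h_zero hp hx h ha, a, h, ha⟩
  · have h3 := (natDegree_linear_eq_zero_iff (p := p)).1 (by omega)
    exact Or.inr (Or.inr (Or.inr ⟨val_sub_lt_of_explicit_infinity hx h3 hP, Or.inr ⟨h3, hP⟩⟩))

theorem encard_roots_of_squarefree [IsAlgClosed k] {A : k[X]} (hA : Squarefree A) :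
    {a | A.eval a = 0}.encard = A.natDegree := by
  classical
  have h : {a | A.eval a = 0} = (A.roots.toFinset : Set k) := by
    ext a
    rw [Finset.mem_coe, Multiset.mem_toFinset, mem_roots hA.ne_zero]
    rfl
  rw [h, Set.encard_coe_eq_coe_finsetCard,
    Multiset.toFinset_card_of_nodup (nodup_roots (PerfectField.separable_iff_squarefree.2 hA)),
    IsAlgClosed.card_roots_eq_natDegree]

theorem CurvePoint.not_val_sub_lt {P : CurvePoint k K} {z : K} (h : 1 < P.val z) (e : k) :
    ¬ P.val (z - algebraMap k K e) < 1 := fun h' =>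
  absurd (P.val_le_of_sub_lt h') (not_le.2 h)

/-- Over `∞` lie the three branch points given by the roots of `g`. Over `0`, `1`, `lam` lie the
single ones `p`, `p - 2` and `(p - 2) / (2 p - 3)`, the last being infinity if `2 p = 3`. -/
theorem isNormalized_of_explicit [IsAlgClosed k] (h2 : (2 : k) ≠ 0)
    (h_zero : lam ≠ 0) (h_one : lam ≠ 1) (hp : GoodParameter lam p)
    (H : HyperellipticModel (sexticPoly lam p) x y) (hx : Transcendental k x)
    (f : CurveCover k (LegendreField lam) K)
    (hf : f.pullback (legendreX lam) = aeval x (uNum lam p) / aeval x (gPoly lam p)) :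
    f.IsNormalized lam := by
  obtain ⟨hsq, hne⟩ := hp.squarefree_sexticPoly h_zero h_one
  have hdeg := natDegree_sexticPoly (lam := lam) hne
  have hlin := natDegree_linear_le (p := p)
  have hlin0 := natDegree_linear_eq_zero_iff (p := p)
  have hroot : (sexticPoly lam p).eval p = 0 := sexticPoly_eval.2 (Or.inl rfl)
  have hW := fun P => H.isWeierstrass_sextic_iff hx h2 hsq (by omega) (by omega) hroot P
  have hcases := fun {P} => weierstrass_cases_of_explicit h2 h_zero h_one hp H hx hf (P := P)
  choose pt hpt using fun a => exists_val_sub_lt (K := K) hx a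
  refine f.isNormalized_of h2 ?_ ?_ ?_
  · have hset : {P : CurvePoint k K | P.IsWeierstrass ∧ 1 < P.val (f.pullback (legendreX lam))} =
        pt '' {a | (gPoly lam p).eval a = 0} := by
      ext P
      constructor
      · rintro ⟨hP, hpole⟩
        rcases hcases hP with ⟨-, a, hga, ha⟩ | ⟨h, -⟩ | ⟨h, -⟩ | ⟨h, -⟩
        · exact ⟨a, hga, H.branch_point_eq hx h2 hsq
            (sexticPoly_eval.2 (Or.inr (Or.inr (Or.inr hga)))) (hpt a) ha⟩
        all_goals exact absurd h (CurvePoint.not_val_sub_lt hpole _)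
      · rintro ⟨a, hga, rfl⟩
        refine ⟨(hW _).2 (Or.inl ⟨a, sexticPoly_eval.2 (Or.inr (Or.inr (Or.inr hga))), hpt a⟩), ?_⟩
        rw [hf]
        exact one_lt_val_of_explicit h_zero hp hx hga (hpt a)
    rw [hset, Set.InjOn.encard_image, encard_roots_of_squarefree hp.squarefree, natDegree_gPoly]
    · rfl
    · intro a _ b _ hab
      have h := hpt b
      rw [← hab] at h
      exact (pt a).eq_of_sub_lt (hpt a) h
  · intro e he
    rw [Set.encard_eq_one]
    rcases eval_legendrePoly.1 he with rfl | rfl | rfl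
    · refine ⟨pt p, Set.eq_singleton_iff_unique_mem.2 ⟨⟨(hW _).2 (Or.inl ⟨p, hroot, hpt p⟩),
        hf ▸ val_sub_lt_of_explicit hp eval_pencil_zero (hpt p)⟩, ?_⟩⟩
      rintro P ⟨hP, hv⟩
      rcases hcases hP with ⟨h, -⟩ | ⟨h, h'⟩ | ⟨h, -⟩ | ⟨h, -⟩
      · exact absurd hv (CurvePoint.not_val_sub_lt h _)
      · exact H.branch_point_eq hx h2 hsq hroot h' (hpt p)
      · exact absurd (P.eq_of_sub_lt h hv) one_ne_zero
      · exact absurd (P.eq_of_sub_lt h hv) h_zero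
    · have hr1 : (sexticPoly lam p).eval (p - 2) = 0 := sexticPoly_eval.2 (by tauto)
      refine ⟨pt (p - 2), Set.eq_singleton_iff_unique_mem.2
        ⟨⟨(hW _).2 (Or.inl ⟨_, hr1, hpt _⟩), 
          hf ▸ val_sub_lt_of_explicit hp eval_pencil_one (hpt _)⟩, ?_⟩⟩
      rintro P ⟨hP, hv⟩
      rcases hcases hP with ⟨h, -⟩ | ⟨h, -⟩ | ⟨h, h'⟩ | ⟨h, -⟩
      · exact absurd hv (CurvePoint.not_val_sub_lt h _)
      · exact absurd (P.eq_of_sub_lt h hv) zero_ne_one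
      · exact H.branch_point_eq hx h2 hsq hr1 h' (hpt _)
      · exact absurd (P.eq_of_sub_lt h hv) h_one
    · by_cases h3 : 2 * p - 3 = 0
      · obtain ⟨Q, hQ⟩ := exists_pole (K := K) hx
        rw [Q.not_mem_iff] at hQ
        have h5 : (sexticPoly e p).natDegree = 2 * 2 + 1 := by
          rw [hdeg, hlin0.2 h3]
        refine ⟨Q, Set.eq_singleton_iff_unique_mem.2 ⟨⟨(hW _).2 (Or.inr ⟨h5, hQ⟩), 
          hf ▸ val_sub_lt_of_explicit_infinity hx h3 hQ⟩, ?_⟩⟩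
        rintro P ⟨hP, hv⟩
        rcases hcases hP with ⟨h, -⟩ | ⟨h, -⟩ | ⟨h, -⟩ | ⟨-, ⟨a, ha, -⟩ | ⟨-, h⟩⟩
        · exact absurd hv (CurvePoint.not_val_sub_lt h _)
        · exact absurd (P.eq_of_sub_lt h hv) h_zero.symm
        · exact absurd (P.eq_of_sub_lt h hv) h_one.symm
        · exfalso
          apply hne
          -- With `2 p = 3` the linear factor is the constant `2 - p`. A root of it would make it
          -- zero.
          have h2p : p = 2 := by
            rw [h3] at ha
            linear_combination -ha
          rw [h3, h2p, C_0, zero_mul, zero_sub, map_ofNat]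
          ring
        · exact H.point_infinity_eq hx h5 P Q h hQ
      · have hra : (2 * p - 3) * ((p - 2) / (2 * p - 3)) - p + 2 = 0 := by
          field_simp
          ring
        have hr1 : (sexticPoly e p).eval ((p - 2) / (2 * p - 3)) = 0 :=
          sexticPoly_eval.2 (by tauto)
        refine ⟨pt _, Set.eq_singleton_iff_unique_mem.2
          ⟨⟨(hW _).2 (Or.inl ⟨_, hr1, hpt _⟩), 
            hf ▸ val_sub_lt_of_explicit hp (eval_pencil_lam hra) (hpt _)⟩, ?_⟩⟩
        rintro P ⟨hP, hv⟩
        rcases hcases hP with ⟨h, -⟩ | ⟨h, -⟩ | ⟨h, -⟩ | ⟨-, ⟨a, ha, h⟩ | ⟨h, -⟩⟩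
        · exact absurd hv (CurvePoint.not_val_sub_lt h _)
        · exact absurd (P.eq_of_sub_lt h hv) h_zero.symm
        · exact absurd (P.eq_of_sub_lt h hv) h_one.symm
        · have : a = (p - 2) / (2 * p - 3) := by
            rw [eq_div_iff h3]
            linear_combination ha
          rw [this] at h
          exact H.branch_point_eq hx h2 hsq hr1 h (hpt _)
        · exact absurd h h3
  · intro P hP
    rcases hcases hP with ⟨h, -⟩ | ⟨h, -⟩ | ⟨h, -⟩ | ⟨h, -⟩
    · exact Or.inl h
    · exact Or.inr ⟨0, eval_legendrePoly.2 (by tauto), h⟩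
    · exact Or.inr ⟨1, eval_legendrePoly.2 (by tauto), h⟩
    · exact Or.inr ⟨lam, eval_legendrePoly.2 (by tauto), h⟩

end Explicit

/-! ### Existence of the explicit covers and independence of the sign. -/

section Existence

variable {k : Type u} [Field k] {lam p : k}

theorem exists_isExplicitCover [IsAlgClosed k] (h2 : (2 : k) ≠ 0) (h_zero : lam ≠ 0) (h_one : lam ≠ 1)
    (hp : GoodParameter lam p) (ε : ℤˣ) : ∃ f, IsExplicitCover lam p ε f := by
  obtain ⟨hsq, hne⟩ := hp.squarefree_sexticPoly h_zero h_one
  have hdeg := natDegree_sexticPoly (lam := lam) hne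
  have hlin := natDegree_linear_le (p := p)
  have hnu : ¬ IsUnit (sexticPoly lam p) := fun hu => by
    rw [natDegree_eq_zero_of_isUnit hu] at hdeg; omega
  have : Fact (Irreducible (X ^ 2 - C (algebraMap k[X] (RatFunc k) (sexticPoly lam p)))) :=
    ⟨irreducible_X_sq_sub_C hsq hnu⟩
  obtain ⟨hx, H⟩ := HyperellipticField.model (d := sexticPoly lam p)
  obtain ⟨f, hfX, hfY⟩ := exists_legendreHom h_zero h_one (hp.aeval_transcendental h_zero hx)
    (explicit_equation hx H.eq ε)
  have hf3 := homDegree_of_explicit h_zero h_one hp H hx hfX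
  let φ : CurveCover k (LegendreField lam) (HyperellipticField (sexticPoly lam p)) :=
    ⟨f, AlgHom.finite_of_homDegree_ne_zero (by omega)⟩
  exact ⟨{ K := HyperellipticField (sexticPoly lam p)
           isCurveField := H.isCurveField hx
           genus_eq := H.curveGenus_eq_two hx h2 hsq (by omega) (by omega)
            (sexticPoly_eval.2 (Or.inl rfl))
           cover := φ
           degree_eq := hf3
           isNormalized := isNormalized_of_explicit h2 h_zero h_one hp H hx φ hfX },
    _, _, H.adjoin_eq_top, H.eq, hfX, hfY⟩

/-- The models have the same equation. A difference of signs is absorbed by `y ↦ -y`. -/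
theorem IsExplicitCover.equivalent (h_zero : lam ≠ 0) (h_one : lam ≠ 1)
    (hp : GoodParameter lam p) {ε ε' : ℤˣ} {f f' : NormalizedGenusTwoCover lam}
    (hf : IsExplicitCover lam p ε f) (hf' : IsExplicitCover lam p ε' f') : f ≈ f' := by
  obtain ⟨x, y, htop, heq, hX, hY⟩ := hf
  obtain ⟨x', y', htop', heq', hX', hY'⟩ := hf'
  obtain ⟨hsq, hne⟩ := hp.squarefree_sexticPoly h_zero h_one
  have hdeg := natDegree_sexticPoly (lam := lam) hne
  have hnu : ¬ IsUnit (sexticPoly lam p) := fun hu => by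
    rw [natDegree_eq_zero_of_isUnit hu] at hdeg; omega
  have H : HyperellipticModel (sexticPoly lam p) x y := ⟨heq, htop⟩
  have H' : HyperellipticModel (sexticPoly lam p) x' y' := ⟨heq', htop'⟩
  have hx := H.transcendental f.isCurveField
  have hx' := H'.transcendental f'.isCurveField
  have hε : ∀ ε : ℤˣ, ((ε : ℤ) : f.K) = 1 ∨ ((ε : ℤ) : f.K) = -1 := by
    intro ε
    rcases Int.units_eq_one_or ε with rfl | rfl <;> simp
  obtain ⟨e, hex, hey⟩ : ∃ e : f'.K ≃ₐ[k] f.K, e x' = x ∧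
      ((ε' : ℤ) : f.K) * e y' = (ε : ℤ) * y := by
    by_cases h : ((ε : ℤ) : f.K) = (ε' : ℤ)
    · obtain ⟨e, h1, h2⟩ := H'.exists_algEquiv hx' H hx hsq hnu
      exact ⟨e, h1, by rw [h2, h]⟩
    · obtain ⟨e, h1, h2⟩ := H'.exists_algEquiv hx' H.neg hx hsq hnu
      refine ⟨e, h1, ?_⟩
      rw [h2]
      rcases hε ε with h3 | h3 <;> rcases hε ε' with h4 | h4 <;> simp_all
  refine ⟨e, fun z => ?_⟩
  have hcomp : f.cover.pullback = e.toAlgHom.comp f'.cover.pullback := by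
    apply (legendre_model lam).algHom_ext
    · change _ = e (f'.cover.pullback _)
      rw [hX, hX', map_div₀, ← aeval_algHom_apply, ← aeval_algHom_apply, hex]
    · change _ = e (f'.cover.pullback _)
      rw [hY, hY']
      simp only [map_div₀, map_pow, ← aeval_algHom_apply, map_mul, map_sub, map_one, map_intCast, hex, AlgEquiv.commutes]
      linear_combination (-(algebraMap k f.K lam * (algebraMap k f.K lam - 1)) * x * (x - 1) /
        aeval x (gPoly lam p) ^ 2) * hey
  rw [hcomp]
  rfl

end Existence
end

noncomputable section

/-! ### Injectivity: rigidity of the coordinate. -/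

section Moebius

variable {k : Type u} [Field k] {lam p q : k}

/-- The homogenization of `gPoly`. -/
def gForm (lam q : k) (N L : k[X]) : k[X] :=
  N ^ 3 + C (-q) * N ^ 2 * L + C ((lam - 1) * (3 - 2 * q)) * N * L ^ 2 +
    C ((lam - 1) * (q - 2)) * L ^ 3

theorem aeval_gForm {K : Type*} [Field K] [Algebra k K] (x : K) (N L : k[X]) :
    aeval x (gForm lam q N L) = aeval x N ^ 3 + algebraMap k K (-q) * aeval x N ^ 2 * aeval x L +
      algebraMap k K ((lam - 1) * (3 - 2 * q)) * aeval x N * aeval x L ^ 2 +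
      algebraMap k K ((lam - 1) * (q - 2)) * aeval x L ^ 3 := by
  simp only [gForm, map_add, map_mul, map_pow, aeval_C]

/-- A linear fractional transformation compatible with two of the explicit covers of the line is
trivial. -/
theorem eq_of_moebius (h_zero : lam ≠ 0) (h_one : lam ≠ 1)
    (hp : GoodParameter lam p) {a b : k} (hN0 : C q * (C a + C b * X) + X - C p ≠ 0)
    (h : (C q * (C a + C b * X) + X - C p) ^ 2 * gPoly lam p =
      X ^ 2 * gForm lam q (C q * (C a + C b * X) + X - C p) (C a + C b * X)) : p = q := by
  have hg0 : (gPoly lam p).eval 0 ≠ 0 := hp.eval_ne_zero (by simp [uNum])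
  -- Write `L = a + b X` and `N = q L + X - p`, so that `N / L` is the second coordinate. The
  -- identity `h` says that the two maps `u` agree, after cancelling `lam (X - p)`. At `X = 0`,
  -- where `g` does not vanish, it gives `N(0) = 0`, so `N = ν X`.
  have hqa : q * a = p := by
    have h0 := congrArg (eval 0) h
    simp only [eval_mul, eval_pow, eval_sub, eval_add, eval_C, eval_X, ne_eq, OfNat.ofNat_ne_zero,
      not_false_eq_true, zero_pow, zero_mul, mul_zero, add_zero] at h0
    have := (mul_eq_zero.1 h0).resolve_right hg0
    exact sub_eq_zero.1 (pow_eq_zero_iff two_ne_zero |>.1 this)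
  set ν := q * b + 1 with hν
  have hN : C q * (C a + C b * X) + X - C p = C ν * X := by
    rw [← hqa, hν]
    simp only [map_mul, map_add, map_one]
    ring
  have hν0 : ν ≠ 0 := by
    intro h0
    rw [hN, h0, C_0, zero_mul] at hN0
    exact hN0 rfl
  rw [hN] at h
  have hG : gForm lam q (C ν * X) (C a + C b * X) = C (ν ^ 2) * gPoly lam p := by
    have hX : (X ^ 2 : k[X]) ≠ 0 := pow_ne_zero _ X_ne_zero
    apply mul_left_cancel₀ hX
    rw [← h, C_pow]
    ring
  have hlin := (hp.squarefree_sexticPoly h_zero h_one).2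
  have hllC : C (lam * (lam - 1)) ≠ 0 := C_ne_zero.2 (mul_ne_zero h_zero (sub_ne_zero.2 h_one))
  have hl1C : C (lam - 1) ≠ 0 := C_ne_zero.2 (sub_ne_zero.2 h_one)
  have hN' : C ν * X = C q * (C a + C b * X) + X - C p := hN.symm
  -- Comparison of the fibres over `lam`. The right hand side is nonzero of degree at most one, so
  -- the square on the left must be constant and `b = 0`.
  have hthird : (C a + C b * X) ^ 2 * (C (2 * q - 3) * (C ν * X) - C (q - 2) * (C a + C b * X)) =
      C (ν ^ 2) * (C (2 * p - 3) * X - C p + 2) := by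
    apply mul_left_cancel₀ hllC
    have e := uNum_sub_lam_gPoly lam p
    rw [mul_left_comm _ (C (ν ^ 2)), ← e, mul_sub (C (ν ^ 2)), mul_left_comm _ (C lam), ← hG, gForm, uNum]
    simp only [map_mul, map_sub, map_pow, map_neg, C_1, map_ofNat] at hN' ⊢
    linear_combination (C lam * (C ν) ^ 2 * X ^ 2) * hN'
  -- Comparison of the fibres over `1`. Once `b = 0` and `ν = 1` it reads `(X - a)² (X - p + 2 a) =
  -- (X - 1)² (X - p + 2)`, which forces `a = 1`.
  have hsecond : (C ν * X - (C a + C b * X)) ^ 2 * (X - C p + 2 * (C a + C b * X)) =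
      C (ν ^ 2) * ((X - 1) ^ 2 * (X - C p + 2)) := by
    apply mul_left_cancel₀ hl1C
    have e := uNum_sub_gPoly lam p
    rw [mul_assoc] at e
    rw [mul_left_comm _ (C (ν ^ 2)), ← e, mul_sub (C (ν ^ 2)), ← hG, gForm, uNum]
    simp only [map_mul, map_sub, map_pow, map_neg, C_1, map_ofNat] at hN' ⊢
    linear_combination (C lam * (C ν) ^ 2 * X ^ 2 -
      (C ν * X - (C a + C b * X)) ^ 2 * (C lam - 1)) * hN'
  have hb : b = 0 := by
    by_contra hb
    have hL : (C a + C b * X).natDegree = 1 := by compute_degree!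
    have hR : C (ν ^ 2) * (C (2 * p - 3) * X - C p + 2) ≠ 0 :=
      mul_ne_zero (C_ne_zero.2 (pow_ne_zero _ hν0)) hlin
    have hdeg := congrArg natDegree hthird
    rw [natDegree_mul (fun h0 => hR (by rw [← hthird, h0, zero_mul]))
      (fun h0 => hR (by rw [← hthird, h0, mul_zero])), natDegree_pow, hL,
      natDegree_C_mul (pow_ne_zero _ hν0)] at hdeg
    have := natDegree_linear_le (p := p)
    omega
  have hν1 : ν = 1 := by rw [hν, hb, mul_zero, zero_add]
  rw [hν1, hb] at hsecond
  have h1 := congrArg (eval 1) hsecond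
  have hc := congrArg derivative hsecond
  have h1' := congrArg (eval 0) hc
  simp only [derivative_mul, derivative_pow, derivative_sub, derivative_add, derivative_X,
    derivative_C, derivative_one, derivative_ofNat, eval_mul, eval_pow, eval_sub, eval_add, eval_C,
    eval_X, eval_one, eval_ofNat, eval_zero] at h1 h1'
  have ha1 : (1 - a) ^ 2 * (1 - p + 2 * a) = 0 := by linear_combination h1
  have ha : a = 1 := by
    rcases mul_eq_zero.1 ha1 with h0 | h0
    · exact (sub_eq_zero.1 (pow_eq_zero_iff two_ne_zero |>.1 h0)).symm
    · have hpa : p = 1 + 2 * a := by linear_combination -h0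
      rw [hpa] at h1'
      norm_num at h1'
      have : (a - 1) ^ 2 = 0 := by linear_combination h1'
      exact sub_eq_zero.1 (pow_eq_zero_iff two_ne_zero |>.1 this)
  rw [← hqa, ha, mul_one]

variable {K : Type*} [Field K] [Algebra k K] {x y x' y' : K}

/-- The only Weierstrass point over `0` is `x = p` in one model and `x' = q` in the other. Both `1 /
(x - p)` and `1 / (x' - q)` have it as their only pole, of order two, so they are related linearly.
-/
theorem parameter_eq_of_explicit [IsAlgClosed k] (h2 : (2 : k) ≠ 0)
    (h_zero : lam ≠ 0) (h_one : lam ≠ 1) (hp : GoodParameter lam p) (hq : GoodParameter lam q)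
    (H : HyperellipticModel (sexticPoly lam p) x y) (hx : Transcendental k x)
    (H' : HyperellipticModel (sexticPoly lam q) x' y') (hx' : Transcendental k x')
    (hu : aeval x (uNum lam p) / aeval x (gPoly lam p) =
      aeval x' (uNum lam q) / aeval x' (gPoly lam q)) : p = q := by
  obtain ⟨hsq, hne⟩ := hp.squarefree_sexticPoly h_zero h_one
  have hdeg := natDegree_sexticPoly (lam := lam) hne
  have hlin := natDegree_linear_le (p := p)
  have hroot : (sexticPoly lam p).eval p = 0 := sexticPoly_eval.2 (Or.inl rfl)
  obtain ⟨hsq', hne'⟩ := hq.squarefree_sexticPoly h_zero h_one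
  have hdeg' := natDegree_sexticPoly (lam := lam) hne'
  have hlin' := natDegree_linear_le (p := q)
  have hroot' : (sexticPoly lam q).eval q = 0 := sexticPoly_eval.2 (Or.inl rfl)
  have hxp := HyperellipticModel.sub_algebraMap_ne_zero hx p
  have hxq := HyperellipticModel.sub_algebraMap_ne_zero hx' q
  obtain ⟨P, hP'⟩ := exists_val_sub_lt (K := K) hx' q
  have hW := H'.isWeierstrass_of_root hx' h2 hsq' P hroot' hP'
  have hPv := val_sub_lt_of_explicit hq eval_pencil_zero hP'
  rw [← hu] at hPv
  have hP : P.val (x - algebraMap k K p) < 1 := by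
    rcases weierstrass_cases_of_explicit h2 h_zero h_one hp H hx rfl hW with
      ⟨h, -⟩ | ⟨-, h⟩ | ⟨h, -⟩ | ⟨h, -⟩
    · exact absurd hPv (CurvePoint.not_val_sub_lt h _)
    · exact h
    · exact absurd (P.eq_of_sub_lt h hPv) one_ne_zero
    · exact absurd (P.eq_of_sub_lt h hPv) h_zero
  have H1 := H.quintic hx (by omega) p
  have H1' := H'.quintic hx' (by omega) q
  have h5' := natDegree_quinticAt hsq' (by omega) hroot'
  have hx1' := H1'.transcendental (H.isCurveField hx)
  have hPinf' : 1 < P.val (x' - algebraMap k K q)⁻¹ := by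
    rw [← HyperellipticModel.val_inv_lt_iff (inv_ne_zero hxq), inv_inv]; exact hP'
  obtain ⟨α, β, hαβ⟩ := H1.exists_eq_linear (H.isCurveField hx) h2
    (squarefree_quinticAt hsq (by omega) (by omega) hroot)
    (natDegree_quinticAt hsq (by omega) hroot) P
    (by rw [← HyperellipticModel.val_inv_lt_iff (inv_ne_zero hxp), inv_inv]; exact hP)
    (z := (x' - algebraMap k K q)⁻¹)
    (fun Q hQ => by
      by_contra h
      exact hQ (H1'.point_infinity_eq hx1' (g := 2) h5' Q P (Q.not_mem_iff.1 h) hPinf'))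
    (fun s t hs ht => by
      obtain ⟨τ, hτ, h1⟩ := H1'.isUniformizer_infinity hx1' (g := 2) h5' P hPinf'
      rw [P.mem_iff, map_mul, map_mul, ← h1]
      exact mul_le_mul_left (mul_le_mul' (hτ.val_le (P.vanishes_iff.1 hs))
        (hτ.val_le (P.vanishes_iff.1 ht))) _)
  -- Clearing denominators in `1 / (x' - q) = α / (x - p) + β` gives `(a + β x) (x' - q) = x - p`.
  set a := α - β * p with ha
  have hL : aeval x (C a + C β * X) * (x' - algebraMap k K q) = x - algebraMap k K p := by
    have h1 : (algebraMap k K α * (x - algebraMap k K p)⁻¹ + algebraMap k K β) *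
        (x' - algebraMap k K q) = 1 := by rw [← hαβ, inv_mul_cancel₀ hxq]
    simp only [map_add, map_mul, aeval_C, aeval_X, ha, map_sub]
    field_simp at h1
    linear_combination h1
  have hN : aeval x (C q * (C a + C β * X) + X - C p) = x' * aeval x (C a + C β * X) := by
    rw [map_sub, map_add, map_mul, aeval_C, aeval_C, aeval_X]
    linear_combination -hL
  have hL0 : aeval x (C a + C β * X) ≠ 0 := by
    intro h
    rw [h, zero_mul] at hL
    exact hxp hL.symm
  have hx'0 : x' ≠ 0 := by
    rintro rfl
    exact hx' isAlgebraic_zero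
  refine eq_of_moebius (a := a) (b := β) h_zero h_one hp ?_ ?_
  · intro h
    rw [h, map_zero] at hN
    exact mul_ne_zero hx'0 hL0 hN.symm
  · apply transcendental_iff_injective.1 hx
    have hg := aeval_gPoly_ne_zero (lam := lam) (p := p) hx
    have hg' := aeval_gPoly_ne_zero (lam := lam) (p := q) hx'
    rw [div_eq_div_iff hg hg'] at hu
    have hG : aeval x (gForm lam q (C q * (C a + C β * X) + X - C p) (C a + C β * X)) =
        aeval x' (gPoly lam q) * aeval x (C a + C β * X) ^ 3 := by
      rw [aeval_gForm, gPoly_eq, hN]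
      generalize aeval x (C a + C β * X) = l
      simp only [map_add, map_mul, map_pow, aeval_C, aeval_X]
      ring
    rw [map_mul, map_mul, hG, map_pow, map_pow, aeval_X, hN]
    have hlK : algebraMap k K lam ≠ 0 := by simpa using h_zero
    have e1 : aeval x (uNum lam p) = algebraMap k K lam * (x - algebraMap k K p) * x ^ 2 := by
      simp [uNum]
    have e2 : aeval x' (uNum lam q) = algebraMap k K lam * (x' - algebraMap k K q) * x' ^ 2 := by
      simp [uNum]
    rw [e1, e2] at hu
    apply mul_left_cancel₀ (mul_ne_zero hlK hxq)
    linear_combination (-aeval x (C a + C β * X) ^ 2) * hu -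
      (algebraMap k K lam * x ^ 2 * aeval x' (gPoly lam q) * aeval x (C a + C β * X) ^ 2) * hL

end Moebius
end

noncomputable section

/-! ### Counting functions with a single pole. -/

section PoleSpace

variable {k K : Type*} [Field k] [Field K] [Algebra k K]

/-- If the value of `z` exceeded `c ≥ 1`, the leading term would dominate all others in the integral
equation. -/
theorem CurvePoint.val_le_of_monic (P : CurvePoint k K) {S : Subalgebra k K} {q : S[X]}
    (hq : q.Monic) {z : K} (hz : aeval z q = 0) {c : P.ring.ValueGroup} (hc : 1 ≤ c)
    (h : ∀ i, P.val (q.coeff i : K) ≤ c) : P.val z ≤ c := by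
  by_contra! hlt
  have hz1 : 1 < P.val z := hc.trans_lt hlt
  have hpos : ∀ n, P.val z ^ n ≠ 0 := fun n => pow_ne_zero _ (by rintro h; simp [h] at hz1)
  rw [aeval_eq_sum_range, Finset.sum_range_succ, hq.coeff_natDegree, one_smul,
    add_eq_zero_iff_eq_neg] at hz
  have hsum : P.val (∑ i ∈ Finset.range q.natDegree, q.coeff i • z ^ i) < P.val z ^ q.natDegree := by
    refine Valuation.map_sum_lt _ (hpos _) fun i hi => ?_
    have hi' : i + 1 ≤ q.natDegree := Finset.mem_range.1 hi
    rw [Algebra.smul_def, map_mul, map_pow]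
    refine lt_of_lt_of_le ?_ (pow_le_pow_right₀ hz1.le hi')
    rw [pow_succ']
    exact mul_lt_mul_of_pos_right ((h i).trans_lt hlt) (zero_lt_iff.2 (hpos i))
  rw [hz, Valuation.map_neg, map_pow] at hsum
  exact lt_irrefl _ hsum

/-- The functions whose value at `P` is bounded by `c`. -/
def CurvePoint.valLE (P : CurvePoint k K) (c : P.ring.ValueGroup) : Submodule k K where
  carrier := {z | P.val z ≤ c}
  add_mem' {a b} ha hb := by
    change P.val (a + b) ≤ c
    exact Valuation.map_add_le _ ha hb
  zero_mem' := by
    change P.val 0 ≤ c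
    rw [map_zero]; exact zero_le
  smul_mem' a z hz := by
    change P.val (a • z) ≤ c
    rw [Algebra.smul_def, map_mul]
    calc _ ≤ 1 * P.val z := mul_le_mul_left (P.val_algebraMap_le a) _
      _ ≤ c := by rw [one_mul]; exact hz

theorem CurvePoint.mem_valLE {P : CurvePoint k K} {c : P.ring.ValueGroup} {z : K} :
    z ∈ P.valLE c ↔ P.val z ≤ c := Iff.rfl

/-- The functions without poles outside of `P` whose pole at `P` is bounded by that of `h ^ n`. -/
def poleSpace (P : CurvePoint k K) (h : K) (n : ℕ) : Submodule k K :=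
  (⨅ Q : {Q : CurvePoint k K // Q ≠ P}, Q.1.valLE 1) ⊓ P.valLE (P.val h ^ n)

theorem mem_poleSpace {P : CurvePoint k K} {h : K} {n : ℕ} {z : K} :
    z ∈ poleSpace P h n ↔ (∀ Q : CurvePoint k K, Q ≠ P → Q.val z ≤ 1) ∧ P.val z ≤ P.val h ^ n := by
  rw [poleSpace, Submodule.mem_inf, Submodule.mem_iInf, Subtype.forall]
  rfl

variable {P : CurvePoint k K} {h : K}

theorem IsCurveField.isAlgebraic_algebra_adjoin (hK : IsCurveField k K) {x : K}
    (hx : Transcendental k x) : Algebra.IsAlgebraic (Algebra.adjoin k {x}) K := by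
  have hi : AlgebraicIndependent k (fun _ : Unit => x) := by
    rw [algebraicIndependent_unique_type_iff]; exact hx
  have hb := hi.isTranscendenceBasis_of_lift_trdeg_le_of_finite (by
    rw [hK.trdeg_eq_one]; simp)
  have := hb.isAlgebraic
  rwa [Set.range_const] at this

/-- The coefficients of an integral equation are polynomials in `h`. They are regular away from `P`,
and at `P` their degrees bound the pole of `z`. -/
theorem exists_mem_poleSpace (hreg : ∀ Q : CurvePoint k K, Q ≠ P → h ∈ Q.ring) (hP : 1 < P.val h)
    {z : K} (hz : IsIntegral (Algebra.adjoin k {h}) z) :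
    ∃ N, ∀ n, N ≤ n → z ∈ poleSpace P h n := by
  obtain ⟨q, hq, hqz⟩ := hz
  have hcoeff : ∀ i, ∃ A : k[X], aeval h A = (q.coeff i : K) := fun i =>
    Algebra.adjoin_mem_exists_aeval k h (q.coeff i).2
  choose A hA using hcoeff
  refine ⟨∑ i ∈ Finset.range (q.natDegree + 1), (A i).natDegree, fun n hn => mem_poleSpace.2
    ⟨fun Q hQ => ?_, ?_⟩⟩
  · refine Q.val_le_of_monic hq hqz le_rfl fun i => ?_
    rw [← hA]
    exact Q.val_aeval_le (Q.mem_iff.1 (hreg Q hQ)) _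
  · refine P.val_le_of_monic hq hqz (one_le_pow₀ hP.le) fun i => ?_
    rcases Nat.lt_or_ge q.natDegree i with hi | hi
    · rw [coeff_eq_zero_of_natDegree_lt hi]
      simp
    · by_cases hA0 : A i = 0
      · rw [← hA, hA0]; simp
      · rw [← hA, P.val_aeval_of_one_lt hP hA0]
        refine pow_le_pow_right₀ hP.le (le_trans ?_ hn)
        exact Finset.single_le_sum (f := fun i => (A i).natDegree) (fun _ _ => Nat.zero_le _)
          (Finset.mem_range.2 (by omega))

variable [IsAlgClosed k]

/-- The hypothesis `hst` says that the square of the maximal ideal lies in the ideal generated by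
`h⁻¹`. So the local ring modulo `h⁻¹` is spanned by `1` and one element `t`. Discreteness of the
valuation is not presupposed: if the maximal ideal is not contained in `(h⁻¹)`, any `t` in it but
outside `(h⁻¹)` dominates the whole maximal ideal. -/
theorem exists_linear_sub_le (hK : IsCurveField k K) (hP : 1 < P.val h)
    (hst : ∀ s t : K, P.Vanishes s → P.Vanishes t → s * t * h ∈ P.ring) :
    ∃ t : K, ∀ z, P.val z ≤ 1 → ∃ a b : k,
      P.val (z - algebraMap k K a - algebraMap k K b * t) ≤ P.val h⁻¹ := by
  have hh0 : h ≠ 0 := by rintro rfl; simp at hP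
  have hle : ∀ z, z * h ∈ P.ring → P.val z ≤ P.val h⁻¹ := by
    intro z hz
    rw [P.mem_iff, map_mul] at hz
    rw [map_inv₀, ← one_mul (P.val h)⁻¹]
    exact (le_mul_inv_iff₀ (zero_lt_iff.2 (by simpa using hh0))).2 hz
  by_cases hm : ∀ s, P.val s < 1 → P.val s ≤ P.val h⁻¹
  · refine ⟨0, fun z hz => ?_⟩
    obtain ⟨a, ha⟩ := hK.exists_sub_lt P hz
    exact ⟨a, 0, by simpa using hm _ ha⟩
  · push Not at hm
    obtain ⟨t, ht1, ht⟩ := hm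
    have ht0 : t ≠ 0 := by rintro rfl; simp at ht
    refine ⟨t, fun z hz => ?_⟩
    obtain ⟨a, ha⟩ := hK.exists_sub_lt P hz
    set s := z - algebraMap k K a with hs
    have hst' : P.val s ≤ P.val t := by
      by_contra! hlt
      have hs0 : s ≠ 0 := by
        intro h0; simp [h0] at hlt
      have h1 : P.val (t / s) < 1 := by
        rw [map_div₀]
        exact (div_lt_one₀ (zero_lt_iff.2 (by simpa using hs0))).2 hlt
      have h2 := hst (t / s) s (P.vanishes_iff.2 h1) (P.vanishes_iff.2 ha)
      rw [div_mul_cancel₀ _ hs0] at h2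
      exact absurd (hle _ h2) (not_le.2 ht)
    have h1 : P.val (s / t) ≤ 1 := by
      rw [map_div₀]
      exact (div_le_one₀ (zero_lt_iff.2 (by simpa using ht0))).2 hst'
    obtain ⟨b, hb⟩ := hK.exists_sub_lt P h1
    refine ⟨a, b, hle _ ?_⟩
    have h2 := hst _ t (P.vanishes_iff.2 hb) (P.vanishes_iff.2 ht1)
    rwa [sub_mul, div_mul_cancel₀ _ ht0] at h2

/-- Raising the pole bound by one power of `h` adds at most two dimensions, those of the local ring
modulo `h⁻¹`. The induction starts with the constants. -/
theorem rank_poleSpace_le (hK : IsCurveField k K) (hP : 1 < P.val h)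
    (hst : ∀ s t : K, P.Vanishes s → P.Vanishes t → s * t * h ∈ P.ring) (n : ℕ) :
    Module.rank k (poleSpace P h n) ≤ (2 * n + 1 : ℕ) := by
  have hh0 : h ≠ 0 := by rintro rfl; simp at hP
  have hv0 : P.val h ≠ 0 := by simpa using hh0
  induction n with
  | zero =>
    have hle : poleSpace P h 0 ≤ Submodule.span k {1} := by
      intro z hz
      rw [mem_poleSpace, pow_zero] at hz
      obtain ⟨c, rfl⟩ := exists_eq_algebraMap_of_forall_mem (k := k) (z := z) (fun Q => by
        rw [Q.mem_iff]
        by_cases hQ : Q = P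
        · rw [hQ]; exact hz.2
        · exact hz.1 Q hQ)
      rw [Algebra.algebraMap_eq_smul_one]
      exact Submodule.smul_mem _ _ (Submodule.mem_span_singleton_self 1)
    refine (Submodule.rank_mono hle).trans ((rank_span_le _).trans ?_)
    simp
  | succ n ih =>
    obtain ⟨t, ht⟩ := exists_linear_sub_le hK hP hst
    -- The leading part at `P`: division by `h ^ (n + 1)`, then reduction modulo `h⁻¹`. The kernel
    -- is the previous pole space.
    let φ : poleSpace P h (n + 1) →ₗ[k] K ⧸ P.valLE (P.val h⁻¹) :=
      (P.valLE (P.val h⁻¹)).mkQ ∘ₗ (LinearMap.mulRight k (h⁻¹ ^ (n + 1))) ∘ₗ Submodule.subtype _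
    have hrange : LinearMap.range φ ≤ Submodule.span k
        {(P.valLE (P.val h⁻¹)).mkQ 1, (P.valLE (P.val h⁻¹)).mkQ t} := by
      rintro _ ⟨z, rfl⟩
      have hz := (mem_poleSpace.1 z.2).2
      have hz1 : P.val ((z : K) * h⁻¹ ^ (n + 1)) ≤ 1 := by
        rw [map_mul, map_pow, map_inv₀, inv_pow]
        exact mul_inv_le_one_of_le₀ hz (zero_le)
      obtain ⟨a, b, hab⟩ := ht _ hz1
      have : φ z = a • (P.valLE (P.val h⁻¹)).mkQ 1 + b • (P.valLE (P.val h⁻¹)).mkQ t := by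
        rw [← map_smul, ← map_smul, ← map_add]
        refine (Submodule.Quotient.eq _).2 ?_
        rw [CurvePoint.mem_valLE]
        rw [Algebra.smul_def, Algebra.smul_def, mul_one, ← sub_sub]
        exact hab
      rw [this]
      exact add_mem (Submodule.smul_mem _ _ (Submodule.subset_span (by simp)))
        (Submodule.smul_mem _ _ (Submodule.subset_span (by simp)))
    have hker : Module.rank k (LinearMap.ker φ) ≤ Module.rank k (poleSpace P h n) := by
      have hmem : ∀ z : LinearMap.ker φ, ((z : poleSpace P h (n + 1)) : K) ∈ poleSpace P h n := by
        intro z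
        have h1 := mem_poleSpace.1 z.1.2
        have h2 : P.val ((z.1 : K) * h⁻¹ ^ (n + 1)) ≤ P.val h⁻¹ := by
          have := (Submodule.Quotient.mk_eq_zero _).1 (LinearMap.mem_ker.1 z.2)
          exact this
        refine mem_poleSpace.2 ⟨h1.1, ?_⟩
        have e : (z.1 : K) = (z.1 : K) * h⁻¹ ^ (n + 1) * h ^ (n + 1) := by
          rw [inv_pow, mul_assoc, inv_mul_cancel₀ (pow_ne_zero _ hh0), mul_one]
        rw [e, map_mul, map_pow]
        calc _ ≤ P.val h⁻¹ * P.val h ^ (n + 1) := mul_le_mul_left h2 _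
          _ = P.val h ^ n := by rw [map_inv₀, pow_succ', inv_mul_cancel_left₀ hv0]
      exact LinearMap.rank_le_of_injective
        (LinearMap.codRestrict (poleSpace P h n)
          ((poleSpace P h (n + 1)).subtype ∘ₗ (LinearMap.ker φ).subtype) hmem)
        (fun a b hab => Subtype.ext (Subtype.ext (congrArg (fun w : poleSpace P h n => (w : K)) hab)))
    have h2 : Module.rank k (LinearMap.range φ) ≤ 2 := by
      refine (Submodule.rank_mono hrange).trans ((rank_span_le _).trans ?_)
      refine Cardinal.mk_insert_le.trans ?_
      rw [Cardinal.mk_singleton, one_add_one_eq_two]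
    rw [← LinearMap.rank_range_add_rank_ker φ]
    calc _ ≤ (2 : Cardinal) + (2 * n + 1 : ℕ) := add_le_add h2 (hker.trans ih)
      _ = (2 * (n + 1) + 1 : ℕ) := by push_cast; ring

/-- A function with a single pole, of order at most two, is of degree at most two. -/
theorem finrank_adjoin_le_two (hK : IsCurveField k K) (hP : 1 < P.val h)
    (hreg : ∀ Q : CurvePoint k K, Q ≠ P → h ∈ Q.ring)
    (hst : ∀ s t : K, P.Vanishes s → P.Vanishes t → s * t * h ∈ P.ring) :
    Module.finrank (IntermediateField.adjoin k {h}) K ≤ 2 := by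
  have hh : Transcendental k h := by
    intro halg
    obtain ⟨c, rfl⟩ := IsCurveField.exists_eq_algebraMap_of_isAlgebraic halg
    exact absurd (P.val_algebraMap_le c) (not_le.2 hP)
  have := hK.isAlgebraic_adjoin hh
  have := hK.isAlgebraic_algebra_adjoin hh
  have := hK.finitelyGenerated
  have : Algebra.EssFiniteType (IntermediateField.adjoin k {h}) K := .of_comp k _ K
  have : Module.Finite (IntermediateField.adjoin k {h}) K :=
    Algebra.finite_of_essFiniteType_of_isAlgebraic
  set D := Module.finrank (IntermediateField.adjoin k {h}) K with hD
  let b := Module.finBasis (IntermediateField.adjoin k {h}) K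
  have h_integral : ∀ j, ∃ y : Algebra.adjoin k {h}, y ≠ 0 ∧ IsIntegral (Algebra.adjoin k {h}) (y • b j) :=
    fun j => (Algebra.IsAlgebraic.isAlgebraic (b j)).exists_integral_multiple
  choose y hy0 hy using h_integral
  choose N hN using fun j => exists_mem_poleSpace hreg hP (hy j)
  -- A basis over `k(h)`, scaled to be integral over `k[h]`, has poles bounded by `h ^ M`. Its `D`
  -- elements times `h ^ i`, `i ≤ 2 M`, are `(2 M + 1) D` independent functions in a space of
  -- dimension at most `6 M + 1`, so `D ≤ 2`.
  set M := ∑ j, N j with hM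
  have hNM : ∀ j, N j ≤ M := fun j =>
    Finset.single_le_sum (f := N) (fun _ _ => Nat.zero_le _) (Finset.mem_univ j)
  let w : Fin D → (IntermediateField.adjoin k {h})ˣ := fun j => Units.mk0
    ⟨(y j : K), IntermediateField.algebra_adjoin_le_adjoin k _ (y j).2⟩ (fun h0 => hy0 j (by
      have := congrArg Subtype.val h0
      exact Subtype.ext this))
  have hind := b.linearIndependent.units_smul w
  let gen : IntermediateField.adjoin k {h} := IntermediateField.AdjoinSimple.gen k h
  have hgen : Transcendental k gen := fun halg => hh
    ((isAlgebraic_algHom_iff (IntermediateField.val _) Subtype.val_injective).2 halg)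
  have hpow : LinearIndependent k fun i : Fin (2 * M + 1) => gen ^ (i : ℕ) := by
    have h1 := (basisMonomials k).linearIndependent.map' (aeval gen).toLinearMap
      (LinearMap.ker_eq_bot.2 (transcendental_iff_injective.1 hgen))
    have h2 := h1.comp (fun i : Fin (2 * M + 1) => (i : ℕ)) Fin.val_injective
    have h3 : (fun i : Fin (2 * M + 1) => gen ^ (i : ℕ)) =
        ((aeval gen).toLinearMap ∘ basisMonomials k) ∘ fun i : Fin (2 * M + 1) => (i : ℕ) := by
      funext i
      simp
    rw [h3]
    exact h2
  have hfam := linearIndependent_smul hpow hind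
  have hmem : ∀ q : Fin (2 * M + 1) × Fin D,
      gen ^ (q.1 : ℕ) • (w • ⇑b) q.2 ∈ poleSpace P h (3 * M) := by
    rintro ⟨i, j⟩
    have e : gen ^ (i : ℕ) • (w • ⇑b) j = h ^ (i : ℕ) * (y j • b j) := rfl
    have hj := mem_poleSpace.1 (hN j _ (hNM j))
    rw [mem_poleSpace, e]
    refine ⟨fun Q hQ => ?_, ?_⟩
    · rw [map_mul, map_pow]
      exact mul_le_one' (pow_le_one₀ zero_le (Q.mem_iff.1 (hreg Q hQ))) (hj.1 Q hQ)
    · rw [map_mul, map_pow]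
      calc _ ≤ P.val h ^ (2 * M) * P.val h ^ M :=
            mul_le_mul' (pow_le_pow_right₀ hP.le (by omega)) hj.2
        _ = _ := by rw [← pow_add]; congr 1; ring
  have hfin : Module.Finite k (poleSpace P h (3 * M)) :=
    Module.rank_lt_aleph0_iff.1 ((rank_poleSpace_le hK hP hst _).trans_lt (Cardinal.natCast_lt_aleph0))
  have hfam' : LinearIndependent k (fun q => (⟨_, hmem q⟩ : poleSpace P h (3 * M))) :=
    LinearIndependent.of_comp (poleSpace P h (3 * M)).subtype hfam
  have hcard := hfam'.fintype_card_le_finrank.trans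
    (Module.finrank_le_of_rank_le (rank_poleSpace_le hK hP hst (3 * M)))
  rw [Fintype.card_prod, Fintype.card_fin, Fintype.card_fin] at hcard
  by_contra! hD3
  have : (2 * M + 1) * 3 ≤ (2 * M + 1) * D := Nat.mul_le_mul_left _ hD3
  omega

end PoleSpace
end

noncomputable section

/-! ### Rational curves and quintic models of curves of genus two. -/

section Rational

variable {k K : Type*} [Field k] [Field K] [Algebra k K]

/-- The rational function field is the model `y² = x` with `x = h²`, `y = h`, of degree `2 · 0 + 1`.
-/
theorem curveGenus_eq_zero [IsAlgClosed k] (h2 : (2 : k) ≠ 0) {h : K} (hh : Transcendental k h)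
    (htop : IntermediateField.adjoin k {h} = ⊤) : curveGenus k K = 0 := by
  have hh2 : Transcendental k (h ^ 2) := fun halg => hh (IsAlgebraic.of_pow two_pos halg)
  have H : HyperellipticModel (X : k[X]) (h ^ 2) h := by
    refine ⟨(aeval_X _).symm, ?_⟩
    rw [eq_top_iff, ← htop]
    exact IntermediateField.adjoin.mono _ _ _ (by simp)
  exact H.curveGenus_eq (H.isCurveField hh2) h2 irreducible_X.squarefree (g := 0) natDegree_X

theorem fieldRange_ratFuncHom {h : K} (hh : Transcendental k h) :
    (ratFuncHom hh).fieldRange = IntermediateField.adjoin k {h} := by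
  rw [AlgHom.fieldRange_eq_map, ← RatFunc.adjoin_X_eq_top, IntermediateField.adjoin_map,
    Set.image_singleton, ratFuncHom_X]

theorem exists_ratFuncHom_eq {h z : K} (hh : Transcendental k h)
    (hz : z ∈ IntermediateField.adjoin k {h}) : ∃ w, ratFuncHom hh w = z := by
  rw [← fieldRange_ratFuncHom hh] at hz
  exact hz

theorem Polynomial.exists_eq_mul_sq {e : k[X]} (he : e ≠ 0) :
    ∃ d m : k[X], Squarefree d ∧ m ≠ 0 ∧ e = d * m ^ 2 := by
  induction hn : e.natDegree using Nat.strong_induction_on generalizing e with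
  | _ n ih =>
    by_cases hsq : Squarefree e
    · exact ⟨e, 1, hsq, one_ne_zero, by ring⟩
    · simp only [Squarefree, not_forall] at hsq
      obtain ⟨q, ⟨e', he'⟩, hu⟩ := hsq
      have hq0 : q ≠ 0 := by rintro rfl; simp [he'] at he
      have he'0 : e' ≠ 0 := by rintro rfl; simp [he'] at he
      have hq : q.natDegree ≠ 0 := fun h => hu (by
        rw [isUnit_iff_degree_eq_zero, degree_eq_natDegree hq0, h]; rfl)
      have hdeg := natDegree_mul (mul_ne_zero hq0 hq0) he'0
      rw [← he', natDegree_mul hq0 hq0] at hdeg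
      obtain ⟨d, m, hd, hm, hdm⟩ := ih e'.natDegree (by omega) he'0 rfl
      exact ⟨d, q * m, hd, mul_ne_zero hq0 hm, by rw [he', hdm]; ring⟩

/-- Quadratic extensions of `k(h)` are hyperelliptic. -/
theorem exists_hyperellipticModel (h2 : (2 : k) ≠ 0) {h : K} (hh : Transcendental k h)
    (hrank : Module.finrank (IntermediateField.adjoin k {h}) K = 2) :
    ∃ (d : k[X]) (y : K), HyperellipticModel d h y ∧ Squarefree d ∧
      y ∉ IntermediateField.adjoin k {h} := by
  set F := IntermediateField.adjoin k {h} with hF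
  have h2K : (2 : K) ≠ 0 := by
    have := (algebraMap k K).injective.ne h2
    rwa [map_ofNat, map_zero] at this
  obtain ⟨w, hw⟩ : ∃ w : K, w ∉ F := by
    by_contra! hall
    have : F = ⊤ := eq_top_iff.2 fun z _ => hall z
    rw [this, IntermediateField.finrank_top] at hrank
    omega
  have hind : LinearIndependent F ![(1 : K), w] := by
    rw [LinearIndependent.pair_iff]
    intro s t hst
    rw [Algebra.smul_def, Algebra.smul_def, mul_one] at hst
    have ht : t = 0 := by
      by_contra ht
      apply hw
      have ht' : (t : K) ≠ 0 := fun h0 => ht (Subtype.ext h0)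
      have : w = -(s : K) / t := by
        rw [eq_div_iff ht']
        have : (s : K) + t * w = 0 := hst
        linear_combination this
      rw [this]
      exact div_mem (neg_mem s.2) t.2
    rw [ht, map_zero, zero_mul, add_zero] at hst
    exact ⟨Subtype.ext hst, ht⟩
  have : FiniteDimensional F K := Module.finite_of_finrank_pos (by omega)
  have hspan := hind.span_eq_top_of_card_eq_finrank' (by rw [hrank]; rfl)
  have hrep : ∀ z : K, ∃ a b : F, z = a + b * w := by
    intro z
    have hz : z ∈ Submodule.span F (Set.range ![(1 : K), w]) := hspan ▸ Submodule.mem_top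
    rw [Matrix.range_cons, Matrix.range_cons, Matrix.range_empty, Set.union_empty,
      Set.singleton_union, Submodule.mem_span_pair] at hz
    obtain ⟨a, b, hab⟩ := hz
    refine ⟨a, b, ?_⟩
    rw [← hab, Algebra.smul_def, Algebra.smul_def, mul_one]
    rfl
  obtain ⟨a, b, hab⟩ := hrep (w ^ 2)
  have h2F : (2 : K) ∈ F := by
    have := F.algebraMap_mem 2
    rwa [map_ofNat] at this
  -- Completing the square in `w² = a + b w`.
  set v := w - b / 2 with hv
  have hv2 : v ^ 2 ∈ F := by
    have : v ^ 2 = a + (b / 2) ^ 2 := by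
      rw [hv]
      field_simp
      linear_combination 4 * hab
    rw [this]
    exact add_mem a.2 (pow_mem (div_mem b.2 h2F) 2)
  have hvF : v ∉ F := fun hmem => hw (by
    have := add_mem hmem (div_mem b.2 h2F)
    rwa [hv, sub_add_cancel] at this)
  obtain ⟨A, B, hAB⟩ := (IntermediateField.mem_adjoin_simple_iff k _).1 hv2
  have hv0 : v ≠ 0 := by
    intro h0
    exact hvF (h0 ▸ F.zero_mem)
  have hB0 : aeval h B ≠ 0 := by
    intro h0
    rw [h0, div_zero] at hAB
    exact hv0 (pow_eq_zero_iff two_ne_zero |>.1 hAB)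
  have hA0 : aeval h A ≠ 0 := by
    intro h0
    rw [h0, zero_div] at hAB
    exact hv0 (pow_eq_zero_iff two_ne_zero |>.1 hAB)
  obtain ⟨d, m, hd, hm, hdm⟩ := exists_eq_mul_sq (e := A * B) (by
    rintro h0
    have := congrArg (aeval h) h0
    rw [map_mul, map_zero] at this
    exact mul_ne_zero hA0 hB0 this)
  have hm0 : aeval h m ≠ 0 := fun h0 => hm (transcendental_iff.1 hh _ h0)
  have hmemF : ∀ C : k[X], aeval h C ∈ F := fun C =>
    IntermediateField.algebra_adjoin_le_adjoin _ _ (aeval_mem_adjoin_singleton k _)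
  -- With `v² = A / B` and `A B = d m²`, the square of `v B / m` is `d`.
  set y := v * aeval h B / aeval h m with hy
  have hvy : v = y * aeval h m / aeval h B := by
    rw [hy]; field_simp
  have hFle : F ≤ IntermediateField.adjoin k {h, y} := IntermediateField.adjoin.mono _ _ _ (by simp)
  refine ⟨d, y, ⟨?_, ?_⟩, hd, ?_⟩
  · have e := congrArg (aeval h) hdm
    rw [map_mul, map_mul, map_pow] at e
    rw [hy, div_pow, mul_pow, hAB, div_eq_iff (pow_ne_zero 2 hm0), ← e]
    field_simp
  · rw [eq_top_iff]
    intro z _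
    obtain ⟨a', b', rfl⟩ := hrep z
    have hyM : y ∈ IntermediateField.adjoin k {h, y} := IntermediateField.subset_adjoin _ _ (by simp)
    have hvM : v ∈ IntermediateField.adjoin k {h, y} := by
      rw [hvy]
      exact div_mem (mul_mem hyM (hFle (hmemF m))) (hFle (hmemF B))
    have hwM : w ∈ IntermediateField.adjoin k {h, y} := by
      have := add_mem hvM (hFle (div_mem b.2 h2F))
      rwa [hv, sub_add_cancel] at this
    exact add_mem (hFle a'.2) (mul_mem (hFle b'.2) hwM)
  · intro hyF
    apply hvF
    rw [hvy]
    exact div_mem (mul_mem hyF (hmemF m)) (hmemF B)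

theorem CurvePoint.comap_eq_of_pole {h : K} {P : CurvePoint k K}
    (hreg : ∀ Q : CurvePoint k K, Q ≠ P → h ∈ Q.ring) (hP : 1 < P.val h)
    {e : K ≃ₐ[k] K} (he : e h = h) : P.comap e = P := by
  by_contra hne
  have := hreg _ hne
  rw [CurvePoint.mem_iff, CurvePoint.val_comap_le_one, he] at this
  exact absurd this (not_le.2 hP)

variable [IsAlgClosed k]

/-- For even degree `2 n` the function `y / h ^ n` takes at `P` one of the two values `± b`, where
`b²` is the leading coefficient. The involution changes the sign but fixes `P`, the only pole of
`h`. -/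
theorem HyperellipticModel.odd_natDegree {d : k[X]} {h y : K} (H : HyperellipticModel d h y)
    (hh : Transcendental k h) (h2 : (2 : k) ≠ 0) (hd : Squarefree d)
    (hd1 : ¬ IsUnit d) {P : CurvePoint k K} (hreg : ∀ Q : CurvePoint k K, Q ≠ P → h ∈ Q.ring)
    (hP : 1 < P.val h) : Odd d.natDegree := by
  rw [← Nat.not_even_iff_odd]
  rintro ⟨n, hn⟩
  have hh0 : h ≠ 0 := by rintro rfl; simp at hP
  have H' := H.atInfinity hh0 (n := n) (by omega)
  obtain ⟨e, heh, hey⟩ := H.exists_involution hh hd hd1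
  have hinv : P.val (h⁻¹ - algebraMap k K 0) < 1 := by
    rw [map_zero, sub_zero, HyperellipticModel.val_inv_lt_iff hh0]; exact hP
  have h1 := P.val_aeval_sub_lt hinv (reflect (2 * n) d)
  rw [← coeff_zero_eq_eval_zero, coeff_reflect, revAt_le (Nat.zero_le _), Nat.sub_zero,
    show 2 * n = d.natDegree by omega, coeff_natDegree] at h1
  obtain ⟨b, hb⟩ := IsAlgClosed.exists_pow_nat_eq d.leadingCoeff two_pos
  have hb0 : b ≠ 0 := by
    rintro rfl
    rw [zero_pow two_ne_zero] at hb
    exact hd.ne_zero (leadingCoeff_eq_zero.1 hb.symm)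
  rw [← show 2 * n = d.natDegree by omega, ← H'.eq, ← hb, map_pow] at h1
  set z := y * h⁻¹ ^ n with hz
  have hez : e z = -z := by
    rw [hz, map_mul, map_pow, map_inv₀, heh, hey, neg_mul]
  have hcomap := CurvePoint.comap_eq_of_pole hreg hP heh
  have key : ∀ c : k, c ≠ 0 → ¬ P.val (z - algebraMap k K c) < 1 := by
    intro c hc hlt
    have h3 := hlt
    rw [← hcomap, CurvePoint.val_comap_lt_one, map_sub, hez, AlgEquiv.commutes] at h3
    have h4 := Valuation.map_add_lt _ hlt h3
    rw [show z - algebraMap k K c + (-z - algebraMap k K c) = algebraMap k K (-2 * c) by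
      simp only [map_mul, map_neg, map_ofNat]; ring,
      P.val_algebraMap (mul_ne_zero (neg_ne_zero.2 h2) hc)] at h4
    exact lt_irrefl _ h4
  rw [show z ^ 2 - algebraMap k K b ^ 2 =
    (z - algebraMap k K b) * (z - algebraMap k K (-b)) by rw [map_neg]; ring, map_mul] at h1
  exact absurd h1 (not_lt.2 (one_le_mul (not_lt.1 (key b hb0))
    (not_lt.1 (key (-b) (neg_ne_zero.2 hb0)))))

/-- A curve of genus two with a Weierstrass point `P` is given by an equation of degree five with
`P` at infinity. -/
theorem exists_quintic_model (h2 : (2 : k) ≠ 0) (hK : IsCurveField k K)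
    (hgenus : curveGenus k K = 2) {P : CurvePoint k K} (hW : P.IsWeierstrass) :
    ∃ (d : k[X]) (h y : K), HyperellipticModel d h y ∧ Transcendental k h ∧ Squarefree d ∧
      d.natDegree = 5 ∧ 1 < P.val h := by
  obtain ⟨h, hP, hreg, hst⟩ := hW
  rw [P.not_mem_iff] at hP
  have hh : Transcendental k h := by
    intro halg
    obtain ⟨c, rfl⟩ := IsCurveField.exists_eq_algebraMap_of_isAlgebraic halg
    exact absurd (P.val_algebraMap_le c) (not_le.2 hP)
  have hle := finrank_adjoin_le_two hK hP hreg hst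
  have := hK.isAlgebraic_adjoin hh
  have := hK.finitelyGenerated
  have : Algebra.EssFiniteType (IntermediateField.adjoin k {h}) K := .of_comp k _ K
  have : Module.Finite (IntermediateField.adjoin k {h}) K :=
    Algebra.finite_of_essFiniteType_of_isAlgebraic
  have hpos : 0 < Module.finrank (IntermediateField.adjoin k {h}) K := Module.finrank_pos
  -- Degree one would make the curve rational, of genus zero.
  have hne : Module.finrank (IntermediateField.adjoin k {h}) K ≠ 1 := by
    intro h1
    have := curveGenus_eq_zero h2 hh (IntermediateField.finrank_eq_one_iff_eq_top.1 h1)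
    omega
  obtain ⟨d, y, H, hd, hy⟩ := exists_hyperellipticModel h2 hh (by omega)
  have hd1 : ¬ IsUnit d := by
    intro hu
    obtain ⟨c, hc, rfl⟩ := isUnit_iff.1 hu
    have halg : IsAlgebraic k y := by
      refine IsAlgebraic.of_pow two_pos ?_
      rw [H.eq, aeval_C]
      exact isAlgebraic_algebraMap c
    obtain ⟨c', rfl⟩ := IsCurveField.exists_eq_algebraMap_of_isAlgebraic halg
    exact hy (algebraMap_mem _ c')
  obtain ⟨g, hg⟩ := H.odd_natDegree hh h2 hd hd1 hreg hP
  have := H.curveGenus_eq hK h2 hd hg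
  exact ⟨d, h, y, H, hh, hd, by omega, hP⟩

end Rational

/-! ### Points of the elliptic curve over `k(X)`. -/

section EllipticRational

variable {k : Type u} [Field k] [IsAlgClosed k] {lam : k}

/-- The elliptic curve has only constant points over the field of rational functions. -/
theorem isAlgebraic_of_legendre_ratFunc (h2 : (2 : k) ≠ 0) (h_zero : lam ≠ 0) (h_one : lam ≠ 1)
    {x y : RatFunc k} (h : y ^ 2 = aeval x (legendrePoly lam)) : IsAlgebraic k x := by
  by_contra hx
  obtain ⟨f, hfx, -⟩ := exists_legendreHom h_zero h_one hx h
  have hbot : f.fieldRange ≠ ⊥ := by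
    intro hb
    have hm : x ∈ f.fieldRange := ⟨_, hfx⟩
    rw [hb, IntermediateField.mem_bot] at hm
    obtain ⟨c, rfl⟩ := hm
    exact hx (isAlgebraic_algebraMap c)
  -- A non-constant point embeds the function field of `E` in `k(X)`. By Lüroth it is then rational,
  -- of genus zero, whereas the cubic model has genus one.
  have hgen := RatFunc.Luroth.transcendental_generator hbot
  have heq := RatFunc.Luroth.eq_adjoin_generator (E := f.fieldRange)
  obtain ⟨t, ht⟩ : RatFunc.Luroth.generator f.fieldRange ∈ f.fieldRange :=
    RatFunc.Luroth.generator_mem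
  have ht' : f t = RatFunc.Luroth.generator f.fieldRange := ht
  have htt : Transcendental k t := by
    rw [← ht'] at hgen
    exact fun halg => hgen ((isAlgebraic_algHom_iff f f.injective).2 halg)
  have htop : IntermediateField.adjoin k {t} = ⊤ := by
    rw [eq_top_iff]
    intro z _
    have hz : f z ∈ f.fieldRange := ⟨z, rfl⟩
    rw [heq, ← ht', ← Set.image_singleton, ← IntermediateField.adjoin_map] at hz
    obtain ⟨z', hz', hzz⟩ := hz
    rwa [← f.injective hzz]
  have h0 := curveGenus_eq_zero h2 htt htop
  have h1 := (legendre_model lam).curveGenus_eq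
    ((legendre_model lam).isCurveField (legendreX_transcendental lam)) h2
    (squarefree_legendrePoly h_zero h_one) (g := 1) natDegree_legendrePoly
  omega

end EllipticRational
end

noncomputable section

/-! ### The hyperelliptic involution lifts the inversion of `E`. -/

section Involution

variable {k K : Type*} [Field k] [Field K] [Algebra k K] {d : k[X]} {h y : K}

theorem AlgEquiv.apply_eq_of_mem_adjoin {e : K ≃ₐ[k] K} (heh : e h = h) {z : K}
    (hz : z ∈ IntermediateField.adjoin k {h}) : e z = z := by
  obtain ⟨A, B, rfl⟩ := (IntermediateField.mem_adjoin_simple_iff k _).1 hz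
  rw [map_div₀, ← aeval_algHom_apply, ← aeval_algHom_apply, heh]

theorem HyperellipticModel.mem_adjoin_of_fixed (H : HyperellipticModel d h y) (h2 : (2 : k) ≠ 0)
    (hy0 : y ≠ 0) {e : K ≃ₐ[k] K} (heh : e h = h) (hey : e y = -y) {z : K} (hz : e z = z) :
    z ∈ IntermediateField.adjoin k {h} := by
  obtain ⟨a, ha, b, hb, rfl⟩ := H.exists_eq_add_mul z
  rw [map_add, map_mul, AlgEquiv.apply_eq_of_mem_adjoin heh ha,
    AlgEquiv.apply_eq_of_mem_adjoin heh hb, hey] at hz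
  have h2K : (2 : K) ≠ 0 := by
    have := (algebraMap k K).injective.ne h2
    rwa [map_ofNat, map_zero] at this
  have : 2 * y * b = 0 := by linear_combination -hz
  rw [(mul_eq_zero.1 this).resolve_left (mul_ne_zero h2K hy0), zero_mul, add_zero]
  exact ha

theorem HyperellipticModel.exists_eq_mul_of_anti (H : HyperellipticModel d h y) (h2 : (2 : k) ≠ 0)
    {e : K ≃ₐ[k] K} (heh : e h = h) (hey : e y = -y) {z : K} (hz : e z = -z) :
    ∃ b ∈ IntermediateField.adjoin k {h}, z = b * y := by
  obtain ⟨a, ha, b, hb, rfl⟩ := H.exists_eq_add_mul z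
  rw [map_add, map_mul, AlgEquiv.apply_eq_of_mem_adjoin heh ha,
    AlgEquiv.apply_eq_of_mem_adjoin heh hb, hey] at hz
  have h2K : (2 : K) ≠ 0 := by
    have := (algebraMap k K).injective.ne h2
    rwa [map_ofNat, map_zero] at this
  have : 2 * a = 0 := by linear_combination hz
  rw [(mul_eq_zero.1 this).resolve_left h2K, zero_add]
  exact ⟨b, hb, rfl⟩

end Involution

section Invariance

variable {k : Type u} [Field k] {lam : k} {K : Type*} [Field K] [Algebra k K] {d : k[X]} {h y ξ η : K}

theorem aeval_legendrePoly (ξ : K) : aeval ξ (legendrePoly lam) =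
    ξ ^ 3 - (1 + algebraMap k K lam) * ξ ^ 2 + algebraMap k K lam * ξ := by
  simp only [legendrePoly, map_mul, map_sub, map_one, aeval_X, aeval_C]
  ring

/-- The third point on the line through two points of the curve. -/
theorem third_point {l ξ η ξ' η' m x₃ : K} (hne : ξ ≠ ξ')
    (h : η ^ 2 = ξ ^ 3 - (1 + l) * ξ ^ 2 + l * ξ)
    (h' : η' ^ 2 = ξ' ^ 3 - (1 + l) * ξ' ^ 2 + l * ξ') (hm : m * (ξ - ξ') = η - η')
    (hx : x₃ = m ^ 2 + 1 + l - ξ - ξ') :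
    (m * (x₃ - ξ) + η) ^ 2 = x₃ ^ 3 - (1 + l) * x₃ ^ 2 + l * x₃ := by
  apply mul_left_cancel₀ (sub_ne_zero.2 hne)
  have hη' : η' = η - m * (ξ - ξ') := by linear_combination hm
  subst hη' hx
  linear_combination (m ^ 2 + 1 + l - ξ - ξ' - ξ') * h - (m ^ 2 + 1 + l - ξ - ξ' - ξ) * h'

/-- A residual intersection with a line through a constant point has no pole where `ξ` has one. -/
theorem CurvePoint.val_residual_le (P : CurvePoint k K) {ξ' : K} {a b : k} (hP : 1 < P.val ξ)
    (heq : η ^ 2 = aeval ξ (legendrePoly lam))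
    (h : ξ' * (ξ - algebraMap k K a) ^ 2 = (η - algebraMap k K b) ^ 2 +
      (1 + algebraMap k K lam - ξ - algebraMap k K a) * (ξ - algebraMap k K a) ^ 2) :
    P.val ξ' ≤ 1 := by
  have hv0 : P.val ξ ≠ 0 := fun h0 => by simp [h0] at hP
  have hη : P.val η ≤ P.val ξ ^ 2 := by
    have h3 : P.val η ^ 2 = P.val ξ ^ 3 := by
      rw [← map_pow, heq, P.val_aeval_of_one_lt hP (by
        intro h0
        have := natDegree_legendrePoly (lam := lam)
        simp [h0] at this), natDegree_legendrePoly]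
    have h4 : P.val η ^ 2 ≤ (P.val ξ ^ 2) ^ 2 := by
      rw [h3, ← pow_mul]
      exact pow_le_pow_right₀ hP.le (by omega)
    exact (pow_le_pow_iff_left₀ zero_le zero_le two_ne_zero).1 h4
  have hξa : P.val (ξ - algebraMap k K a) = P.val ξ := by
    rw [Valuation.map_sub_eq_of_lt_left]
    exact (P.val_algebraMap_le a).trans_lt hP
  -- The equation of `E` cancels the cubic terms in `ξ`, so the right hand side grows at most like
  -- `ξ²`.
  have e : ξ' * (ξ - algebraMap k K a) ^ 2 = a • ξ ^ 2 +
      (lam + a ^ 2 - 2 * a * (1 + lam)) • ξ + (b ^ 2 + a ^ 2 * (1 + lam - a)) • (1 : K) +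
        (-2 * b) • η := by
    rw [aeval_legendrePoly] at heq
    simp only [Algebra.smul_def, map_add, map_sub, map_mul, map_pow, map_one, map_ofNat, map_neg]
    linear_combination h + heq
  have hmem : ξ' * (ξ - algebraMap k K a) ^ 2 ∈ P.valLE (P.val ξ ^ 2) := by
    have h1 : (1 : K) ∈ P.valLE (P.val ξ ^ 2) := by
      rw [CurvePoint.mem_valLE, map_one]; exact one_le_pow₀ hP.le
    have hξ : ξ ∈ P.valLE (P.val ξ ^ 2) := by
      rw [CurvePoint.mem_valLE]; exact le_self_pow₀ hP.le two_ne_zero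
    have hξ2 : ξ ^ 2 ∈ P.valLE (P.val ξ ^ 2) := by
      rw [CurvePoint.mem_valLE, map_pow]
    rw [e]
    exact add_mem (add_mem (add_mem (Submodule.smul_mem _ _ hξ2) (Submodule.smul_mem _ _ hξ))
      (Submodule.smul_mem _ _ h1)) (Submodule.smul_mem _ _ hη)
  rw [CurvePoint.mem_valLE, map_mul, map_pow, hξa] at hmem
  by_contra! hlt
  exact absurd hmem (not_le.2 (lt_mul_of_one_lt_left (zero_lt_iff.2 (pow_ne_zero 2 hv0)) hlt))

theorem isAlgebraic_of_mem_adjoin [IsAlgClosed k] (h2 : (2 : k) ≠ 0) (h_zero : lam ≠ 0)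
    (h_one : lam ≠ 1) (hh : Transcendental k h) (heq : η ^ 2 = aeval ξ (legendrePoly lam))
    (hξ : ξ ∈ IntermediateField.adjoin k {h}) (hη : η ∈ IntermediateField.adjoin k {h}) :
    IsAlgebraic k ξ := by
  obtain ⟨x, rfl⟩ := exists_ratFuncHom_eq hh hξ
  obtain ⟨y, rfl⟩ := exists_ratFuncHom_eq hh hη
  refine (isAlgebraic_of_legendre_ratFunc h2 h_zero h_one (y := y) ?_).algHom (ratFuncHom hh)
  refine (ratFuncHom hh).injective ?_
  change ratFuncHom hh (y ^ 2) = ratFuncHom hh _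
  rw [map_pow, heq, aeval_algHom_apply]

/-- The hyperelliptic involution lifts the inversion of the elliptic curve. -/
theorem involution_legendre [IsAlgClosed k] (h2 : (2 : k) ≠ 0) (h_zero : lam ≠ 0) (h_one : lam ≠ 1)
    (H : HyperellipticModel d h y) (hh : Transcendental k h) (hg : d.natDegree = 5)
    {e : K ≃ₐ[k] K} (heh : e h = h) (hey : e y = -y) {P : CurvePoint k K} (hP : 1 < P.val h)
    (hξ : Transcendental k ξ) (hPξ : 1 < P.val ξ) (heq : η ^ 2 = aeval ξ (legendrePoly lam)) :
    e ξ = ξ ∧ e η = -η := by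
  have hy0 : y ≠ 0 := H.y_ne_zero hh (by rintro rfl; simp at hg)
  have hee : ∀ z, e (e z) = z := by
    intro z
    have : e.toAlgHom.comp e.toAlgHom = AlgHom.id k K :=
      H.algHom_ext (by change e (e h) = h; rw [heh, heh])
        (by change e (e y) = y; rw [hey, map_neg, hey, neg_neg])
    exact DFunLike.congr_fun this z
  have hreg : ∀ Q : CurvePoint k K, Q ≠ P → h ∈ Q.ring := by
    intro Q hQ
    by_contra hm
    exact hQ (H.point_infinity_eq hh (g := 2) hg Q P (Q.not_mem_iff.1 hm) hP)
  have hcomap := CurvePoint.comap_eq_of_pole hreg hP heh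
  have heq' : e η ^ 2 = aeval (e ξ) (legendrePoly lam) := by
    rw [← map_pow, heq, aeval_algHom_apply]
  have hfix : e ξ = ξ := by
    -- Otherwise the line through `(ξ, η)` and its conjugate meets `E` in a third point that is
    -- invariant, hence defined over `k(h)` and constant. The conjugate of `ξ` is then a residual
    -- intersection with a line through a constant point, so it is regular at `P`. But `P` is fixed
    -- by the involution and is a pole of `ξ`.
    by_contra hne
    have hne' : ξ - e ξ ≠ 0 := sub_ne_zero.2 (Ne.symm hne)
    set m := (η - e η) / (ξ - e ξ) with hm
    have hem : e m = m := by
      rw [hm, map_div₀, map_sub, map_sub, hee, hee, ← neg_sub, ← neg_sub ξ, neg_div_neg_eq]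
    have hmul : m * (ξ - e ξ) = η - e η := div_mul_cancel₀ _ hne'
    set x₃ := m ^ 2 + 1 + algebraMap k K lam - ξ - e ξ with hx₃
    have hthird := third_point (Ne.symm hne) (heq.trans (aeval_legendrePoly ξ))
      (heq'.trans (aeval_legendrePoly _)) hmul hx₃
    rw [← aeval_legendrePoly] at hthird
    have hex : e x₃ = x₃ := by
      rw [hx₃]
      simp only [map_sub, map_add, map_pow, map_one, hem, hee, AlgEquiv.commutes]
      ring
    have hey₃ : e (m * (x₃ - ξ) + η) = m * (x₃ - ξ) + η := by
      rw [map_add, map_mul, map_sub, hem, hex]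
      linear_combination hmul
    have hxF := H.mem_adjoin_of_fixed h2 hy0 heh hey hex
    have hyF := H.mem_adjoin_of_fixed h2 hy0 heh hey hey₃
    have hxalg := isAlgebraic_of_mem_adjoin h2 h_zero h_one hh hthird hxF hyF
    obtain ⟨a, ha⟩ := IsCurveField.exists_eq_algebraMap_of_isAlgebraic hxalg
    have hyalg : IsAlgebraic k (m * (x₃ - ξ) + η) := by
      refine IsAlgebraic.of_pow two_pos ?_
      rw [hthird, ha, aeval_algebraMap_apply]
      exact isAlgebraic_algebraMap _
    obtain ⟨b, hb⟩ := IsCurveField.exists_eq_algebraMap_of_isAlgebraic hyalg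
    have hres := P.val_residual_le (ξ' := e ξ) (a := a) (b := b) hPξ heq (by
      rw [ha] at hb hx₃
      have h1 : η - algebraMap k K b = m * (ξ - algebraMap k K a) := by linear_combination hb
      rw [h1]
      linear_combination ((ξ - algebraMap k K a) ^ 2) * hx₃)
    rw [← CurvePoint.val_comap_le_one, hcomap] at hres
    exact absurd hres (not_le.2 hPξ)
  refine ⟨hfix, ?_⟩
  rw [hfix, ← heq] at heq'
  -- If `η` were invariant too, `(ξ, η)` would be a point over `k(h)`, and `ξ` would be constant.
  rcases sq_eq_sq_iff_eq_or_eq_neg.1 heq' with h1 | h1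
  · exact absurd (isAlgebraic_of_mem_adjoin h2 h_zero h_one hh heq
      (H.mem_adjoin_of_fixed h2 hy0 heh hey hfix) (H.mem_adjoin_of_fixed h2 hy0 heh hey h1)) hξ
  · exact h1

end Invariance
end

noncomputable section

/-! ### Odd multiplicities and squarefree parts. -/

section Factorization

variable {k : Type*} [Field k]

/-- The square of the reduced denominator of `γ` divides `d`, so the denominator is a unit. -/
theorem RatFunc.exists_eq_algebraMap_of_sq_mul {d F : k[X]} (hd : Squarefree d) {γ : RatFunc k}
    (h : γ ^ 2 * algebraMap k[X] (RatFunc k) d = algebraMap k[X] (RatFunc k) F) :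
    ∃ m : k[X], γ = algebraMap k[X] (RatFunc k) m := by
  have hden : algebraMap k[X] (RatFunc k) γ.denom ≠ 0 := by simpa using γ.denom_ne_zero
  have h1 : γ.num ^ 2 * d = F * γ.denom ^ 2 := by
    apply RatFunc.algebraMap_injective k
    rw [map_mul, map_mul, map_pow, map_pow, ← h]
    nth_rw 2 [← RatFunc.num_div_denom γ]
    field_simp
  have hdvd : γ.denom ^ 2 ∣ d := by
    have hc : IsCoprime (γ.denom ^ 2) (γ.num ^ 2) := (RatFunc.isCoprime_num_denom γ).symm.pow
    exact hc.dvd_of_dvd_mul_left ⟨F, by rw [h1]; ring⟩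
  have hu : IsUnit γ.denom := hd _ (by rwa [← pow_two])
  have h1' : γ.denom = 1 := (RatFunc.monic_denom γ).eq_one_of_isUnit hu
  refine ⟨γ.num, ?_⟩
  rw [← RatFunc.num_div_denom γ, h1', map_one, div_one, RatFunc.num_algebraMap]

/-- By coprimality the multiplicity in `A` is that in `d m²`, which is the multiplicity in `d`, zero
or one, plus an even number. -/
theorem Polynomial.odd_rootMultiplicity_iff [PerfectField k] {A A' d m : k[X]}
    (hF : A * A' = d * m ^ 2) (hc : IsCoprime A A') (hd : Squarefree d) (hA0 : A * A' ≠ 0) {a : k}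
    (ha : A.eval a = 0) : Odd (A.rootMultiplicity a) ↔ d.eval a = 0 := by
  classical
  have hA'a : A'.eval a ≠ 0 := by
    obtain ⟨u, v, huv⟩ := hc
    intro h0
    have := congrArg (eval a) huv
    simp [ha, h0] at this
  have h1 : A.rootMultiplicity a = (A * A').rootMultiplicity a := by
    rw [rootMultiplicity_mul hA0, rootMultiplicity_eq_zero (p := A') hA'a, add_zero]
  have hne : d * m ^ 2 ≠ 0 := hF ▸ hA0
  have h2 : (d * m ^ 2).rootMultiplicity a = d.rootMultiplicity a + 2 * m.rootMultiplicity a := by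
    have hm0 : m ≠ 0 := by rintro rfl; simp at hne
    rw [rootMultiplicity_mul hne, pow_two, rootMultiplicity_mul (mul_ne_zero hm0 hm0)]
    ring
  rw [h1, hF, h2]
  by_cases hda : d.eval a = 0
  · have hle := rootMultiplicity_le_one_of_separable (PerfectField.separable_iff_squarefree.2 hd) a
    have hpos := (rootMultiplicity_pos hd.ne_zero).2 hda
    have : d.rootMultiplicity a = 1 := by omega
    rw [this]
    exact ⟨fun _ => hda, fun _ => ⟨_, add_comm _ _⟩⟩
  · rw [rootMultiplicity_eq_zero (p := d) hda, zero_add]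
    exact ⟨fun h => absurd h (Nat.not_odd_iff_even.2 (even_two_mul _)), fun h => absurd h hda⟩

/-- A cubic polynomial with a single root of odd multiplicity. -/
theorem Polynomial.exists_eq_of_unique_odd [IsAlgClosed k] {A : k[X]} (hA : A.natDegree = 3)
    {S : Set k} (hS : S.encard = 1) (hodd : ∀ a, a ∈ S ↔ A.eval a = 0 ∧ Odd (A.rootMultiplicity a)) :
    ∃ c β α : k, c ≠ 0 ∧ A = C c * (X - C β) * (X - C α) ^ 2 := by
  classical
  have hA0 : A ≠ 0 := by rintro rfl; simp at hA
  obtain ⟨β, rfl⟩ := Set.encard_eq_one.1 hS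
  obtain ⟨hβ, -⟩ := (hodd β).1 rfl
  have hcard : A.roots.card = 3 := by rw [IsAlgClosed.card_roots_eq_natDegree, hA]
  have hβm : β ∈ A.roots := (mem_roots hA0).2 hβ
  obtain ⟨t, ht⟩ := Multiset.exists_cons_of_mem hβm
  have htc : t.card = 2 := by rw [ht, Multiset.card_cons] at hcard; omega
  obtain ⟨α, γ, rfl⟩ := Multiset.card_eq_two.1 htc
  have hprod := (IsAlgClosed.splits A).eq_prod_roots
  rw [ht] at hprod
  simp only [Multiset.insert_eq_cons, Multiset.map_cons, Multiset.map_singleton, Multiset.prod_cons,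
    Multiset.prod_singleton] at hprod
  have huniq : ∀ a, a ≠ β → a ∈ A.roots → Even (A.roots.count a) := by
    intro a haβ ha
    rw [← Nat.not_odd_iff_even, count_roots]
    intro ho
    exact haβ ((hodd a).2 ⟨(mem_roots hA0).1 ha, ho⟩)
  -- Besides `β` there are two more roots. If they were distinct, one of them would differ from `β`
  -- and have multiplicity one. Both may coincide with `β`.
  have hαγ : α = γ := by
    by_contra hne
    by_cases hαβ : α = β
    · have hγβ : γ ≠ β := fun h => hne (hαβ.trans h.symm)
      have := huniq γ hγβ (by rw [ht]; simp)
      rw [ht] at this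
      simp [hγβ, Ne.symm hne] at this
    · have := huniq α hαβ (by rw [ht]; simp)
      rw [ht] at this
      simp [hαβ, hne] at this
  refine ⟨A.leadingCoeff, β, α, leadingCoeff_ne_zero.2 hA0, ?_⟩
  rw [hprod]
  simp only [← hαγ, leadingCoeff_mul, leadingCoeff_C, leadingCoeff_X_sub_C, mul_one]
  ring

end Factorization

/-! ### Weierstrass points in the fibres of a rational function of `h`. -/

section Fibers

variable {k K : Type*} [Field k] [Field K] [Algebra k K] {d r s : k[X]} {h y : K}

theorem exists_point_choice (hh : Transcendental k h) :
    ∃ pt : k → CurvePoint k K, (∀ a, (pt a).val (h - algebraMap k K a) < 1) ∧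
      Function.Injective pt := by
  choose pt hpt using fun a => exists_val_sub_lt (K := K) hh a
  refine ⟨pt, hpt, fun a b hab => ?_⟩
  have h := hpt b
  rw [← hab] at h
  exact (pt a).eq_of_sub_lt (hpt a) h

theorem CurvePoint.one_lt_val_div (P : CurvePoint k K) (hc : IsCoprime r s) (hs : s ≠ 0)
    (hh : Transcendental k h) {a : k} (ha : P.val (h - algebraMap k K a) < 1)
    (hsa : s.eval a = 0) : 1 < P.val (aeval h r / aeval h s) := by
  have hra : r.eval a ≠ 0 := by
    obtain ⟨u, v, huv⟩ := hc
    intro h0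
    have := congrArg (eval a) huv
    simp [hsa, h0] at this
  have h1 := P.val_div_sub_lt ha (A := s) hra
  rw [hsa, zero_div, map_zero, sub_zero, ← inv_div] at h1
  have hr0 : r ≠ 0 := by rintro rfl; simp at hra
  rwa [HyperellipticModel.val_inv_lt_iff] at h1
  exact div_ne_zero (fun h0 => hr0 (transcendental_iff.1 hh _ h0))
    (fun h0 => hs (transcendental_iff.1 hh _ h0))

theorem CurvePoint.one_lt_val_div_iff_of_pole (P : CurvePoint k K) (hr : r ≠ 0) (hs : s ≠ 0)
    (hP : 1 < P.val h) :
    1 < P.val (aeval h r / aeval h s) ↔ s.natDegree < r.natDegree := by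
  have hv : 0 < P.val h := zero_lt_one.trans hP
  rw [map_div₀, P.val_aeval_of_one_lt hP hr, P.val_aeval_of_one_lt hP hs,
    one_lt_div₀ (pow_pos hv _), pow_lt_pow_iff_right₀ hP]

variable [IsAlgClosed k]

/-- The point at infinity is a pole by the inequality of degrees, so only the roots of `d`
contribute to a finite fibre. -/
theorem HyperellipticModel.encard_fiber (H : HyperellipticModel d h y) (hK : IsCurveField k K)
    (h2 : (2 : k) ≠ 0) (hd : Squarefree d) (hg : d.natDegree = 5) (hc : IsCoprime r s)
    (hs : s ≠ 0) (hrs : s.natDegree < r.natDegree) (e : k) :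
    {P : CurvePoint k K | P.IsWeierstrass ∧
      P.val (aeval h r / aeval h s - algebraMap k K e) < 1}.encard =
      {a | d.eval a = 0 ∧ (r - C e * s).eval a = 0}.encard := by
  have hh := H.transcendental hK
  have hr : r ≠ 0 := by rintro rfl; simp at hrs
  obtain ⟨pt, hpt, hinj⟩ := exists_point_choice (K := K) hh
  rw [← hinj.encard_image]
  congr 1
  ext P
  constructor
  · rintro ⟨hW, hv⟩
    rcases (H.isWeierstrass_iff hK h2 hd hg P).1 hW with hP | ⟨a, hda, ha⟩
    · exact absurd hv (CurvePoint.not_val_sub_lt ((P.one_lt_val_div_iff_of_pole hr hs hP).2 hrs) _)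
    · have hsa : s.eval a ≠ 0 := fun h0 =>
        absurd hv (CurvePoint.not_val_sub_lt (P.one_lt_val_div hc hs hh ha h0) _)
      have := P.eq_of_sub_lt (P.val_div_sub_lt ha (A := r) hsa) hv
      refine ⟨a, ⟨hda, ?_⟩, H.branch_point_eq hh h2 hd hda (hpt a) ha⟩
      rw [eval_sub, eval_mul, eval_C, ← this, div_mul_cancel₀ _ hsa, sub_self]
  · rintro ⟨a, ⟨hda, hra⟩, rfl⟩
    refine ⟨H.isWeierstrass_of_root hh h2 hd _ hda (hpt a), ?_⟩
    rw [eval_sub, eval_mul, eval_C, sub_eq_zero] at hra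
    have hsa : s.eval a ≠ 0 := by
      intro h0
      obtain ⟨u, v, huv⟩ := hc
      rw [h0, mul_zero] at hra
      have := congrArg (eval a) huv
      simp [hra, h0] at this
    have := (pt a).val_div_sub_lt (hpt a) (A := r) hsa
    rwa [hra, mul_div_cancel_right₀ _ hsa] at this

/-- The additional one is the Weierstrass point at infinity. -/
theorem HyperellipticModel.encard_pole_fiber (H : HyperellipticModel d h y) (hK : IsCurveField k K)
    (h2 : (2 : k) ≠ 0) (hd : Squarefree d) (hg : d.natDegree = 5) (hc : IsCoprime r s)
    (hs : s ≠ 0) (hrs : s.natDegree < r.natDegree) :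
    {P : CurvePoint k K | P.IsWeierstrass ∧ 1 < P.val (aeval h r / aeval h s)}.encard =
      {a | d.eval a = 0 ∧ s.eval a = 0}.encard + 1 := by
  have hh := H.transcendental hK
  have hr : r ≠ 0 := by rintro rfl; simp at hrs
  obtain ⟨pt, hpt, hinj⟩ := exists_point_choice (K := K) hh
  obtain ⟨Q, hQ⟩ := exists_pole (K := K) hh
  rw [Q.not_mem_iff] at hQ
  rw [← hinj.encard_image, ← Set.encard_insert_of_notMem (a := Q)]
  · congr 1
    ext P
    constructor
    · rintro ⟨hW, hv⟩
      rcases (H.isWeierstrass_iff hK h2 hd hg P).1 hW with hP | ⟨a, hda, ha⟩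
      · exact Or.inl (H.point_infinity_eq hh (g := 2) hg P Q hP hQ)
      · refine Or.inr ⟨a, ⟨hda, ?_⟩, H.branch_point_eq hh h2 hd hda (hpt a) ha⟩
        by_contra hsa
        exact absurd (P.val_div_sub_lt ha (A := r) hsa) (CurvePoint.not_val_sub_lt hv _)
    · rintro (rfl | ⟨a, ⟨hda, hsa⟩, rfl⟩)
      · exact ⟨H.isWeierstrass_infinity hh (g := 2) hg _ hQ,
          (CurvePoint.one_lt_val_div_iff_of_pole _ hr hs hQ).2 hrs⟩
      · exact ⟨H.isWeierstrass_of_root hh h2 hd _ hda (hpt a),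
          (pt a).one_lt_val_div hc hs hh (hpt a) hsa⟩
  · rintro ⟨a, -, rfl⟩
    exact absurd (hpt a) (CurvePoint.not_val_sub_lt hQ _)

end Fibers
end

noncomputable section

/-! ### The map between the quotients and its fibres. -/

section NormalForm

variable {k : Type u} [Field k] [IsAlgClosed k] {lam : k} {K : Type*} [Field K] [Algebra k K]

/-- The pull-back of the coordinate `x` as a rational function on the quotient of the curve by the
hyperelliptic involution. -/
theorem exists_quotient_function (h2 : (2 : k) ≠ 0) (h_zero : lam ≠ 0) (h_one : lam ≠ 1)
    (hK : IsCurveField k K) (hgenus : curveGenus k K = 2) (f : CurveCover k (LegendreField lam) K)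
    (hdeg : f.degree = 3) (hn : f.IsNormalized lam) :
    ∃ (d : k[X]) (h y : K) (r s : k[X]) (β : RatFunc k) (hh : Transcendental k h),
      HyperellipticModel d h y ∧ Squarefree d ∧ d.natDegree = 5 ∧ IsCoprime r s ∧ s ≠ 0 ∧
      r.natDegree = 3 ∧ s.natDegree < 3 ∧
      f.pullback (legendreX lam) = aeval h r / aeval h s ∧
      f.pullback (legendreY lam) = ratFuncHom hh β * y := by
  have hpole := hn.encard_pole
  -- The quintic model is built with one of the three Weierstrass points over the origin of `E` at
  -- infinity, so that the numerator has larger degree than the denominator.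
  obtain ⟨P, hW, hPξ⟩ := Set.nonempty_of_encard_ne_zero (by rw [hpole]; norm_num)
  obtain ⟨d, h, y, H, hh, hd, hg, hP⟩ := exists_quintic_model h2 hK hgenus hW
  have hd1 : ¬ IsUnit d := fun hu => by rw [natDegree_eq_zero_of_isUnit hu] at hg; omega
  obtain ⟨e, heh, hey⟩ := H.exists_involution hh hd hd1
  have hy0 : y ≠ 0 := H.y_ne_zero hh hd.ne_zero
  have hξ : Transcendental k (f.pullback (legendreX lam)) := fun halg =>
    legendreX_transcendental lam ((isAlgebraic_algHom_iff f.pullback f.pullback.injective).1 halg)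
  have heq : f.pullback (legendreY lam) ^ 2 =
      aeval (f.pullback (legendreX lam)) (legendrePoly lam) := by
    rw [← map_pow, (legendre_model lam).eq, aeval_algHom_apply]
  obtain ⟨heξ, heη⟩ := involution_legendre h2 h_zero h_one H hh hg heh hey hP hξ hPξ heq
  obtain ⟨w, hw⟩ := exists_ratFuncHom_eq hh (H.mem_adjoin_of_fixed h2 hy0 heh hey heξ)
  obtain ⟨b, hb, hη⟩ := H.exists_eq_mul_of_anti h2 heh hey heη
  obtain ⟨β, rfl⟩ := exists_ratFuncHom_eq hh hb
  have hwt : Transcendental k w := fun halg => hξ (hw ▸ halg.algHom (ratFuncHom hh))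
  have hfrac : f.pullback (legendreX lam) = aeval h w.num / aeval h w.denom := by
    rw [← hw]
    conv_lhs => rw [← RatFunc.num_div_denom w]
    rw [map_div₀, ratFuncHom_algebraMap, ratFuncHom_algebraMap]
  have hdeg3 : max w.num.natDegree w.denom.natDegree = 3 := by
    have hcomp : f.pullback.comp (ratFuncHom (legendreX_transcendental lam)) =
        (ratFuncHom hh).comp (ratFuncHom hwt) := by
      apply ratFunc_algHom_ext
      rw [AlgHom.comp_apply, AlgHom.comp_apply, ratFuncHom_X, ratFuncHom_X, hw]
    have h1 := homDegree_comp (ratFuncHom (legendreX_transcendental lam)) f.pullback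
    have h3 : homDegree f.pullback = 3 := hdeg
    rw [hcomp, homDegree_comp, homDegree_legendreX h_zero h_one, H.homDegree_eq_two hh hd hd1, h3,
      homDegree_ratFunc, ratFuncHom_X] at h1
    omega
  have hnum : w.num ≠ 0 := by
    intro h0
    rw [h0, map_zero, zero_div] at hfrac
    exact hξ (hfrac ▸ isAlgebraic_zero)
  have hlt := (P.one_lt_val_div_iff_of_pole hnum w.denom_ne_zero hP).1 (hfrac ▸ hPξ)
  exact ⟨d, h, y, w.num, w.denom, β, hh, H, hd, hg, RatFunc.isCoprime_num_denom w, w.denom_ne_zero,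
    by omega, by omega, hfrac, hη⟩

/-- The branching of the quotient of the cover by the involutions. -/
theorem exists_normal_form (h2 : (2 : k) ≠ 0) (h_zero : lam ≠ 0) (h_one : lam ≠ 1)
    (hK : IsCurveField k K) (hgenus : curveGenus k K = 2) (f : CurveCover k (LegendreField lam) K)
    (hdeg : f.degree = 3) (hn : f.IsNormalized lam) :
    ∃ (h : K) (r s : k[X]), Transcendental k h ∧ IsCoprime r s ∧
      f.pullback (legendreX lam) = aeval h r / aeval h s ∧
      IntermediateField.adjoin k {h, f.pullback (legendreY lam)} = ⊤ ∧
      (∃ c a₁ a₂, c ≠ 0 ∧ a₁ ≠ a₂ ∧ s = C c * (X - C a₁) * (X - C a₂)) ∧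
      ∀ e, (legendrePoly lam).eval e = 0 →
        ∃ c β α, c ≠ 0 ∧ r - C e * s = C c * (X - C β) * (X - C α) ^ 2 := by
  obtain ⟨d, h, y, r, s, β, hh, H, hd, hg, hc, hs, hr3, hs3, hξ, hη⟩ :=
    exists_quotient_function h2 h_zero h_one hK hgenus f hdeg hn
  have hsA : algebraMap k[X] (RatFunc k) s ≠ 0 := by simpa using hs
  have hsK : aeval h s ≠ 0 := fun h0 => hs (transcendental_iff.1 hh _ h0)
  have heq : f.pullback (legendreY lam) ^ 2 =
      aeval (f.pullback (legendreX lam)) (legendrePoly lam) := by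
    rw [← map_pow, (legendre_model lam).eq, aeval_algHom_apply]
  -- The equation of `E` at `ξ = r / s`, `η = β y`, multiplied by `s⁴`: up to a square, `d` is the
  -- product of the four members of the pencil.
  have hF : (β * algebraMap k[X] (RatFunc k) s ^ 2) ^ 2 * algebraMap k[X] (RatFunc k) d =
      algebraMap k[X] (RatFunc k) (r * (r - s) * (r - C lam * s) * s) := by
    apply (ratFuncHom hh).toRingHom.injective
    change ratFuncHom hh _ = ratFuncHom hh _
    simp only [map_mul, map_pow, map_sub, ratFuncHom_algebraMap, aeval_C]
    rw [hη, hξ, mul_pow, H.eq, aeval_legendrePoly] at heq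
    field_simp at heq
    linear_combination (aeval h s) * heq
  obtain ⟨m, hm⟩ := RatFunc.exists_eq_algebraMap_of_sq_mul hd hF
  rw [hm, ← map_pow, ← map_mul] at hF
  have hF' := RatFunc.algebraMap_injective k hF
  have hr0 : r ≠ 0 := by rintro rfl; simp at hr3
  have hqdeg : ∀ e, (r - C e * s).natDegree = 3 := by
    intro e
    rw [natDegree_sub_eq_left_of_natDegree_lt ((natDegree_C_mul_le _ _).trans_lt (by omega)), hr3]
  have hq0 : ∀ e, r - C e * s ≠ 0 := fun e h0 => by
    have := hqdeg e
    rw [h0] at this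
    simp at this
  have hF0 : r * (r - s) * (r - C lam * s) * s ≠ 0 := by
    refine mul_ne_zero (mul_ne_zero (mul_ne_zero hr0 ?_) (hq0 _)) hs
    simpa using hq0 1
  refine ⟨h, r, s, hh, hc, hξ, ?_, ?_, ?_⟩
  · have hβ0 : ratFuncHom hh β ≠ 0 := by
      intro h0
      have hz : β = 0 := by simpa using h0
      rw [hz, zero_mul] at hm
      have hm0 : m = 0 := by simpa using hm.symm
      rw [hm0] at hF'
      exact hF0 (by rw [← hF']; ring)
    rw [eq_top_iff, ← H.adjoin_eq_top, IntermediateField.adjoin_le_iff]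
    have hle : IntermediateField.adjoin k {h} ≤
        IntermediateField.adjoin k {h, f.pullback (legendreY lam)} :=
      IntermediateField.adjoin.mono _ _ _ (by simp)
    rintro z (hz | hz)
    · rw [hz]; exact IntermediateField.subset_adjoin _ _ (by simp)
    · rw [Set.mem_singleton_iff.1 hz]
      have : y = f.pullback (legendreY lam) / ratFuncHom hh β := by
        rw [hη, mul_div_cancel_left₀ _ hβ0]
      rw [this]
      refine div_mem (IntermediateField.subset_adjoin _ _ (by simp)) (hle ?_)
      rw [← fieldRange_ratFuncHom hh]
      exact ⟨β, rfl⟩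
  -- Two of the three Weierstrass points over `∞` are affine and give two roots of `s`, whose degree
  -- is at most two.
  · have hp := hn.encard_pole
    rw [hξ, H.encard_pole_fiber hK h2 hd hg hc hs (by omega)] at hp
    have h2' : {a | d.eval a = 0 ∧ s.eval a = 0}.encard = 2 := by
      have h3 : (3 : ℕ∞) = 2 + 1 := by norm_num
      rw [h3] at hp
      exact WithTop.add_right_cancel ENat.one_ne_top hp
    obtain ⟨a₁, a₂, hne, hset⟩ := Set.encard_eq_two.1 h2'
    have h1 : s.eval a₁ = 0 := (hset ▸ (Or.inl rfl : a₁ ∈ ({a₁, a₂} : Set k)) :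
      a₁ ∈ {a | d.eval a = 0 ∧ s.eval a = 0}).2
    have h2 : s.eval a₂ = 0 := (hset ▸ (Or.inr rfl : a₂ ∈ ({a₁, a₂} : Set k)) :
      a₂ ∈ {a | d.eval a = 0 ∧ s.eval a = 0}).2
    have hdvd : (X - C a₁) * (X - C a₂) ∣ s :=
      (isCoprime_X_sub_C_of_isUnit_sub (sub_ne_zero.2 hne).isUnit).mul_dvd
        (dvd_iff_isRoot.2 h1) (dvd_iff_isRoot.2 h2)
    obtain ⟨t, ht⟩ := hdvd
    have ht0 : t ≠ 0 := by rintro rfl; simp [ht] at hs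
    have htd : t.natDegree = 0 := by
      have := natDegree_mul (mul_ne_zero (X_sub_C_ne_zero a₁) (X_sub_C_ne_zero a₂)) ht0
      rw [← ht, natDegree_mul (X_sub_C_ne_zero a₁) (X_sub_C_ne_zero a₂), natDegree_X_sub_C,
        natDegree_X_sub_C] at this
      omega
    rw [natDegree_eq_zero] at htd
    obtain ⟨c, rfl⟩ := htd
    exact ⟨c, a₁, a₂, by simpa using ht0, hne, by rw [ht]; ring⟩
  · intro e he
    -- The roots of odd multiplicity of `r - e s` are its common roots with `d`, and there is
    -- exactly one.
    have hp := hn.encard_root h2 h_zero h_one he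
    rw [hξ, H.encard_fiber hK h2 hd hg hc hs (by omega)] at hp
    refine exists_eq_of_unique_odd (hqdeg e) hp fun a => ?_
    suffices hodd : (r - C e * s).eval a = 0 →
        (Odd ((r - C e * s).rootMultiplicity a) ↔ d.eval a = 0) by
      constructor
      · rintro ⟨h1, h2⟩
        exact ⟨h2, (hodd h2).2 h1⟩
      · rintro ⟨h1, h2⟩
        exact ⟨(hodd h1).1 h2, h1⟩
    intro ha
    have c0 := hc
    have c1 : IsCoprime (r - s) s := by simpa using hc.sub_C_mul_left 1
    have cl := hc.sub_C_mul_left lam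
    have c01 : IsCoprime r (r - s) := by simpa using hc.sub_C_mul zero_ne_one
    have c0l : IsCoprime r (r - C lam * s) := by simpa using hc.sub_C_mul h_zero.symm
    have c1l : IsCoprime (r - s) (r - C lam * s) := by simpa using hc.sub_C_mul h_one.symm
    rcases eval_legendrePoly.1 he with rfl | rfl | rfl
    · refine odd_rootMultiplicity_iff (A' := (r - s) * (r - C lam * s) * s) (m := m) ?_ ?_ hd ?_ ha
      · rw [C_0, zero_mul, sub_zero, mul_comm d, hF']; ring
      · rw [C_0, zero_mul, sub_zero]
        exact (c01.mul_right c0l).mul_right c0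
      · rw [C_0, zero_mul, sub_zero]
        convert hF0 using 1; ring
    · refine odd_rootMultiplicity_iff (A' := r * (r - C lam * s) * s) (m := m) ?_ ?_ hd ?_ ha
      · rw [C_1, one_mul, mul_comm d, hF']; ring
      · rw [C_1, one_mul]
        exact (c01.symm.mul_right c1l).mul_right c1
      · rw [C_1, one_mul]
        convert hF0 using 1; ring
    · refine odd_rootMultiplicity_iff (A' := r * (r - s) * s) (m := m) ?_ ?_ hd ?_ ha
      · rw [mul_comm d, hF']; ring
      · exact (c0l.symm.mul_right c1l.symm).mul_right cl
      · convert hF0 using 1; ring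

end NormalForm
end

noncomputable section

/-! ### Moving the ramification points to `0`, `1`, `∞`. -/

section Parameter

theorem squarefree_of_natDegree_le_one {k : Type*} [Field k] {f : k[X]} (h0 : f ≠ 0)
    (h1 : f.natDegree ≤ 1) : Squarefree f := by
  rintro q ⟨r, rfl⟩
  have hq0 : q ≠ 0 := by rintro rfl; simp at h0
  have hr0 : r ≠ 0 := by rintro rfl; simp at h0
  rw [natDegree_mul (mul_ne_zero hq0 hq0) hr0, natDegree_mul hq0 hq0] at h1
  rw [isUnit_iff_degree_eq_zero, degree_eq_natDegree hq0]
  simp only [Nat.cast_eq_zero]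
  omega

theorem IsCoprime.eval_ne_zero_of_eval_eq_zero {k : Type*} [Field k] {f g : k[X]}
    (h : IsCoprime f g) {a : k} (ha : f.eval a = 0) : g.eval a ≠ 0 := by
  intro hb
  obtain ⟨u, v, huv⟩ := h
  have := congrArg (eval a) huv
  simp [ha, hb] at this

variable {k : Type*} [Field k] {lam : k} {K : Type*} [Field K] [Algebra k K]

/-- A rational function of degree three with the ramification of the covers in `𝒰` over `0`, `1`,
`lam` and `∞` is brought into the form `uFun` by a linear fractional change of the coordinate. -/
theorem exists_goodParameter_of_pencil (h_zero : lam ≠ 0) (h_one : lam ≠ 1) {h : K}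
    (hh : Transcendental k h) {r s : k[X]} (hrs : IsCoprime r s)
    (hs : ∃ c a₁ a₂, c ≠ 0 ∧ a₁ ≠ a₂ ∧ s = C c * (X - C a₁) * (X - C a₂))
    (hr : ∀ e, (legendrePoly lam).eval e = 0 →
      ∃ c β α, c ≠ 0 ∧ r - C e * s = C c * (X - C β) * (X - C α) ^ 2) :
    ∃ (p : k) (x : K), GoodParameter lam p ∧ Transcendental k x ∧
      aeval h r / aeval h s = aeval x (uNum lam p) / aeval x (gPoly lam p) ∧
      h ∈ IntermediateField.adjoin k {x} := by
  obtain ⟨c, a₁, a₂, hc, ha, hs⟩ := hs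
  obtain ⟨c₀, β₀, α₀, hc₀, h₀⟩ := hr 0 (by simp [eval_legendrePoly])
  obtain ⟨c₁, β₁, α₁, hc₁, h₁⟩ := hr 1 (by simp [eval_legendrePoly])
  obtain ⟨c₂, β₂, α₂, hc₂, h₂⟩ := hr lam (by simp [eval_legendrePoly])
  have e0 : (r - C 0 * s).eval α₀ = 0 := by rw [h₀]; simp
  have e0' : (r - C 0 * s).eval β₀ = 0 := by rw [h₀]; simp
  have e1 : (r - C 1 * s).eval α₁ = 0 := by rw [h₁]; simp
  have e2 : (r - C lam * s).eval α₂ = 0 := by rw [h₂]; simp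
  have hs1 : s.eval a₁ = 0 := by rw [hs]; simp
  have hs2 : s.eval a₂ = 0 := by rw [hs]; simp
  have n10 : α₁ ≠ α₀ := fun h => (hrs.sub_C_mul zero_ne_one).eval_ne_zero_of_eval_eq_zero e0 (h ▸ e1)
  have n12 : α₁ ≠ α₂ := fun h =>
    (hrs.sub_C_mul h_one.symm).eval_ne_zero_of_eval_eq_zero e1 (h ▸ e2)
  have n02 : α₀ ≠ α₂ := fun h =>
    (hrs.sub_C_mul h_zero.symm).eval_ne_zero_of_eval_eq_zero e0 (h ▸ e2)
  have nβ2 : β₀ ≠ α₂ := fun h =>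
    (hrs.sub_C_mul h_zero.symm).eval_ne_zero_of_eval_eq_zero e0' (h ▸ e2)
  have hs0 := hrs.sub_C_mul_left 0
  have nα : ∀ a, s.eval a = 0 → α₀ ≠ a := fun a ha h =>
    hs0.eval_ne_zero_of_eval_eq_zero e0 (h ▸ ha)
  have nβ : ∀ a, s.eval a = 0 → β₀ ≠ a := fun a ha h =>
    hs0.eval_ne_zero_of_eval_eq_zero e0' (h ▸ ha)
  -- The coordinate `x = ρ (h - α₀) / (h - α₂)` takes the values `0`, `1`, `∞` at `α₀`, `α₁`, `α₂`.
  -- The inverse transformation is `h = N / L`.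
  obtain ⟨ρ, hρ⟩ : ∃ ρ, ρ = (α₁ - α₂) / (α₁ - α₀) := ⟨_, rfl⟩
  have hρ0 : ρ ≠ 0 := hρ ▸ div_ne_zero (sub_ne_zero.2 n12) (sub_ne_zero.2 n10)
  have hρ1 : ρ * (α₁ - α₀) = α₁ - α₂ := by rw [hρ, div_mul_cancel₀ _ (sub_ne_zero.2 n10)]
  clear hρ
  set L : k[X] := X - C ρ with hL
  set N : k[X] := C α₂ * X - C (ρ * α₀) with hN
  have hκ : ρ * (α₂ - α₀) ≠ 0 := mul_ne_zero hρ0 (sub_ne_zero.2 n02.symm)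
  have hNL : IsCoprime N L := by
    refine ⟨C (ρ * (α₂ - α₀))⁻¹, -C (α₂ * (ρ * (α₂ - α₀))⁻¹), ?_⟩
    have hκ' : C (ρ * (α₂ - α₀)) * C (ρ * (α₂ - α₀))⁻¹ = (1 : k[X]) := by
      rw [← C_mul, mul_inv_cancel₀ hκ, C_1]
    rw [hN, hL, C_mul (a := α₂)]
    generalize C (ρ * (α₂ - α₀))⁻¹ = z at hκ' ⊢
    simp only [map_mul, map_sub] at hκ' ⊢
    linear_combination hκ'
  have hM0 : N - C α₀ * L = C (α₂ - α₀) * X := by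
    rw [hN, hL]; simp only [map_mul, map_sub]; ring
  have hM1 : N - C α₁ * L = C (α₂ - α₁) * (X - C 1) := by
    have := congrArg (C (R := k)) hρ1
    rw [hN, hL]; simp only [map_mul, map_sub, map_one] at this ⊢
    linear_combination this
  have hM2 : N - C α₂ * L = C (ρ * (α₂ - α₀)) := by
    rw [hN, hL]; simp only [map_mul, map_sub]; ring
  have hdeg : ∀ a, (N - C a * L).natDegree ≤ 1 := fun a => by
    rw [hN, hL]; compute_degree
  obtain ⟨x, hx⟩ : ∃ x, x = algebraMap k K ρ * (h - algebraMap k K α₀) /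
    (h - algebraMap k K α₂) := ⟨_, rfl⟩
  have hh2 := HyperellipticModel.sub_algebraMap_ne_zero hh α₂
  have hlx : aeval x L * (h - algebraMap k K α₂) = algebraMap k K (ρ * (α₂ - α₀)) := by
    rw [hL, hx]
    simp only [map_sub, aeval_X, aeval_C, map_mul]
    field_simp
    ring
  have hl0 : aeval x L ≠ 0 := by
    intro h0
    rw [h0, zero_mul] at hlx
    exact hκ ((map_eq_zero _).1 hlx.symm)
  have hNx : aeval x N = h * aeval x L := by
    rw [hN, hL, hx]
    simp only [map_sub, aeval_X, aeval_C, map_mul]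
    field_simp
    ring
  have hMx : ∀ a, aeval x (N - C a * L) = (h - algebraMap k K a) * aeval x L := fun a => by
    rw [map_sub, map_mul, aeval_C, hNx]; ring
  have hmem : h ∈ IntermediateField.adjoin k {x} := by
    have hq : h = aeval x N / aeval x L := by rw [hNx, mul_div_cancel_right₀ _ hl0]
    rw [IntermediateField.mem_adjoin_simple_iff]
    exact ⟨N, L, hq⟩
  have htx : Transcendental k x := by
    intro hxa
    apply hh
    have := IntermediateField.isAlgebraic_adjoin_simple (K := k) hxa.isIntegral
    exact (IntermediateField.isAlgebraic_iff (x := (⟨h, hmem⟩ : IntermediateField.adjoin k {x}))).1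
      (this.isAlgebraic _)
  have hinj := transcendental_iff_injective.1 htx
  -- `R` and `S` are the cubic homogenizations of `r` and `s` at `(N, L)`. As `s` has degree two,
  -- `S` has the extra factor `L`, the root at the old infinity.
  set R : k[X] := C c₀ * (N - C β₀ * L) * (N - C α₀ * L) ^ 2 with hR
  set S : k[X] := C c * L * ((N - C a₁ * L) * (N - C a₂ * L)) with hS
  have hRx : aeval x R = aeval h r * aeval x L ^ 3 := by
    have := congrArg (aeval h) h₀
    rw [hR]
    simp only [map_mul, map_pow, hMx, aeval_C]
    simp only [map_mul, map_sub, map_zero, aeval_C, aeval_X, map_pow] at this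
    linear_combination (-aeval x L ^ 3) * this
  have hSx : aeval x S = aeval h s * aeval x L ^ 3 := by
    rw [hS, hs]
    simp only [map_mul, hMx, aeval_C, map_sub, aeval_X]
    ring
  have hpencil : ∀ e c' β α, r - C e * s = C c' * (X - C β) * (X - C α) ^ 2 →
      R - C e * S = C c' * (N - C β * L) * (N - C α * L) ^ 2 := fun e c' β α hE => by
    apply hinj
    have := congrArg (aeval h) hE
    simp only [map_mul, map_sub, aeval_C, aeval_X, map_pow] at this
    rw [map_sub, map_mul (aeval x) (C e), hRx, hSx]
    simp only [map_mul, map_pow, hMx, aeval_C]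
    linear_combination (aeval x L ^ 3) * this
  have hcop : IsCoprime R S := by
    have hCc : IsUnit (C c) := isUnit_C.2 hc.isUnit
    have hCc₀ : IsUnit (C c₀) := isUnit_C.2 hc₀.isUnit
    rw [hR, hS, mul_assoc (C c₀), mul_assoc (C c), isCoprime_mul_unit_left_left hCc₀,
      isCoprime_mul_unit_left_right hCc]
    have key : ∀ b, b ≠ a₁ → b ≠ a₂ →
        IsCoprime (N - C b * L) (L * ((N - C a₁ * L) * (N - C a₂ * L))) := fun b hb₁ hb₂ =>
      (hNL.sub_C_mul_left b).mul_right ((hNL.sub_C_mul hb₁).mul_right (hNL.sub_C_mul hb₂))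
    exact (key _ (nβ _ hs1) (nβ _ hs2)).mul_left (key _ (nα _ hs1) (nα _ hs2)).pow_left
  have hsqS : Squarefree S := by
    have hsq : ∀ a, Squarefree (N - C a * L) := fun a => by
      refine squarefree_of_natDegree_le_one ?_ (hdeg a)
      intro h0
      have := hMx a
      rw [h0, map_zero] at this
      exact mul_ne_zero (HyperellipticModel.sub_algebraMap_ne_zero hh a) hl0 this.symm
    have hCc : IsUnit (C c) := isUnit_C.2 hc.isUnit
    rw [hS, mul_assoc, squarefree_mul_iff, squarefree_mul_iff, squarefree_mul_iff]
    exact ⟨hCc.isRelPrime_left, hCc.squarefree,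
      ((hNL.sub_C_mul_left a₁).symm.mul_right (hNL.sub_C_mul_left a₂).symm).isRelPrime,
      (irreducible_X_sub_C _).squarefree, (hNL.sub_C_mul ha).isRelPrime, hsq _, hsq _⟩
  have hR' : R = C (c₀ * (α₂ - β₀) * (α₂ - α₀) ^ 2) * X ^ 3 +
      C (c₀ * (ρ * (β₀ - α₀)) * (α₂ - α₀) ^ 2) * X ^ 2 := by
    rw [hR, hM0, hN, hL]
    simp only [map_mul, map_sub, map_pow]
    ring
  obtain ⟨p, c', hc', hRp, hSp⟩ := exists_parameter (R := R) (S := S) h_zero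
    (by rw [hR']; compute_degree)
    (by
      rw [hR']
      simp only [coeff_add, coeff_C_mul, coeff_X_pow]
      simpa using ⟨⟨hc₀, sub_ne_zero.2 nβ2.symm⟩, sub_ne_zero.2 n02.symm⟩)
    (by rw [hR, hM0, mul_pow]; exact ⟨C c₀ * (N - C β₀ * L) * C (α₂ - α₀) ^ 2, by ring⟩)
    (by
      have := hpencil _ _ _ _ h₁
      rw [C_1, one_mul, hM1, mul_pow] at this
      exact ⟨C c₁ * (N - C β₁ * L) * C (α₂ - α₁) ^ 2, by rw [this]; ring⟩)
    (by
      rw [hpencil _ _ _ _ h₂, hM2, ← C_pow]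
      refine (natDegree_mul_C_le _ _).trans ((natDegree_C_mul_le _ _).trans (hdeg _)))
  have hCc' : IsUnit (C c') := isUnit_C.2 hc'.isUnit
  refine ⟨p, x, ⟨?_, ?_⟩, htx, ?_, hmem⟩
  · rwa [hRp, hSp, isCoprime_mul_unit_left_left hCc', isCoprime_mul_unit_left_right hCc'] at hcop
  · exact hsqS.squarefree_of_dvd ⟨C c', by rw [hSp]; ring⟩
  · have hl3 := pow_ne_zero 3 hl0
    rw [← mul_div_mul_right _ _ hl3, ← hRx, ← hSx, hRp, hSp, map_mul, map_mul, aeval_C,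
      mul_div_mul_left]
    simpa using hc'

end Parameter

/-! ### Surjectivity. -/

section Surjective

variable {k : Type u} [Field k] [IsAlgClosed k] {lam : k}

/-- Every normalized cover of genus two is given by the explicit formulas. -/
theorem NormalizedGenusTwoCover.exists_isExplicitCover (h2 : (2 : k) ≠ 0) (h_zero : lam ≠ 0)
    (h_one : lam ≠ 1) (f : NormalizedGenusTwoCover lam) :
    ∃ p, GoodParameter lam p ∧ IsExplicitCover lam p 1 f := by
  obtain ⟨h, r, s, hh, hrs, hX, htop, hs, hr⟩ := exists_normal_form h2 h_zero h_one f.isCurveField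
    f.genus_eq f.cover f.degree_eq f.isNormalized
  obtain ⟨p, x, hp, hx, hq, hmem⟩ := exists_goodParameter_of_pencil h_zero h_one hh hrs hs hr
  have hg := aeval_gPoly_ne_zero (lam := lam) (p := p) hx
  have hlK : algebraMap k f.K (lam * (lam - 1)) ≠ 0 :=
    (_root_.map_ne_zero _).2 (mul_ne_zero h_zero (sub_ne_zero.2 h_one))
  have hx0 : x ≠ 0 := by
    simpa using HyperellipticModel.sub_algebraMap_ne_zero hx 0
  have hx1 : x - 1 ≠ 0 := by
    simpa using HyperellipticModel.sub_algebraMap_ne_zero hx 1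
  set η := f.cover.pullback (legendreY lam) with hη
  -- The formula for the second coordinate of `f₊`, solved for `y`. The equation of `E` then becomes
  -- the equation of the sextic.
  obtain ⟨y, hy⟩ : ∃ y, y = η * aeval x (gPoly lam p) ^ 2 /
    (algebraMap k f.K (lam * (lam - 1)) * x * (x - 1)) := ⟨_, rfl⟩
  have hηy : η = algebraMap k f.K (lam * (lam - 1)) * y * x * (x - 1) / aeval x (gPoly lam p) ^ 2 := by
    rw [hy]; field_simp
  have hηeq : η ^ 2 = aeval (aeval x (uNum lam p) / aeval x (gPoly lam p)) (legendrePoly lam) := by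
    rw [← hq, ← hX, hη, ← map_pow, (legendre_model lam).eq, aeval_algHom_apply]
  refine ⟨p, hp, x, y, ?_, ?_, hX.trans hq, by rw [← hη, hηy]; simp⟩
  · rw [eq_top_iff, ← htop, IntermediateField.adjoin_le_iff]
    have hxm : x ∈ IntermediateField.adjoin k {x, y} :=
      IntermediateField.subset_adjoin _ _ (by simp)
    have hym : y ∈ IntermediateField.adjoin k {x, y} :=
      IntermediateField.subset_adjoin _ _ (by simp)
    rintro z (rfl | rfl)
    · exact IntermediateField.adjoin.mono k _ _ (by simp) hmem
    · have hgm : aeval x (gPoly lam p) ∈ IntermediateField.adjoin k {x, y} :=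
        by
        rw [show x = ((⟨x, hxm⟩ : IntermediateField.adjoin k {x, y}) : f.K) from rfl,
          IntermediateField.aeval_coe]
        exact SetLike.coe_mem _
      rw [hηy]
      exact div_mem (mul_mem (mul_mem (mul_mem (algebraMap_mem _ _) hym) hxm)
        (sub_mem hxm (one_mem _))) (pow_mem hgm 2)
  · have h1 := congrArg (aeval x) (uNum_sub_gPoly lam p)
    have h2 := congrArg (aeval x) (uNum_sub_lam_gPoly lam p)
    have h0 : aeval x (uNum lam p) = algebraMap k f.K lam * (x - algebraMap k f.K p) * x ^ 2 := by
      simp [uNum]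
    rw [legendrePoly, hηy] at hηeq
    have hD : (algebraMap k f.K (lam * (lam - 1)) * x * (x - 1)) ^ 2 ≠ 0 :=
      pow_ne_zero _ (mul_ne_zero (mul_ne_zero hlK hx0) hx1)
    apply mul_left_cancel₀ hD
    simp only [map_mul, map_sub, map_add, map_pow, map_one, aeval_X, aeval_C, sexticPoly,
      map_ofNat, h0] at h1 h2 hηeq ⊢
    generalize aeval x (gPoly lam p) = g at *
    generalize algebraMap k f.K lam = l at *
    generalize algebraMap k f.K p = q at *
    have e1 : l * (x - q) * x ^ 2 / g - 1 = (l - 1) * (x - 1) ^ 2 * (x - q + 2) / g := by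
      rw [← h1]; field_simp
    have e2 : l * (x - q) * x ^ 2 / g - l = l * (l - 1) * ((2 * q - 3) * x - q + 2) / g := by
      rw [← h2]; field_simp
    rw [e1, e2] at hηeq
    have e3 : (l * (l - 1) * x * (x - 1)) ^ 2 * y ^ 2 =
        (l * (l - 1) * y * x * (x - 1) / g ^ 2) ^ 2 * g ^ 4 := by field_simp
    rw [e3, hηeq]
    field_simp

end Surjective
end

noncomputable section

/-! ### Injectivity for isomorphism classes. -/

section Injective

variable {k : Type u} [Field k] [IsAlgClosed k] {lam p q : k}

/-- Isomorphic explicit covers have the same parameter. -/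
theorem IsExplicitCover.parameter_eq (h2 : (2 : k) ≠ 0) (h_zero : lam ≠ 0) (h_one : lam ≠ 1)
    (hp : GoodParameter lam p) (hq : GoodParameter lam q) {ε ε' : ℤˣ}
    {f f' : NormalizedGenusTwoCover lam} (hf : IsExplicitCover lam p ε f)
    (hf' : IsExplicitCover lam q ε' f') (hff : f ≈ f') : p = q := by
  obtain ⟨x, y, htop, heq, hX, -⟩ := hf
  obtain ⟨x', y', htop', heq', hX', -⟩ := hf'
  obtain ⟨e, he⟩ := hff
  have H : HyperellipticModel (sexticPoly lam p) x y := ⟨heq, htop⟩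
  -- The second model is transported by `e`, so that both live on the same field.
  have H' : HyperellipticModel (sexticPoly lam q) (e x') (e y') := by
    refine ⟨?_, ?_⟩
    · rw [← map_pow, heq', ← AlgEquiv.coe_toAlgHom, aeval_algHom_apply]
    · have h := congrArg (IntermediateField.map e.toAlgHom) htop'
      rw [IntermediateField.adjoin_map, ← AlgHom.fieldRange_eq_map] at h
      rw [Set.image_pair] at h
      exact h.trans (AlgHom.fieldRange_eq_top.2 e.surjective)
  refine parameter_eq_of_explicit h2 h_zero h_one hp hq H (H.transcendental f.isCurveField) H'
    (H'.transcendental f.isCurveField) ?_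
  have h := he (legendreX lam)
  rw [hX, hX', map_div₀, ← AlgEquiv.coe_toAlgHom, ← aeval_algHom_apply, ← aeval_algHom_apply] at h
  exact h

end Injective
end

/-! ### The bijection. -/

theorem proposition1p2 {k : Type u} [Field k] [IsAlgClosed k] (h2 : (2 : k) ≠ 0) (h3 : (3 : k) ≠ 0)
    (lam : k) (h_zero : lam ≠ 0) (h_one : lam ≠ 1) :
    ∃ χ : normalizedLineCovers lam → HurwitzSet lam, Function.Bijective χ ∧
      ∀ u : normalizedLineCovers lam,
        (∃ p : k, u.1.pullback RatFunc.X = uFun lam p) ∧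
        ∀ p : k, u.1.pullback RatFunc.X = uFun lam p → ∀ ε : ℤˣ,
          (∃ f, IsExplicitCover lam p ε f) ∧
          ∀ f, IsExplicitCover lam p ε f → χ u = Quotient.mk (hurwitzSetoid lam) f := by
  choose par hpar hgood using fun u : normalizedLineCovers lam => exists_goodParameter h_zero u.2
  choose F hF using fun u => exists_isExplicitCover h2 h_zero h_one (hgood u) 1
  -- The parameter is determined by `u`, so the chosen one agrees with any other.
  have hpar_eq : ∀ u p, u.1.pullback RatFunc.X = uFun lam p → p = par u := fun u p hu =>
    uFun_injective h2 h_zero h_one (hu.symm.trans (hpar u))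
  refine ⟨fun u => Quotient.mk (hurwitzSetoid lam) (F u), ⟨?_, ?_⟩, fun u => ⟨⟨_, hpar u⟩, ?_⟩⟩
  · intro u v huv
    have h := (hF u).parameter_eq h2 h_zero h_one (hgood u) (hgood v) (hF v) (Quotient.exact huv)
    apply Subtype.ext
    apply CurveCover.ext
    apply ratFunc_algHom_ext
    rw [hpar u, hpar v, h]
  · intro c
    induction c using Quotient.ind with
    | _ f =>
      obtain ⟨p, hp, hf⟩ := f.exists_isExplicitCover h2 h_zero h_one
      obtain ⟨φ, hφ, hX⟩ := hp.exists_cover h_zero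
      obtain rfl := hpar_eq ⟨φ, hφ⟩ p hX
      exact ⟨⟨φ, hφ⟩, Quotient.sound ((hF _).equivalent h_zero h_one hp hf)⟩
  · intro p hu ε
    obtain rfl := hpar_eq u p hu
    exact ⟨exists_isExplicitCover h2 h_zero h_one (hgood u) ε,
      fun f hf => Quotient.sound ((hF u).equivalent h_zero h_one (hgood u) hf)⟩
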